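/- **Notation.** Let $k=\mathbb F_q$ be a finite field of characteristic two, $K=k((t))$, $\mathcal O_K=k[[t]]$ with maximal ideal $\mathfrak m_K$, $G_K=\mathrm{Gal}(K^{\mathrm{sep}}/K)$ and $\Gamma=\mathbb Z/2\mathbb Z$. Let $S_{K,\Gamma}$ be the set of continuous homomorphisms $G_K\to\Gamma$, and for $c:S_{K,\Gamma}\to\mathbb R$ put $$M(K,\Gamma,c)=\frac1{\sharp\Gamma}\sum_{\rho\in S_{K,\Gamma}}q^{-c(\rho)}\in[0,\infty].$$ For $\tau:\Gamma\to \mathrm{GL}_d(\mathcal O_K)$ and $\rho\in S_{K,\Gamma}$ let $\mathrm{Spec}\,M\to\mathrm{Spec}\,K$ be the étale $\Gamma$-torsor of $\rho$, $\mathcal O_M$ the integral closure of $\mathcal O_K$ in $M$, and $\Xi\subset\mathcal O_M^{\oplus d}$ the $\mathcal O_K$-submodule of the elements on which the action of $\Gamma$ through $\tau$ and the coordinatewise action on $\mathcal O_M$ coincide. Put $\mathbf v_\tau(\rho)=\frac1{\sharp\Gamma}\,\mathrm{length}_{\mathcal O_K}(\mathcal O_M^{\oplus d}/\mathcal O_M\cdot\Xi)$.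 For an $\mathcal O_K$-basis $\phi_1,\dots,\phi_d$ of $\Xi$ let $u:\mathbb A^d_{\mathcal O_M}\to\mathbb A^d_{\mathcal O_K}$ be given by $u^*(x_i)=\sum_j(\phi_j)_i\,y_j$, and put $\mathbf w_\tau(\rho)=\dim u^{-1}(o)-\mathbf v_\tau(\rho)$, where $o$ is the origin of the closed fibre $\mathbb A^d_k$. For $r\ge1$ let $K_r=k_r((t))$ with $[k_r:k]=r$. A function $f$ of the integers $r\ge1$ is *admissible* if $f(r)=\big(\sum_i n_i\alpha_i^r\big)/(q^{cr}-1)$ for all $r$, with a finite sum, $n_i\in\mathbb Z$, $\alpha_i\in\mathbb C^\times$, $0\ne c\in\mathbb Q$; then $(\mathbb D f)(r)=\big(\sum_i n_i\alpha_i^{-r}\big)/(q^{-cr}-1)$, which does not depend on the expression. If the functions $M(K_r,\Gamma,\mathbf v_\tau)$ and $M(K_r,\Gamma,-\mathbf w_\tau)$ of $r$ are finite and admissible, the *strong duality* is $\mathbb D(M(K_r,\Gamma,-\mathbf w_\tau))=M(K_r,\Gamma,\mathbf v_\tau)$, and the *weak duality* is $$M(K_r,\Gamma,\mathbf v_\tau)q^{rd}-M(K_r,\Gamma,-\mathbf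 w_\tau)=\mathbb D(M(K_r,\Gamma,-\mathbf w_\tau))q^{rd}-\mathbb D(M(K_r,\Gamma,\mathbf v_\tau)).$$ Let $\sigma_n$ ($n\ge1$) be the direct sum of $n$ copies of the two-dimensional representation of $\Gamma$ by transposition, let $\tau_m$ ($m\ge0$) be the representation in which the generator acts by $\begin{pmatrix}1&t^m\\0&1\end{pmatrix}$, and put $\upsilon_{m,n}=\tau_m\oplus\sigma_n$. **Theorem.** 1. For every $\rho\in S_{K,\Gamma}$ the discriminant of $\mathcal O_M/\mathcal O_K$ is $\mathfrak m_K^{2i}$ for some $i\ge0$. There are exactly two $\rho$ with $i=0$, and exactly $2(q-1)q^{i-1}$ for each $i\ge1$. 2. For the representations $\sigma_n$, $\tau_m$, $\upsilon_{m,n}$ ($n\ge1$, $m\ge0$), $\Xi$ is free of rank $d$ and the length above is finite. If $\rho$ has discriminant $\mathfrak m_K^{2i}$, then $\mathbf v_{\sigma_n}(\rho)=ni$; $\mathbf w_{\sigma_n}(\rho)=n-ni$ if $i\ge1$ and $0$ if $i=0$; $\mathbf v_{\tau_m}(\rho)=\mathbf w_{\tau_m}(\rho)=0$ if $i\le m$;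 $\mathbf v_{\tau_m}(\rho)=i-m$ and $\mathbf w_{\tau_m}(\rho)=1-i+m$ if $i>m$; and $\mathbf v_{\upsilon_{m,n}}=\mathbf v_{\tau_m}+\mathbf v_{\sigma_n}$, $\mathbf w_{\upsilon_{m,n}}=\mathbf w_{\tau_m}+\mathbf w_{\sigma_n}$. 3. For $n\ge1$, in $[0,\infty]$, $$M(K,\Gamma,\mathbf v_{\sigma_n})=1+\sum_{i\ge1}(q-1)q^{i-1}q^{-in},\qquad M(K,\Gamma,-\mathbf w_{\sigma_n})=1+\sum_{i\ge1}(q-1)q^{i-1}q^{-in+n}.$$ Both are $\infty$ for $n=1$. For $n\ge2$ they equal $1+\dfrac{(q-1)q^{-n}}{1-q^{1-n}}$ and $1+\dfrac{q-1}{1-q^{1-n}}$. 4. For every $n\ge2$ the functions $M(K_r,\Gamma,\mathbf v_{\sigma_n})$ and $M(K_r,\Gamma,-\mathbf w_{\sigma_n})$ are finite and admissible, and the strong duality and the weak duality (with $d=2n$) hold. 5. For $m\ge0$ and $n\ge1$, $$M(K,\Gamma,\mathbf v_{\upsilon_{m,n}})=1+\sum_{i=1}^m(q-1)q^{i-1}q^{-in}+\sum_{i>m}(q-1)q^{i-1}q^{-i+m-in},$$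 $$M(K,\Gamma,-\mathbf w_{\upsilon_{m,n}})=1+\sum_{i=1}^m(q-1)q^{i-1}q^{-in+n}+\sum_{i>m}(q-1)q^{i-1}q^{1-i+m-in+n}.$$ For $n\ge2$ they equal $$1+(q-1)q^{-n}\frac{1-q^{(1-n)m}}{1-q^{1-n}}+(q-1)\frac{q^{m-(m+1)n-1}}{1-q^{-n}}\quad\text{and}\quad 1+(q-1)\frac{1-q^{(1-n)m}}{1-q^{1-n}}+(q-1)\frac{q^{m-mn}}{1-q^{-n}},$$ and for $n=1$ they equal $1+\frac{m(q-1)}q+\frac1q$ and $1+m(q-1)+q$. 6. For $(m,n)=(1,1)$ the functions $M(K_r,\Gamma,\mathbf v_{\upsilon_{1,1}})$ and $M(K_r,\Gamma,-\mathbf w_{\upsilon_{1,1}})$ are finite and admissible, but the weak duality (with $d=4$) fails. -/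

import Mathlib

open scoped PowerSeries LaurentSeries ENNReal

noncomputable section

namespace TotalMass

section General

variable {O : Type*} (K : Type*) [CommRing O] [Field K] [Algebra O K]
variable (Γ : Type*) [Group Γ]

/-- The set `S_{K,Γ}` of continuous homomorphisms from the absolute Galois group
`G_K = Gal(K^sep / K)` (with its Krull topology) to the discrete group `Γ`. -/
abbrev GalHom : Type _ :=
  {ρ : Gal(SeparableClosure K/K) →* Γ // @Continuous _ Γ _ ⊥ ρ}

variable {K Γ}

/-- The étale `K`-algebra `M` of the `Γ`-torsor `Spec M → Spec K` attached to `ρ`: the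
algebra of the `G_K`-equivariant maps `f : Γ → K^sep`, where `g ∈ G_K` acts on `Γ` by left
multiplication by `ρ g`. -/
def torsorAlgebra (ρ : GalHom K Γ) : Subalgebra K (Γ → SeparableClosure K) where
  carrier := {f | ∀ (g : Gal(SeparableClosure K/K)) (γ : Γ), f (ρ.1 g * γ) = g (f γ)}
  mul_mem' ha hb g γ := by simp [ha g γ, hb g γ]
  add_mem' ha hb g γ := by simp [ha g γ, hb g γ]
  algebraMap_mem' c g γ := by simp [Pi.algebraMap_apply]

variable (O) in
/-- The integral closure of `O = O_K` in `M`, as a subalgebra of the algebra of all maps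
`Γ → K^sep`. -/
def torsorIntSubalgebra (ρ : GalHom K Γ) : Subalgebra O (Γ → SeparableClosure K) :=
  integralClosure O (Γ → SeparableClosure K) ⊓ (torsorAlgebra ρ).restrictScalars O

variable (O) in
/-- The integer ring `O_M` of `M`: the integral closure of `O` in `M`. -/
def TorsorInt (ρ : GalHom K Γ) : Type _ := torsorIntSubalgebra O ρ

instance (ρ : GalHom K Γ) : CommRing (TorsorInt O ρ) :=
  inferInstanceAs (CommRing (torsorIntSubalgebra O ρ))

instance (ρ : GalHom K Γ) : Algebra O (TorsorInt O ρ) :=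
  inferInstanceAs (Algebra O (torsorIntSubalgebra O ρ))

/-- Right translation of maps `Γ → K^sep` by `γ`. -/
def translate (O : Type*) [CommRing O] [Algebra O K] (γ : Γ) :
    (Γ → SeparableClosure K) →ₐ[O] (Γ → SeparableClosure K) where
  toFun f δ := f (δ * γ)
  map_one' := rfl
  map_mul' _ _ := rfl
  map_zero' := rfl
  map_add' _ _ := rfl
  commutes' _ := rfl

theorem translate_mem (ρ : GalHom K Γ) (γ : Γ) (f : Γ → SeparableClosure K)
    (hf : f ∈ torsorIntSubalgebra O ρ) : translate O γ f ∈ torsorIntSubalgebra O ρ := by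
  refine ⟨IsIntegral.map (translate O γ) hf.1, fun g δ => ?_⟩
  change f (ρ.1 g * δ * γ) = g (f (δ * γ))
  rw [mul_assoc]
  exact hf.2 g (δ * γ)

/-- The (left) action of `Γ` on `O_M` induced from the action `(γ • f)(δ) = f (δ * γ)` on `M`. -/
def torsorAct (ρ : GalHom K Γ) (γ : Γ) : TorsorInt O ρ →ₐ[O] TorsorInt O ρ :=
  ((translate O γ).comp (torsorIntSubalgebra O ρ).val).codRestrict (torsorIntSubalgebra O ρ)
    fun f => translate_mem ρ γ f.1 f.2

variable (O) in
/-- The discriminant ideal of `O_M / O`, generated by the discriminants of all families of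
`♯Γ = rank O_M` elements of `O_M`. If `ρ` is surjective then `M` is the Galois
extension `L / K` cut out by `ρ`, and this is the discriminant of `L / K`. -/
def discrIdeal (ρ : GalHom K Γ) : Ideal O :=
  Ideal.span (Set.range fun b : Fin (Nat.card Γ) → TorsorInt O ρ => Algebra.discr O b)

variable {ι : Type*} [Fintype ι] [DecidableEq ι]

/-- The tuning submodule `Ξ ⊆ O_M^d`: the elements on which the action of `Γ` through `τ` and
the coordinatewise action of `Γ` on `O_M` coincide. -/
def tuning (τ : Γ →* GL ι O) (ρ : GalHom K Γ) : Submodule O (ι → TorsorInt O ρ) where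
  carrier := {x | ∀ (γ : Γ) (i : ι),
    ∑ j, (τ γ : Matrix ι ι O) i j • x j = torsorAct ρ γ (x i)}
  add_mem' ha hb γ i := by simp [smul_add, Finset.sum_add_distrib, ha γ i, hb γ i]
  zero_mem' γ i := by simp
  smul_mem' c x hx γ i := by
    simp only [Pi.smul_apply, map_smul, ← hx γ i, Finset.smul_sum]
    exact Finset.sum_congr rfl fun j _ => smul_comm _ _ _

/-- The length of the `O`-module `O_M^d / (O_M · Ξ)`. -/
def tuningLength (τ : Γ →* GL ι O) (ρ : GalHom K Γ) : ℕ∞ :=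
  Module.length O ((ι → TorsorInt O ρ) ⧸
    Submodule.span (TorsorInt O ρ) (tuning τ ρ : Set (ι → TorsorInt O ρ)))

/-- The function `v_τ : S_{K,Γ} → ℝ`. -/
def vFun (τ : Γ →* GL ι O) (ρ : GalHom K Γ) : ℝ :=
  ((tuningLength τ ρ).toNat : ℝ) / Nat.card Γ

/-- The homomorphism `u^* : O[x] → O_M[y]`, `x_i ↦ ∑_j φ_j(x_i) y_j`, attached to a basis `φ`
of the tuning submodule; `φ_j(x_i)` is the `i`-th coordinate of `φ_j`. -/
def uStar (τ : Γ →* GL ι O) (ρ : GalHom K Γ) (φ : Module.Basis ι O (tuning τ ρ)) :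
    MvPolynomial ι O →ₐ[O] MvPolynomial ι (TorsorInt O ρ) :=
  MvPolynomial.aeval fun i =>
    ∑ j, MvPolynomial.C ((φ j : ι → TorsorInt O ρ) i) * MvPolynomial.X j

variable [IsLocalRing O]

variable (O ι) in
/-- The ideal of the origin `o : Spec k → 𝔸^d_O`, i.e. the kernel of `O[x] → k`, `x_i ↦ 0`. -/
def originIdeal : Ideal (MvPolynomial ι O) :=
  RingHom.ker ((IsLocalRing.residue O).comp (MvPolynomial.constantCoeff (σ := ι)))

/-- The coordinate ring of the scheme-theoretic fibre `u⁻¹(o)`. -/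
abbrev fiberRing (τ : Γ →* GL ι O) (ρ : GalHom K Γ) (φ : Module.Basis ι O (tuning τ ρ)) :
    Type _ :=
  MvPolynomial ι (TorsorInt O ρ) ⧸ (originIdeal O ι).map (uStar τ ρ φ)

open Classical in
/-- The dimension of `u⁻¹(o)`, for some `O`-basis of `Ξ` (it does not depend on the basis:
a change of basis is a linear change of the variables `y`). -/
def fiberDim (τ : Γ →* GL ι O) (ρ : GalHom K Γ) : ℕ :=
  if h : Nonempty (Module.Basis ι O (tuning τ ρ)) then
    ((ringKrullDim (fiberRing τ ρ h.some)).unbotD 0).toNat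
  else 0

/-- The weight function `w_τ = dim u⁻¹(o) - v_τ : S_{K,Γ} → ℝ`. -/
def wFun (τ : Γ →* GL ι O) (ρ : GalHom K Γ) : ℝ :=
  (fiberDim τ ρ : ℝ) - vFun τ ρ

variable (O) in
/-- The total mass `M(K,Γ,c) = (1/♯Γ) ∑_ρ q^{-c(ρ)} ∈ [0,∞]`, where `q` is the cardinality of the
residue field of `O = O_K`. -/
def mass (c : GalHom K Γ → ℝ) : ℝ≥0∞ :=
  (Nat.card Γ : ℝ≥0∞)⁻¹ *
    ∑' ρ : GalHom K Γ, ENNReal.ofReal ((Nat.card (IsLocalRing.ResidueField O) : ℝ) ^ (-c ρ))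

end General

/-! ### Admissible functions and their duals -/

/-- An expression `r ↦ (∑ n_i α_i^r) / (q^{cr} - 1)` with `c ∈ ℚ` nonzero, `n_i ∈ ℤ`,
`α_i ∈ ℂ` nonzero. -/
structure AdmExpr where
  c : ℚ
  c_ne : c ≠ 0
  l : ℕ
  n : Fin l → ℤ
  α : Fin l → ℂ
  α_ne : ∀ i, α i ≠ 0

/-- The function `r ↦ (∑ n_i α_i^r) / (q^{cr} - 1)`. -/
def AdmExpr.eval (q : ℕ) (e : AdmExpr) (r : ℕ+) : ℂ :=
  (∑ i, (e.n i : ℂ) * e.α i ^ (r : ℕ)) / (((q : ℝ) ^ ((e.c : ℝ) * (r : ℝ)) : ℝ) - 1)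

/-- The function `r ↦ (∑ n_i α_i^{-r}) / (q^{-cr} - 1)`. -/
def AdmExpr.evalDual (q : ℕ) (e : AdmExpr) (r : ℕ+) : ℂ :=
  (∑ i, (e.n i : ℂ) * e.α i ^ (-(r : ℤ))) / (((q : ℝ) ^ (-(e.c : ℝ) * (r : ℝ)) : ℝ) - 1)

/-- `f : ℕ → ℂ` (positive integers) is admissible (with respect to `q`). -/
def IsAdmissible (q : ℕ) (f : ℕ+ → ℂ) : Prop :=
  ∃ e : AdmExpr, ∀ r, f r = e.eval q r

open Classical in
/-- The dual `𝔻 f` of an admissible function (and `0` if `f` is not admissible). It does not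
depend on the expression of `f`, see `dual_eq`. -/
def dual (q : ℕ) (f : ℕ+ → ℂ) : ℕ+ → ℂ :=
  if h : IsAdmissible q f then h.choose.evalDual q else 0

theorem sum_zpow_neg_eq_zero {ι : Type*} [Fintype ι] (n : ι → ℂ) (α : ι → ℂ)
    (hα : ∀ i, α i ≠ 0) (h : ∀ r : ℕ+, ∑ i, n i * α i ^ (r : ℕ) = 0) (s : ℤ) :
    ∑ i, n i * α i ^ s = 0 := by
  classical
  have hP : ∀ P : Polynomial ℂ, ∑ i, n i * α i * P.eval (α i) = 0 := by
    intro P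
    induction P using Polynomial.induction_on' with
    | add p q hp hq => simp [mul_add, Finset.sum_add_distrib, hp, hq]
    | monomial k a =>
      have := h ⟨k + 1, Nat.succ_pos k⟩
      simp only [PNat.mk_coe] at this
      simp only [Polynomial.eval_monomial]
      calc ∑ i, n i * α i * (a * α i ^ k) = a * ∑ i, n i * α i ^ (k + 1) := by
            rw [Finset.mul_sum]; exact Finset.sum_congr rfl fun i _ => by ring
        _ = 0 := by rw [this, mul_zero]
  have := hP (Lagrange.interpolate (Finset.univ.image α) id (fun z => z ^ (s - 1)))
  rw [← this]
  refine Finset.sum_congr rfl fun i _ => ?_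
  have hi := Lagrange.eval_interpolate_at_node (s := Finset.univ.image α) (v := id)
    (fun z : ℂ => z ^ (s - 1)) (Function.injective_id.injOn)
    (Finset.mem_image_of_mem α (Finset.mem_univ i))
  simp only [id] at hi
  rw [hi, mul_assoc, ← zpow_one_add₀ (hα i)]
  congr 2
  ring

theorem evalDual_eq (q : ℕ) (hq : 1 < q) (e e' : AdmExpr) (h : ∀ r, e.eval q r = e'.eval q r)
    (r : ℕ+) : e.evalDual q r = e'.evalDual q r := by
  have hq0 : (0 : ℝ) < q := by positivity
  have hq1 : (1 : ℝ) < q := by exact_mod_cast hq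
  have hne : ∀ x : ℝ, x ≠ 0 → (((q : ℝ) ^ x : ℝ) : ℂ) - 1 ≠ 0 := by
    intro x hx h0
    have h1 : (q : ℝ) ^ x = 1 := by
      have := sub_eq_zero.1 h0
      exact_mod_cast this
    rcases lt_or_gt_of_ne hx with h2 | h2
    · exact (Real.rpow_lt_one_of_one_lt_of_neg hq1 h2).ne h1
    · exact (Real.one_lt_rpow hq1 h2).ne' h1
  have hr0 : ∀ r : ℕ+, ((r : ℕ) : ℝ) ≠ 0 := fun r => by exact_mod_cast r.ne_zero
  have hc : ∀ (e : AdmExpr) (r : ℕ+), (e.c : ℝ) * ((r : ℕ) : ℝ) ≠ 0 := fun e r =>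
    mul_ne_zero (by exact_mod_cast e.c_ne) (hr0 r)
  -- the exponential sum whose vanishing at positive integers expresses the hypothesis
  let I := (Fin e.l ⊕ Fin e.l) ⊕ (Fin e'.l ⊕ Fin e'.l)
  let Q : ℝ → ℂ := fun x => (((q : ℝ) ^ x : ℝ) : ℂ)
  let A : I → ℂ := Sum.elim
    (Sum.elim (fun i => Q e'.c * e.α i) (fun i => e.α i))
    (Sum.elim (fun i => Q e.c * e'.α i) (fun i => e'.α i))
  let N : I → ℂ := Sum.elim
    (Sum.elim (fun i => e.n i) (fun i => -e.n i))
    (Sum.elim (fun i => -e'.n i) (fun i => e'.n i))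
  have hQ : ∀ x, Q x ≠ 0 := fun x => by
    simp only [Q]
    exact_mod_cast (Real.rpow_pos_of_pos hq0 x).ne'
  have hA : ∀ i, A i ≠ 0 := by
    rintro ((i | i) | (i | i)) <;> simp [A, hQ, e.α_ne, e'.α_ne]
  have hQz : ∀ (x : ℝ) (s : ℤ), Q x ^ s = Q (x * s) := by
    intro x s
    simp only [Q]
    rw [Real.rpow_mul hq0.le, Real.rpow_intCast]
    push_cast
    rfl
  have key : ∀ s : ℤ, ∑ i, N i * A i ^ s
      = (Q (e'.c * s) - 1) * (∑ i, (e.n i : ℂ) * e.α i ^ s)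
        - (Q (e.c * s) - 1) * (∑ i, (e'.n i : ℂ) * e'.α i ^ s) := by
    intro s
    simp only [I, N, A, Fintype.sum_sum_type, Sum.elim_inl, Sum.elim_inr, mul_zpow, hQz]
    simp only [sub_mul, one_mul, neg_mul, Finset.sum_neg_distrib]
    have e1 : ∀ i, (e.n i : ℂ) * (Q (e'.c * s) * e.α i ^ s)
        = Q (e'.c * s) * ((e.n i : ℂ) * e.α i ^ s) := fun i => by ring
    have e2 : ∀ i, (e'.n i : ℂ) * (Q (e.c * s) * e'.α i ^ s)
        = Q (e.c * s) * ((e'.n i : ℂ) * e'.α i ^ s) := fun i => by ring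
    simp only [e1, e2, ← Finset.mul_sum]
    ring
  have hvan := sum_zpow_neg_eq_zero N A hA (fun r => by
    have h1 := h r
    unfold AdmExpr.eval at h1
    rw [div_eq_div_iff (hne _ (hc e r)) (hne _ (hc e' r))] at h1
    have h2 := key ((r : ℕ) : ℤ)
    simp only [zpow_natCast, Int.cast_natCast] at h2
    rw [h2]
    simp only [Q]
    linear_combination h1) (-((r : ℕ) : ℤ))
  rw [key] at hvan
  unfold AdmExpr.evalDual
  rw [div_eq_div_iff (hne _ (by rw [neg_mul]; exact neg_ne_zero.2 (hc e r)))
    (hne _ (by rw [neg_mul]; exact neg_ne_zero.2 (hc e' r)))]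
  simp only [Q, Int.cast_neg, Int.cast_natCast] at hvan
  simp only [neg_mul]
  simp only [mul_neg] at hvan
  linear_combination hvan

/-- The dual function does not depend on the chosen expression. -/
theorem dual_eq (q : ℕ) (hq : 1 < q) (f : ℕ+ → ℂ) (e : AdmExpr) (h : ∀ r, f r = e.eval q r) :
    dual q f = e.evalDual q := by
  have hf : IsAdmissible q f := ⟨e, h⟩
  unfold dual
  rw [dif_pos hf]
  funext r
  exact evalDual_eq q hq _ _ (fun r => (hf.choose_spec r).symm.trans (h r)) r

/-- The strong duality `𝔻(M_w) = M_v` between two functions `M_v`, `M_w` of `r`. -/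
def StrongDuality (q : ℕ) (Mv Mw : ℕ+ → ℂ) : Prop :=
  ∀ r, dual q Mw r = Mv r

/-- The weak duality `M_v q^{rd} - M_w = 𝔻(M_w) q^{rd} - 𝔻(M_v)`. -/
def WeakDuality (q d : ℕ) (Mv Mw : ℕ+ → ℂ) : Prop :=
  ∀ r : ℕ+, Mv r * (q : ℂ) ^ ((r : ℕ) * d) - Mw r
    = dual q Mw r * (q : ℂ) ^ ((r : ℕ) * d) - dual q Mv r

/-! ### Constructions of representations -/

section Representations

variable {Γ O ι κ : Type*} [Group Γ] [CommRing O] [Fintype ι] [DecidableEq ι]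
  [Fintype κ] [DecidableEq κ]

/-- The direct sum of two representations. -/
def repSum (τ₁ : Γ →* GL ι O) (τ₂ : Γ →* GL κ O) : Γ →* GL (ι ⊕ κ) O :=
  MonoidHom.toHomUnits
    { toFun := fun γ => Matrix.fromBlocks (τ₁ γ : Matrix ι ι O) 0 0 (τ₂ γ : Matrix κ κ O)
      map_one' := by simp
      map_mul' := fun a b => by simp [Matrix.fromBlocks_multiply] }

/-- The direct sum of `n` copies of a representation. -/
def repCopies (n : ℕ) (τ : Γ →* GL ι O) : Γ →* GL (ι × Fin n) O :=
  MonoidHom.toHomUnits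
    { toFun := fun γ => Matrix.blockDiagonal fun _ : Fin n => (τ γ : Matrix ι ι O)
      map_one' := by
        rw [map_one]
        exact Matrix.blockDiagonal_one
      map_mul' := fun a b => by
        rw [map_mul, ← Matrix.blockDiagonal_mul]
        rfl }

/-- The representation of `ℤ/2` in which the non-trivial element acts by the matrix `A`, where
`A * A = 1`. -/
def involutionRep (A : Matrix ι ι O) (hA : A * A = 1) :
    Multiplicative (ZMod 2) →* GL ι O :=
  MonoidHom.toHomUnits
    { toFun := fun γ => if γ = 1 then 1 else A
      map_one' := by simp
      map_mul' := fun a b => by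
        have key : ∀ a b : Multiplicative (ZMod 2),
            (a = 1 ∨ b = 1) ∨ (a ≠ 1 ∧ b ≠ 1 ∧ a * b = 1) := by decide
        rcases key a b with (h | h) | ⟨h1, h2, h3⟩
        · simp [h]
        · simp [h]
        · simp [h1, h2, h3, hA] }

/-- The two-dimensional representation of `ℤ/2` by transposition. -/
def transposition (O : Type*) [CommRing O] : Multiplicative (ZMod 2) →* GL (Fin 2) O :=
  involutionRep !![0, 1; 1, 0] (by simp [Matrix.one_fin_two])

/-- `σ_n`: the direct sum of `n` copies of the transposition representation. -/
def sigmaRep (O : Type*) [CommRing O] (n : ℕ) :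
    Multiplicative (ZMod 2) →* GL (Fin 2 × Fin n) O :=
  repCopies n (transposition O)

/-- `τ_m` over `k[[t]]`, `k` of characteristic two: the non-trivial element of `ℤ/2` acts by the
matrix with rows `(1, t^m)` and `(0, 1)`. -/
def tauRep (k : Type*) [Field k] [CharP k 2] (m : ℕ) :
    Multiplicative (ZMod 2) →* GL (Fin 2) k⟦X⟧ :=
  involutionRep !![1, PowerSeries.X ^ m; 0, 1] (by
    have h2 : (PowerSeries.X ^ m + PowerSeries.X ^ m : k⟦X⟧) = 0 := by
      ext i
      rw [map_add]
      exact CharTwo.add_self_eq_zero _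
    simp [Matrix.one_fin_two, h2])

/-- `υ_{m,n} = τ_m ⊕ σ_n`. -/
def upsilonRep (k : Type*) [Field k] [CharP k 2] (m n : ℕ) :
    Multiplicative (ZMod 2) →* GL (Fin 2 ⊕ Fin 2 × Fin n) k⟦X⟧ :=
  repSum (tauRep k m) (sigmaRep k⟦X⟧ n)

end Representations

/-! ### Total masses over the unramified extensions of `k((t))` -/

section Unramified

variable {k : Type*} [Field k] [Finite k] [CharP k 2] {Γ : Type*} [Group Γ]
variable {ι : Type*} [Fintype ι] [DecidableEq ι]

/-- The residue field `k_r` of `K_r`: the extension of degree `r` of the finite field `k`. The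
unramified extension `K_r` of degree `r` of `K = k((t))` is `k_r((t))`. -/
abbrev resExt (k : Type*) [Field k] [Finite k] [CharP k 2] (r : ℕ+) : Type :=
  FiniteField.Extension k 2 (r : ℕ)

/-- The representation over the integer ring `k_r[[t]]` of `K_r` induced by a representation
over `k[[t]]`. -/
def baseChange (τ : Γ →* GL ι k⟦X⟧) (r : ℕ+) : Γ →* GL ι (resExt k r)⟦X⟧ :=
  (Matrix.GeneralLinearGroup.map (PowerSeries.map (algebraMap k (resExt k r)))).comp τ

/-- `M(K_r, Γ, v_τ) ∈ [0,∞]`. -/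
def massV (τ : Γ →* GL ι k⟦X⟧) (r : ℕ+) : ℝ≥0∞ :=
  mass (resExt k r)⟦X⟧ (K := (resExt k r)⸨X⸩) (vFun (baseChange τ r))

/-- `M(K_r, Γ, -w_τ) ∈ [0,∞]`. -/
def massW (τ : Γ →* GL ι k⟦X⟧) (r : ℕ+) : ℝ≥0∞ :=
  mass (resExt k r)⟦X⟧ (K := (resExt k r)⸨X⸩) (fun ρ => -wFun (baseChange τ r) ρ)

/-- A function of `r` with values in `[0,∞]`, viewed as a complex-valued function (to be used
where all its values are finite). -/
def toComplexFun (f : ℕ+ → ℝ≥0∞) (r : ℕ+) : ℂ := ((f r).toReal : ℂ)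

end Unramified

end TotalMass

end

/-! Everything is governed by one integer attached to `ρ`, the `i` of `HasConductor`: `O_M = O[π]`
with `π ^ 2 = ϖ ^ i π + b` and `π` conjugate to `π + ϖ ^ i`. The argument has three layers.

Linear algebra. If the generators of `Ξ` form a matrix `R * D * C` over `O_M`, with `R`, `C`
invertible and `D` diagonal with entries `ϖ ^ e_j`, then `O_M^d / O_M Ξ` has length `2 ∑ e_j`. The
fibre `u⁻¹(o)` is an affine space over the artinian ring `O_M / ϖ` with one variable for each `e_j >
0`. Hence `v = ∑ e_j` and `w = #{j | e_j > 0} - v`. Solving the tuning equations in the basis `1, π`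
gives exponents `0, i` for the transposition (`isTuned_transposition`) and `0, i - m`, truncated at
zero, for `τ_m` (`isTuned_involutionRep_upper`). Exponents are concatenated under direct sums.

Counting. By Artin–Schreier theory the homomorphisms `ρ` correspond to the classes of `K` modulo the
elements `x ^ 2 + x`. Since `k` is finite, each class has exactly one representative `d + ∑_{l < i}
p_l t^{-(2l+1)}` with `d` in a fixed set `{0, c}` and `p_{i-1} ≠ 0` if `i > 0` (`exists_redForm`,
`redForm_eq_wp`). The odd pole order `2i - 1` makes `t^i α` generate the integers
(`norm_form_integral`, `IsASGen.hasConductor`), so the integer of `ρ` is `i` and the discriminant is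
`t^{2i}`. Counting coefficients gives `2` and `2 (q - 1) q^{i-1}`.

Summation. The masses are geometric series in `i`, and over `K_r` one replaces `q` by `Q = q^r`. The
operator `𝔻` replaces `Q` by `Q⁻¹`. For `σ_n` this exchanges the two masses. For `υ_{1,1}` they are
`2` and `2Q`, and the weak duality already fails at `r = 1`. -/

noncomputable section

namespace TotalMass

/-! ### Length and fibre dimension from elementary divisors -/

section SmithForm

variable {O A ι : Type*} [CommRing O] [CommRing A] [Algebra O A] [Fintype ι] [DecidableEq ι]

variable (A) in
/-- The diagonal matrix with entries `ϖ ^ e i` over `A`. -/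
def diagPow (ϖ : O) (e : ι → ℕ) : Matrix ι ι A :=
  Matrix.diagonal fun i => algebraMap O A (ϖ ^ e i)

/-- Turns divisibility in `A` by a scalar of `O` into a condition on coordinates, so that lengths
can be computed over `O`. -/
theorem repr_mem_span_iff (B : Module.Basis (Fin 2) O A) (x : O) (a : A) :
    (∀ j, B.repr a j ∈ Ideal.span {x}) ↔ ∃ b, a = algebraMap O A x * b := by
  constructor
  · intro h
    choose c hc using fun j => Ideal.mem_span_singleton.1 (h j)
    refine ⟨∑ j, c j • B j, ?_⟩
    conv_lhs => rw [← B.sum_repr a]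
    rw [Finset.mul_sum]
    refine Finset.sum_congr rfl fun j _ => ?_
    rw [hc j, mul_smul, Algebra.smul_def x]
  · rintro ⟨b, rfl⟩ j
    rw [← Algebra.smul_def, map_smul]
    exact Ideal.mem_span_singleton.2 ⟨_, rfl⟩

/-- The length of the cokernel of a matrix with elementary divisors `ϖ ^ e i` over a free
algebra of rank two. -/
theorem length_quotient_range [IsDomain O] [IsDiscreteValuationRing O] {ϖ : O}
    (hϖ : Irreducible ϖ) (B : Module.Basis (Fin 2) O A) (e : ι → ℕ) (R C : GL ι A) :
    Module.length O ((ι → A) ⧸ LinearMap.range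
      (Matrix.mulVecLin ((R : Matrix ι ι A) * diagPow A ϖ e * (C : Matrix ι ι A))))
      = ((2 * ∑ i, e i : ℕ) : ℕ∞) := by
  set Φ := (R : Matrix ι ι A) * diagPow A ϖ e * (C : Matrix ι ι A)
  -- `f` undoes `R` and reduces both coordinates of the `i`-th entry modulo `ϖ ^ e i`. As `C` is
  -- invertible, its kernel is exactly the range of `Φ`, so the cokernel is a product of cyclic
  -- modules.
  let f : (ι → A) →ₗ[O] (∀ i : ι, Fin 2 → O ⧸ Ideal.span {ϖ ^ e i}) :=
    LinearMap.pi fun i => LinearMap.pi fun j =>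
      (Submodule.mkQ (Ideal.span {ϖ ^ e i})) ∘ₗ (Finsupp.lapply j) ∘ₗ B.repr.toLinearMap ∘ₗ
        (LinearMap.proj i) ∘ₗ
          ((Matrix.mulVecLin ((R⁻¹ : GL ι A) : Matrix ι ι A)).restrictScalars O)
  have hf : ∀ x i j, f x i j = Submodule.Quotient.mk
      (B.repr ((((R⁻¹ : GL ι A) : Matrix ι ι A).mulVec x) i) j) := fun _ _ _ => rfl
  have hRR : (R : Matrix ι ι A) * ((R⁻¹ : GL ι A) : Matrix ι ι A) = 1 := by
    rw [← Units.val_mul, mul_inv_cancel, Units.val_one]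
  have hRR' : ((R⁻¹ : GL ι A) : Matrix ι ι A) * (R : Matrix ι ι A) = 1 := by
    rw [← Units.val_mul, inv_mul_cancel, Units.val_one]
  have hCC : (C : Matrix ι ι A) * ((C⁻¹ : GL ι A) : Matrix ι ι A) = 1 := by
    rw [← Units.val_mul, mul_inv_cancel, Units.val_one]
  have hsurj : Function.Surjective f := by
    intro y
    choose z hz using fun i j => Submodule.mkQ_surjective _ (y i j)
    refine ⟨(R : Matrix ι ι A).mulVec fun i => ∑ j, z i j • B j, ?_⟩
    funext i j
    rw [hf, Matrix.mulVec_mulVec, hRR', Matrix.one_mulVec, B.repr_sum_self]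
    exact hz i j
  have hker : LinearMap.ker f = (LinearMap.range (Matrix.mulVecLin Φ)).restrictScalars O := by
    ext x
    rw [LinearMap.mem_ker, Submodule.restrictScalars_mem, LinearMap.mem_range]
    have h1 : f x = 0 ↔ ∀ i, ∃ b, (((R⁻¹ : GL ι A) : Matrix ι ι A).mulVec x) i
        = algebraMap O A (ϖ ^ e i) * b := by
      simp_rw [← repr_mem_span_iff B, funext_iff, hf, Pi.zero_apply,
        Submodule.Quotient.mk_eq_zero]
    rw [h1]
    constructor
    · intro h
      choose b hb using h
      refine ⟨((C⁻¹ : GL ι A) : Matrix ι ι A).mulVec b, ?_⟩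
      rw [Matrix.mulVecLin_apply, Matrix.mulVec_mulVec, Matrix.mul_assoc, hCC, Matrix.mul_one,
        ← Matrix.mulVec_mulVec]
      have : (diagPow A ϖ e).mulVec b = ((R⁻¹ : GL ι A) : Matrix ι ι A).mulVec x := by
        funext i
        rw [hb i, diagPow, Matrix.mulVec_diagonal]
      rw [this, Matrix.mulVec_mulVec, hRR, Matrix.one_mulVec]
    · rintro ⟨y, rfl⟩ i
      refine ⟨((C : Matrix ι ι A).mulVec y) i, ?_⟩
      rw [Matrix.mulVecLin_apply, Matrix.mulVec_mulVec, ← Matrix.mul_assoc, ← Matrix.mul_assoc,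
        hRR', Matrix.one_mul, ← Matrix.mulVec_mulVec, diagPow, Matrix.mulVec_diagonal]
  have e1 := (Submodule.quotEquivOfEq _ _ hker).symm ≪≫ₗ f.quotKerEquivOfSurjective hsurj
  have e2 := Submodule.Quotient.restrictScalarsEquiv O (LinearMap.range (Matrix.mulVecLin Φ))
  rw [← e2.length_eq, e1.length_eq, Module.length_pi_of_fintype]
  have hlen : ∀ n : ℕ, Module.length O (O ⧸ Ideal.span {ϖ ^ n}) = (n : ℕ∞) := by
    intro n
    have := Ring.ord_pow (R := O) (mem_nonZeroDivisors_of_ne_zero hϖ.ne_zero) n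
    rw [Ring.ord_of_irreducible hϖ] at this
    simpa [Ring.ord] using this
  simp only [Module.length_pi_of_fintype, hlen, Finset.sum_const, Finset.card_univ,
    Fintype.card_fin, nsmul_eq_mul]
  push_cast
  rw [Finset.mul_sum]

/-- The algebra automorphism of the polynomial ring given by an invertible linear change of
variables. -/
def linearChange (C : GL ι A) : MvPolynomial ι A ≃ₐ[A] MvPolynomial ι A :=
  have key : ∀ C : GL ι A, ((MvPolynomial.aeval fun i => ∑ j, MvPolynomial.C
      ((C : Matrix ι ι A) i j) * MvPolynomial.X j : MvPolynomial ι A →ₐ[A] MvPolynomial ι A).comp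
      (MvPolynomial.aeval fun i => ∑ j, MvPolynomial.C
      (((C⁻¹ : GL ι A) : Matrix ι ι A) i j) * MvPolynomial.X j)) = AlgHom.id A _ := by
    intro C
    refine MvPolynomial.algHom_ext fun i => ?_
    have h : ∀ l, ∑ j, ((C⁻¹ : GL ι A) : Matrix ι ι A) i j * (C : Matrix ι ι A) j l
        = (1 : Matrix ι ι A) i l := fun l => by
      rw [← Matrix.mul_apply, ← Units.val_mul, inv_mul_cancel, Units.val_one]
    simp only [AlgHom.comp_apply, MvPolynomial.aeval_X, map_sum, map_mul, MvPolynomial.algHom_C,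
      MvPolynomial.algebraMap_eq, Finset.mul_sum, AlgHom.id_apply]
    rw [Finset.sum_comm]
    simp only [← mul_assoc, ← map_mul, ← Finset.sum_mul, ← map_sum, h]
    simp [Matrix.one_apply]
  AlgEquiv.ofAlgHom (MvPolynomial.aeval fun i => ∑ j, MvPolynomial.C
      ((C : Matrix ι ι A) i j) * MvPolynomial.X j)
    (MvPolynomial.aeval fun i => ∑ j, MvPolynomial.C
      (((C⁻¹ : GL ι A) : Matrix ι ι A) i j) * MvPolynomial.X j)
    (key C) (by simpa using key C⁻¹)

theorem linearChange_X (C : GL ι A) (i : ι) : linearChange C (MvPolynomial.X i)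
    = ∑ j, MvPolynomial.C ((C : Matrix ι ι A) i j) * MvPolynomial.X j := by
  simp [linearChange]

/-- The ideal generated by `ϖ` and the linear forms given by the rows of `Φ`. -/
def formIdeal (ϖ : O) (Φ : Matrix ι ι A) : Ideal (MvPolynomial ι A) :=
  Ideal.span {MvPolynomial.C (algebraMap O A ϖ)} ⊔
    Ideal.span (Set.range fun i => ∑ j, MvPolynomial.C (Φ i j) * MvPolynomial.X j)

theorem formIdeal_mul_le (ϖ : O) (R Φ : Matrix ι ι A) :
    formIdeal ϖ (R * Φ) ≤ formIdeal ϖ Φ := by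
  refine sup_le_sup le_rfl (Ideal.span_le.2 ?_)
  rintro _ ⟨i, rfl⟩
  have : ∑ j, MvPolynomial.C ((R * Φ) i j) * MvPolynomial.X j
      = ∑ l, MvPolynomial.C (R i l) *
        ∑ j, MvPolynomial.C (Φ l j) * (MvPolynomial.X j : MvPolynomial ι A) := by
    simp only [Matrix.mul_apply, map_sum, map_mul, Finset.sum_mul, Finset.mul_sum, mul_assoc]
    exact Finset.sum_comm
  simp only [this]
  exact Ideal.sum_mem _ fun l _ => Ideal.mul_mem_left _ _ (Ideal.subset_span ⟨l, rfl⟩)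

theorem formIdeal_units_mul (ϖ : O) (R : GL ι A) (Φ : Matrix ι ι A) :
    formIdeal ϖ ((R : Matrix ι ι A) * Φ) = formIdeal ϖ Φ := by
  refine le_antisymm (formIdeal_mul_le _ _ _) ?_
  have := formIdeal_mul_le ϖ ((R⁻¹ : GL ι A) : Matrix ι ι A) ((R : Matrix ι ι A) * Φ)
  rwa [← Matrix.mul_assoc, ← Units.val_mul, inv_mul_cancel, Units.val_one, Matrix.one_mul] at this

/-- Right multiplication by `C` is a linear substitution of the variables. Together with
`formIdeal_units_mul` this leaves only the diagonal factor to be studied. -/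
theorem formIdeal_map_linearChange (ϖ : O) (Φ : Matrix ι ι A) (C : GL ι A) :
    (formIdeal ϖ Φ).map (linearChange C : MvPolynomial ι A →+* MvPolynomial ι A)
      = formIdeal ϖ (Φ * (C : Matrix ι ι A)) := by
  rw [formIdeal, Ideal.map_sup, Ideal.map_span, Ideal.map_span, formIdeal]
  congr 2
  · simp [linearChange, MvPolynomial.algHom_C]
  · rw [← Set.range_comp]
    congr 1
    funext i
    have hC : ∀ a : A, linearChange C (MvPolynomial.C a) = MvPolynomial.C a := fun a =>
      (linearChange C).commutes a
    simp only [Function.comp_apply, RingHom.coe_coe, map_sum, map_mul, hC, linearChange_X,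
      Matrix.mul_apply, Finset.mul_sum, Finset.sum_mul, mul_assoc]
    exact Finset.sum_comm

/-- The quotient by the form ideal of a diagonal matrix is a polynomial ring. -/
theorem nonempty_quotient_formIdeal_diagPow (ϖ : O) (e : ι → ℕ) :
    Nonempty ((MvPolynomial ι A ⧸ formIdeal ϖ (diagPow A ϖ e)) ≃+*
      MvPolynomial {i // 0 < e i} (A ⧸ Ideal.span {algebraMap O A ϖ})) := by
  classical
  set I := formIdeal ϖ (diagPow A ϖ e)
  have hrow : ∀ i, ∑ j, MvPolynomial.C (diagPow A ϖ e i j) * (MvPolynomial.X j : MvPolynomial ι A)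
      = MvPolynomial.C (algebraMap O A (ϖ ^ e i)) * MvPolynomial.X i := by
    intro i
    rw [Finset.sum_eq_single i]
    · simp [diagPow]
    · intro j _ hj
      simp [diagPow, Matrix.diagonal_apply_ne _ hj.symm]
    · simp
  have hϖ : MvPolynomial.C (algebraMap O A ϖ) ∈ I :=
    Ideal.mem_sup_left (Ideal.subset_span rfl)
  have hX : ∀ i, ¬ 0 < e i → MvPolynomial.X i ∈ I := by
    intro i hi
    refine Ideal.mem_sup_right (Ideal.subset_span ⟨i, ?_⟩)
    simp only [hrow]
    simp [Nat.eq_zero_of_not_pos hi]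
  -- If `e i = 0` the `i`-th form is the variable itself, which is killed. If `e i > 0` the form is
  -- a multiple of `ϖ`, already in the ideal, and the variable survives.
  let f₀ : MvPolynomial ι A →+* MvPolynomial {i // 0 < e i} (A ⧸ Ideal.span {algebraMap O A ϖ}) :=
    MvPolynomial.eval₂Hom (MvPolynomial.C.comp (Ideal.Quotient.mk _))
      fun i => if h : 0 < e i then MvPolynomial.X ⟨i, h⟩ else 0
  have hmk : Ideal.Quotient.mk (Ideal.span {algebraMap O A ϖ}) (algebraMap O A ϖ) = 0 :=
    Ideal.Quotient.eq_zero_iff_mem.2 (Ideal.mem_span_singleton_self _)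
  have hf₀ : I ≤ RingHom.ker f₀ := by
    refine sup_le (Ideal.span_le.2 ?_) (Ideal.span_le.2 ?_)
    · rintro _ rfl
      simp [f₀, RingHom.mem_ker, hmk]
    · rintro _ ⟨i, rfl⟩
      simp only [hrow, SetLike.mem_coe, RingHom.mem_ker, map_mul]
      by_cases h : 0 < e i
      · simp [f₀, hmk, h.ne']
      · simp [f₀, h]
  let f : MvPolynomial ι A ⧸ I →+* _ := Ideal.Quotient.lift I f₀ fun a ha => hf₀ ha
  let g : MvPolynomial {i // 0 < e i} (A ⧸ Ideal.span {algebraMap O A ϖ}) →+*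
      MvPolynomial ι A ⧸ I :=
    MvPolynomial.eval₂Hom (Ideal.Quotient.lift _ ((Ideal.Quotient.mk I).comp MvPolynomial.C)
      (fun a ha => by
        obtain ⟨b, rfl⟩ := Ideal.mem_span_singleton.1 ha
        rw [RingHom.comp_apply, map_mul]
        exact Ideal.Quotient.eq_zero_iff_mem.2 (Ideal.mul_mem_right _ _ hϖ)))
      fun i => Ideal.Quotient.mk I (MvPolynomial.X i.1)
  have hf : ∀ p, f (Ideal.Quotient.mk I p) = f₀ p := fun _ => rfl
  have hfC : ∀ a, f₀ (MvPolynomial.C a) = MvPolynomial.C (Ideal.Quotient.mk _ a) := fun a =>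
    MvPolynomial.eval₂Hom_C _ _ a
  have hfX : ∀ i, f₀ (MvPolynomial.X i) = if h : 0 < e i then MvPolynomial.X ⟨i, h⟩ else 0 :=
    fun i => MvPolynomial.eval₂Hom_X' _ _ i
  have hgC : ∀ a, g (MvPolynomial.C (Ideal.Quotient.mk _ a))
      = Ideal.Quotient.mk I (MvPolynomial.C a) := fun a => MvPolynomial.eval₂Hom_C _ _ _
  have hgX : ∀ i, g (MvPolynomial.X i) = Ideal.Quotient.mk I (MvPolynomial.X i.1) :=
    fun i => MvPolynomial.eval₂Hom_X' _ _ i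
  refine ⟨RingEquiv.ofRingHom f g ?_ ?_⟩
  · refine MvPolynomial.ringHom_ext' (Ideal.Quotient.ringHom_ext (RingHom.ext fun a => ?_))
      fun i => ?_
    · simp only [RingHom.comp_apply, hgC, hf, hfC, RingHom.id_apply]
    · simp only [RingHom.comp_apply, hgX, hf, hfX, RingHom.id_apply, dif_pos i.2]
  · refine Ideal.Quotient.ringHom_ext (MvPolynomial.ringHom_ext' (RingHom.ext fun a => ?_)
      fun i => ?_)
    · simp only [RingHom.comp_apply, hgC, hf, hfC, RingHom.id_apply]
    · by_cases h : 0 < e i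
      · simp only [RingHom.comp_apply, hgX, hf, hfX, RingHom.id_apply, dif_pos h]
      · simp only [RingHom.comp_apply, hf, hfX, RingHom.id_apply, dif_neg h, map_zero]
        exact (Ideal.Quotient.eq_zero_iff_mem.2 (hX i h)).symm

/-- The quotient is a polynomial ring over `A / ϖ`, which has length two over `O`. It is therefore
artinian of dimension zero, and only the surviving variables count. -/
theorem ringKrullDim_quotient_formIdeal [IsDomain O] [IsDiscreteValuationRing O] {ϖ : O}
    (hϖ : Irreducible ϖ) (B : Module.Basis (Fin 2) O A) (e : ι → ℕ) (R C : GL ι A) :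
    ringKrullDim (MvPolynomial ι A ⧸
      formIdeal ϖ ((R : Matrix ι ι A) * diagPow A ϖ e * (C : Matrix ι ι A)))
      = Fintype.card {i // 0 < e i} := by
  have e1 := Ideal.quotientEquiv _ _ (linearChange C).toRingEquiv
    (formIdeal_map_linearChange ϖ ((R : Matrix ι ι A) * diagPow A ϖ e) C).symm
  rw [← ringKrullDim_eq_of_ringEquiv e1, formIdeal_units_mul,
    ringKrullDim_eq_of_ringEquiv (nonempty_quotient_formIdeal_diagPow ϖ e).some]
  set Q := A ⧸ Ideal.span {algebraMap O A ϖ}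
  -- This is the length formula for the one-by-one matrix with entry `ϖ`.
  have hlen : Module.length O Q = 2 := by
    have h := length_quotient_range hϖ B (fun _ : Unit => 1) 1 1
    have e2 : ((Unit → A) ⧸ LinearMap.range (Matrix.mulVecLin (((1 : GL Unit A) : Matrix Unit Unit A)
      * diagPow A ϖ (fun _ : Unit => 1) * ((1 : GL Unit A) : Matrix Unit Unit A)))) ≃ₗ[A] Q := by
      refine Submodule.Quotient.equiv _ _ (LinearEquiv.funUnique Unit A A) ?_
      ext a
      simp only [Units.val_one, Matrix.one_mul, Matrix.mul_one, Submodule.mem_map,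
        LinearMap.mem_range, exists_exists_eq_and]
      rw [Ideal.mem_span_singleton']
      constructor
      · rintro ⟨y, rfl⟩
        refine ⟨y (), ?_⟩
        simp [diagPow, Algebra.smul_def, mul_comm]
      · rintro ⟨y, rfl⟩
        refine ⟨fun _ => y, ?_⟩
        simp [diagPow, Algebra.smul_def, mul_comm]
    rw [(e2.restrictScalars O).length_eq] at h
    simpa using h
  have hfin : IsFiniteLength O Q := Module.length_ne_top_iff.1 (by rw [hlen]; decide)
  have hart : IsArtinian O Q := (isFiniteLength_iff_isNoetherian_isArtinian.1 hfin).2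
  have : Nontrivial Q := (Module.length_pos_iff (R := O)).1 (by rw [hlen]; decide)
  have : IsArtinianRing Q := isArtinian_of_tower O hart
  rw [MvPolynomial.ringKrullDim_of_isNoetherianRing,
    ringKrullDimZero_iff_ringKrullDim_eq_zero.1 (inferInstanceAs (Ring.KrullDimLE 0 Q)), zero_add,
    Nat.card_eq_fintype_card]

end SmithForm

/-! ### Tuning submodules with known elementary divisors -/

section Tuned

variable {O K Γ ι κ : Type*} [CommRing O] [Field K] [Algebra O K] [Group Γ]
  [Fintype ι] [DecidableEq ι] [Fintype κ] [DecidableEq κ]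

/-- The tuning submodule is generated over `O` by the columns of a square matrix over `O_M` with
elementary divisors `ϖ ^ e i`. -/
def IsTuned (ϖ : O) (τ : Γ →* GL ι O) (ρ : GalHom K Γ) (e : ι → ℕ) : Prop :=
  ∃ R C : GL ι (TorsorInt O ρ), ∀ x : ι → TorsorInt O ρ, x ∈ tuning τ ρ ↔
    ∃ c : ι → O, ((R : Matrix ι ι (TorsorInt O ρ)) * diagPow (TorsorInt O ρ) ϖ e *
      (C : Matrix ι ι (TorsorInt O ρ))).mulVec (fun i => algebraMap O _ (c i)) = x

/-- The tuning condition splits along the blocks, so the factorisations are assembled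
block-diagonally. The same holds for `IsTuned.copies`. -/
theorem IsTuned.sum {ϖ : O} {τ₁ : Γ →* GL ι O} {τ₂ : Γ →* GL κ O} {ρ : GalHom K Γ}
    {e₁ : ι → ℕ} {e₂ : κ → ℕ} (h₁ : IsTuned ϖ τ₁ ρ e₁) (h₂ : IsTuned ϖ τ₂ ρ e₂) :
    IsTuned ϖ (repSum τ₁ τ₂) ρ (Sum.elim e₁ e₂) := by
  obtain ⟨R₁, C₁, h₁⟩ := h₁
  obtain ⟨R₂, C₂, h₂⟩ := h₂
  let F : GL ι (TorsorInt O ρ) → GL κ (TorsorInt O ρ) → GL (ι ⊕ κ) (TorsorInt O ρ) := fun X Y =>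
    ⟨Matrix.fromBlocks X 0 0 Y, Matrix.fromBlocks ((X⁻¹ : GL ι _) : Matrix ι ι _) 0 0
      ((Y⁻¹ : GL κ _) : Matrix κ κ _), by
        rw [Matrix.fromBlocks_multiply]
        simp only [Matrix.mul_zero, Matrix.zero_mul, add_zero, zero_add, ← Units.val_mul,
          mul_inv_cancel, Units.val_one, Matrix.fromBlocks_one], by
        rw [Matrix.fromBlocks_multiply]
        simp only [Matrix.mul_zero, Matrix.zero_mul, add_zero, zero_add, ← Units.val_mul,
          inv_mul_cancel, Units.val_one, Matrix.fromBlocks_one]⟩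
  have hF : ∀ X Y, ((F X Y : GL (ι ⊕ κ) (TorsorInt O ρ)) : Matrix (ι ⊕ κ) (ι ⊕ κ) _)
      = Matrix.fromBlocks (X : Matrix ι ι (TorsorInt O ρ)) 0 0 (Y : Matrix κ κ _) :=
    fun _ _ => rfl
  have hD : diagPow (TorsorInt O ρ) ϖ (Sum.elim e₁ e₂)
      = Matrix.fromBlocks (diagPow _ ϖ e₁) 0 0 (diagPow _ ϖ e₂) := by
    rw [diagPow, diagPow, diagPow, Matrix.fromBlocks_diagonal]
    congr 1
    funext i
    cases i <;> rfl
  have hmem : ∀ x : ι ⊕ κ → TorsorInt O ρ, x ∈ tuning (repSum τ₁ τ₂) ρ ↔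
      (x ∘ Sum.inl) ∈ tuning τ₁ ρ ∧ (x ∘ Sum.inr) ∈ tuning τ₂ ρ := by
    intro x
    have hl : ∀ γ i, ∑ j, ((repSum τ₁ τ₂ γ : GL (ι ⊕ κ) O) : Matrix (ι ⊕ κ) (ι ⊕ κ) O) (Sum.inl i) j
        • x j = ∑ j, (τ₁ γ : Matrix ι ι O) i j • x (Sum.inl j) := by
      intro γ i
      rw [Fintype.sum_sum_type]
      simp [repSum]
    have hr : ∀ γ i, ∑ j, ((repSum τ₁ τ₂ γ : GL (ι ⊕ κ) O) : Matrix (ι ⊕ κ) (ι ⊕ κ) O) (Sum.inr i) j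
        • x j = ∑ j, (τ₂ γ : Matrix κ κ O) i j • x (Sum.inr j) := by
      intro γ i
      rw [Fintype.sum_sum_type]
      simp [repSum]
    constructor
    · intro h
      exact ⟨fun γ i => (hl γ i).symm.trans (h γ (Sum.inl i)),
        fun γ i => (hr γ i).symm.trans (h γ (Sum.inr i))⟩
    · rintro ⟨h, h'⟩ γ (i | i)
      · exact (hl γ i).trans (h γ i)
      · exact (hr γ i).trans (h' γ i)
  refine ⟨F R₁ R₂, F C₁ C₂, fun x => ?_⟩
  rw [hmem, h₁, h₂, hF, hF, hD, Matrix.fromBlocks_multiply, Matrix.fromBlocks_multiply]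
  simp only [Matrix.mul_zero, Matrix.zero_mul, add_zero, zero_add]
  constructor
  · rintro ⟨⟨c, hc⟩, ⟨c', hc'⟩⟩
    refine ⟨Sum.elim c c', ?_⟩
    rw [Matrix.fromBlocks_mulVec]
    funext i
    rcases i with i | i
    · simpa [Function.comp_def] using congrFun hc i
    · simpa [Function.comp_def] using congrFun hc' i
  · rintro ⟨c, rfl⟩
    rw [Matrix.fromBlocks_mulVec]
    refine ⟨⟨c ∘ Sum.inl, ?_⟩, ⟨c ∘ Sum.inr, ?_⟩⟩
    · funext i
      simp [Function.comp_def]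
    · funext i
      simp [Function.comp_def]

theorem blockDiagonal_mulVec {R m o : Type*} [CommRing R] [Fintype m] [Fintype o]
    [DecidableEq m] [DecidableEq o] (M : o → Matrix m m R) (x : m × o → R) (p : m × o) :
    (Matrix.blockDiagonal M).mulVec x p = (M p.2).mulVec (fun i => x (i, p.2)) p.1 := by
  simp only [Matrix.mulVec, dotProduct, Fintype.sum_prod_type, Matrix.blockDiagonal_apply]
  refine Finset.sum_congr rfl fun i _ => ?_
  rw [Finset.sum_eq_single p.2] <;> simp +contextual [eq_comm]

theorem IsTuned.copies {ϖ : O} {τ : Γ →* GL ι O} {ρ : GalHom K Γ}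
    {e : ι → ℕ} (h : IsTuned ϖ τ ρ e) (n : ℕ) :
    IsTuned ϖ (repCopies n τ) ρ (fun p => e p.1) := by
  obtain ⟨R, C, h⟩ := h
  let F : GL ι (TorsorInt O ρ) → GL (ι × Fin n) (TorsorInt O ρ) := fun X =>
    ⟨Matrix.blockDiagonal fun _ => (X : Matrix ι ι _),
      Matrix.blockDiagonal fun _ => ((X⁻¹ : GL ι _) : Matrix ι ι _), by
        rw [← Matrix.blockDiagonal_mul]
        simp only [← Units.val_mul, mul_inv_cancel, Units.val_one]
        exact Matrix.blockDiagonal_one, by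
        rw [← Matrix.blockDiagonal_mul]
        simp only [← Units.val_mul, inv_mul_cancel, Units.val_one]
        exact Matrix.blockDiagonal_one⟩
  have hF : ∀ X, ((F X : GL (ι × Fin n) (TorsorInt O ρ)) : Matrix (ι × Fin n) (ι × Fin n) _)
      = Matrix.blockDiagonal fun _ => (X : Matrix ι ι (TorsorInt O ρ)) := fun _ => rfl
  have hD : diagPow (TorsorInt O ρ) ϖ (fun p : ι × Fin n => e p.1)
      = Matrix.blockDiagonal fun _ => diagPow _ ϖ e := by
    simp only [diagPow]
    rw [Matrix.blockDiagonal_diagonal]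
  have hmem : ∀ x : ι × Fin n → TorsorInt O ρ, x ∈ tuning (repCopies n τ) ρ ↔
      ∀ j, (fun i => x (i, j)) ∈ tuning τ ρ := by
    intro x
    have hl : ∀ γ p, ∑ j, ((repCopies n τ γ : GL (ι × Fin n) O) : Matrix (ι × Fin n) (ι × Fin n) O) p j
        • x j = ∑ j, (τ γ : Matrix ι ι O) p.1 j • x (j, p.2) := by
      intro γ p
      rw [Fintype.sum_prod_type]
      refine Finset.sum_congr rfl fun i _ => ?_
      rw [Finset.sum_eq_single p.2] <;>
        simp +contextual [repCopies, Matrix.blockDiagonal_apply, eq_comm]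
    constructor
    · intro h j γ i
      exact (hl γ (i, j)).symm.trans (h γ (i, j))
    · intro h γ p
      exact (hl γ p).trans (h p.2 γ p.1)
  refine ⟨F R, F C, fun x => ?_⟩
  simp only [hmem, h, hF, hD, ← Matrix.blockDiagonal_mul]
  constructor
  · intro hx
    choose c hc using hx
    refine ⟨fun p => c p.2 p.1, funext fun p => ?_⟩
    rw [blockDiagonal_mulVec]
    exact congrFun (hc p.2) p.1
  · rintro ⟨c, rfl⟩ j
    refine ⟨fun i => c (i, j), funext fun i => ?_⟩
    rw [blockDiagonal_mulVec]

/-- The matrix of a family in the tuning submodule. -/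
def familyMatrix {τ : Γ →* GL ι O} {ρ : GalHom K Γ} (φ : ι → tuning τ ρ) :
    Matrix ι ι (TorsorInt O ρ) :=
  Matrix.of fun i j => (φ j : ι → TorsorInt O ρ) i

/-- A basis of the tuning submodule given by a generating square matrix. -/
theorem IsTuned.exists_basis [IsDomain O] {ϖ : O} (hϖ : ϖ ≠ 0)
    {τ : Γ →* GL ι O} {ρ : GalHom K Γ} (B : Module.Basis (Fin 2) O (TorsorInt O ρ))
    {e : ι → ℕ} (h : IsTuned ϖ τ ρ e) :
    ∃ (φ : Module.Basis ι O (tuning τ ρ)) (R C : GL ι (TorsorInt O ρ)),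
      familyMatrix φ = (R : Matrix ι ι (TorsorInt O ρ)) * diagPow (TorsorInt O ρ) ϖ e *
      (C : Matrix ι ι (TorsorInt O ρ)) := by
  obtain ⟨R, C, h⟩ := h
  set Φ := (R : Matrix ι ι (TorsorInt O ρ)) * diagPow (TorsorInt O ρ) ϖ e *
      (C : Matrix ι ι (TorsorInt O ρ))
  have hfree : Module.Free O (TorsorInt O ρ) := Module.Free.of_basis B
  have hcan : ∀ (n : ℕ) (a : TorsorInt O ρ), algebraMap O _ (ϖ ^ n) * a = 0 → a = 0 := by
    intro n a ha
    rw [← Algebra.smul_def] at ha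
    exact (smul_eq_zero.1 ha).resolve_left (pow_ne_zero _ hϖ)
  have halg : ∀ a : O, algebraMap O (TorsorInt O ρ) a = 0 → a = 0 := by
    intro a ha
    have h0 : B 0 ≠ 0 := B.ne_zero 0
    have : a • B 0 = 0 := by rw [Algebra.smul_def, ha, zero_mul]
    exact (smul_eq_zero.1 this).resolve_right h0
  let f : (ι → O) →ₗ[O] (ι → TorsorInt O ρ) :=
    ((Matrix.mulVecLin Φ).restrictScalars O) ∘ₗ
      (LinearMap.pi fun i => (Algebra.linearMap O (TorsorInt O ρ)) ∘ₗ LinearMap.proj i)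
  have hf : ∀ c, f c = Φ.mulVec (fun i => algebraMap O _ (c i)) := fun _ => rfl
  -- Cancel `R`, then the powers of `ϖ` (a free module over a domain is torsion-free), then `C`.
  have hinj : Function.Injective f := by
    rw [← LinearMap.ker_eq_bot, LinearMap.ker_eq_bot']
    intro c hc
    rw [hf] at hc
    have h1 := congrArg (((R⁻¹ : GL ι (TorsorInt O ρ)) : Matrix ι ι _).mulVec) hc
    rw [Matrix.mulVec_zero, Matrix.mulVec_mulVec, ← Matrix.mul_assoc, ← Matrix.mul_assoc,
      ← Units.val_mul, inv_mul_cancel, Units.val_one, Matrix.one_mul, ← Matrix.mulVec_mulVec] at h1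
    have h2 : (C : Matrix ι ι (TorsorInt O ρ)).mulVec (fun i => algebraMap O _ (c i)) = 0 := by
      funext i
      have := congrFun h1 i
      rw [diagPow, Matrix.mulVec_diagonal] at this
      exact hcan _ _ this
    have h3 := congrArg (((C⁻¹ : GL ι (TorsorInt O ρ)) : Matrix ι ι _).mulVec) h2
    rw [Matrix.mulVec_zero, Matrix.mulVec_mulVec, ← Units.val_mul, inv_mul_cancel, Units.val_one,
      Matrix.one_mulVec] at h3
    funext i
    exact halg _ (congrFun h3 i)
  have hrange : LinearMap.range f = tuning τ ρ := by
    ext x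
    rw [h, LinearMap.mem_range]
    rfl
  refine ⟨((Pi.basisFun O ι).map (LinearEquiv.ofInjective f hinj)).map
    (LinearEquiv.ofEq _ _ hrange), R, C, ?_⟩
  ext i j
  change f (Pi.basisFun O ι j) i = Φ i j
  rw [hf]
  have : (fun i => algebraMap O (TorsorInt O ρ) (Pi.basisFun O ι j i)) = Pi.single j 1 := by
    funext l
    by_cases hl : l = j
    · subst hl; simp
    · simp [hl]
  rw [this, Matrix.mulVec_single_one]
  rfl

/-- The matrix of any basis of the tuning submodule has the elementary divisors `ϖ ^ e i`. -/
theorem IsTuned.basis_matrix [IsDomain O] {ϖ : O} (hϖ : ϖ ≠ 0)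
    {τ : Γ →* GL ι O} {ρ : GalHom K Γ} (B : Module.Basis (Fin 2) O (TorsorInt O ρ))
    {e : ι → ℕ} (h : IsTuned ϖ τ ρ e) (ψ : Module.Basis ι O (tuning τ ρ)) :
    ∃ R C : GL ι (TorsorInt O ρ),
      familyMatrix ψ = (R : Matrix ι ι (TorsorInt O ρ)) * diagPow (TorsorInt O ρ) ϖ e *
      (C : Matrix ι ι (TorsorInt O ρ)) := by
  obtain ⟨φ, R, C, hφ⟩ := h.exists_basis hϖ B
  -- The definition of `fiberDim` picks an arbitrary basis. Passing to it multiplies on the right by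
  -- the change of basis `P`, which is absorbed into `C`.
  let P : GL ι O := ⟨φ.toMatrix ψ, ψ.toMatrix φ, φ.toMatrix_mul_toMatrix_flip ψ,
    ψ.toMatrix_mul_toMatrix_flip φ⟩
  refine ⟨R, C * Matrix.GeneralLinearGroup.map (algebraMap O _) P, ?_⟩
  rw [Units.val_mul, ← Matrix.mul_assoc, ← hφ]
  ext i j
  have := congrArg (fun x : tuning τ ρ => (x : ι → TorsorInt O ρ) i) (φ.sum_toMatrix_smul_self ψ j)
  simp only [AddSubmonoidClass.coe_finsetSum, Finset.sum_apply, Submodule.coe_smul,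
    Pi.smul_apply] at this
  rw [Matrix.mul_apply, familyMatrix, Matrix.of_apply, ← this]
  refine Finset.sum_congr rfl fun l _ => ?_
  rw [Algebra.smul_def, mul_comm]
  rfl

/-- The `O_M`-span of `Ξ` is the column space of the matrix of an `O`-basis, so
`length_quotient_range` applies. -/
theorem IsTuned.tuningLength_eq [IsDomain O] [IsDiscreteValuationRing O] {ϖ : O}
    (hϖ : Irreducible ϖ) {τ : Γ →* GL ι O} {ρ : GalHom K Γ}
    (B : Module.Basis (Fin 2) O (TorsorInt O ρ)) {e : ι → ℕ} (h : IsTuned ϖ τ ρ e) :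
    tuningLength τ ρ = ((2 * ∑ i, e i : ℕ) : ℕ∞) := by
  obtain ⟨φ, R, C, hφ⟩ := h.exists_basis hϖ.ne_zero B
  rw [← length_quotient_range hϖ B e R C, ← hφ, tuningLength]
  refine ((Submodule.quotEquivOfEq _ _ ?_).restrictScalars O).length_eq
  rw [Matrix.range_mulVecLin]
  refine le_antisymm (Submodule.span_le.2 fun x hx => ?_) (Submodule.span_mono ?_)
  · have h1 := congrArg (fun x : tuning τ ρ => (x : ι → TorsorInt O ρ)) (φ.sum_repr ⟨x, hx⟩)
    simp only [AddSubmonoidClass.coe_finsetSum, Submodule.coe_smul] at h1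
    rw [← h1]
    refine Submodule.sum_mem _ fun i _ => ?_
    rw [← algebraMap_smul (TorsorInt O ρ)]
    exact Submodule.smul_mem _ _ (Submodule.subset_span ⟨i, rfl⟩)
  · rintro _ ⟨i, rfl⟩
    exact (φ i).2

theorem originIdeal_eq [IsLocalRing O] {ϖ : O}
    (hϖ : IsLocalRing.maximalIdeal O = Ideal.span {ϖ}) :
    originIdeal O ι = Ideal.span {MvPolynomial.C ϖ} ⊔ Ideal.span (Set.range MvPolynomial.X) := by
  refine le_antisymm (fun p hp => ?_) (sup_le (Ideal.span_le.2 ?_) (Ideal.span_le.2 ?_))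
  · have h1 : ∀ p : MvPolynomial ι O, p - MvPolynomial.C (MvPolynomial.constantCoeff p)
        ∈ Ideal.span (Set.range (MvPolynomial.X : ι → MvPolynomial ι O)) := by
      intro p
      induction p using MvPolynomial.induction_on with
      | C a => simp
      | add p q hp hq =>
        have := Ideal.add_mem _ hp hq
        rw [map_add, map_add]
        convert this using 1
        ring
      | mul_X p i hp =>
        rw [map_mul, MvPolynomial.constantCoeff_X, mul_zero, map_zero, sub_zero]
        exact Ideal.mul_mem_left _ _ (Ideal.subset_span ⟨i, rfl⟩)
    rw [originIdeal, RingHom.mem_ker, RingHom.comp_apply, IsLocalRing.residue_eq_zero_iff, hϖ] at hp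
    obtain ⟨b, hb⟩ := Ideal.mem_span_singleton.1 hp
    rw [← sub_add_cancel p (MvPolynomial.C (MvPolynomial.constantCoeff p))]
    refine Ideal.add_mem _ (Ideal.mem_sup_right (h1 p)) (Ideal.mem_sup_left ?_)
    rw [hb, map_mul]
    exact Ideal.mul_mem_right _ _ (Ideal.subset_span rfl)
  · rintro _ rfl
    rw [SetLike.mem_coe, originIdeal, RingHom.mem_ker, RingHom.comp_apply,
      MvPolynomial.constantCoeff_C, IsLocalRing.residue_eq_zero_iff, hϖ]
    exact Ideal.mem_span_singleton_self _
  · rintro _ ⟨i, rfl⟩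
    simp [originIdeal, RingHom.mem_ker]

/-- The origin is cut out by `ϖ` and the coordinates, and `u^*` sends the `i`-th coordinate to the
linear form of the `i`-th row. -/
theorem originIdeal_map_uStar [IsLocalRing O] {ϖ : O}
    (hϖ : IsLocalRing.maximalIdeal O = Ideal.span {ϖ}) {τ : Γ →* GL ι O} {ρ : GalHom K Γ}
    (φ : Module.Basis ι O (tuning τ ρ)) :
    (originIdeal O ι).map (uStar τ ρ φ) = formIdeal ϖ (familyMatrix φ) := by
  rw [originIdeal_eq hϖ, Ideal.map_sup, Ideal.map_span, Ideal.map_span, formIdeal,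
    Set.image_singleton, ← Set.range_comp]
  congr 3
  · exact (uStar τ ρ φ).commutes ϖ
  · funext i
    simp [uStar, familyMatrix]

theorem IsTuned.fiberDim_eq [IsDomain O] [IsDiscreteValuationRing O] {ϖ : O}
    (hϖ : Irreducible ϖ) {τ : Γ →* GL ι O} {ρ : GalHom K Γ}
    (B : Module.Basis (Fin 2) O (TorsorInt O ρ)) {e : ι → ℕ} (h : IsTuned ϖ τ ρ e) :
    fiberDim τ ρ = Fintype.card {i // 0 < e i} := by
  have hne : Nonempty (Module.Basis ι O (tuning τ ρ)) := ⟨(h.exists_basis hϖ.ne_zero B).choose⟩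
  obtain ⟨R, C, hm⟩ := h.basis_matrix hϖ.ne_zero B hne.some
  have hdim : ringKrullDim (fiberRing τ ρ hne.some) = Fintype.card {i // 0 < e i} := by
    rw [← ringKrullDim_quotient_formIdeal hϖ B e R C, ← hm, ← originIdeal_map_uStar
      ((IsDiscreteValuationRing.irreducible_iff_uniformizer _).1 hϖ)]
  rw [fiberDim, dif_pos hne, hdim]
  rfl

/-- The factor two in the length, which is the rank of `O_M`, cancels against the order of `Γ`. -/
theorem IsTuned.vFun_eq [IsDomain O] [IsDiscreteValuationRing O] {ϖ : O}
    (hϖ : Irreducible ϖ) {τ : Γ →* GL ι O} {ρ : GalHom K Γ} (hΓ : Nat.card Γ = 2)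
    (B : Module.Basis (Fin 2) O (TorsorInt O ρ)) {e : ι → ℕ} (h : IsTuned ϖ τ ρ e) :
    vFun τ ρ = ((∑ i, e i : ℕ) : ℝ) := by
  rw [vFun, h.tuningLength_eq hϖ B, hΓ, ENat.toNat_natCast]
  push_cast
  ring

theorem IsTuned.wFun_eq [IsDomain O] [IsDiscreteValuationRing O] {ϖ : O}
    (hϖ : Irreducible ϖ) {τ : Γ →* GL ι O} {ρ : GalHom K Γ} (hΓ : Nat.card Γ = 2)
    (B : Module.Basis (Fin 2) O (TorsorInt O ρ)) {e : ι → ℕ} (h : IsTuned ϖ τ ρ e) :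
    wFun τ ρ = (Fintype.card {i // 0 < e i} : ℝ) - ((∑ i, e i : ℕ) : ℝ) := by
  rw [wFun, h.fiberDim_eq hϖ B, h.vFun_eq hϖ hΓ B]

end Tuned

/-! ### Elementary divisors and discriminant for `O_M = O[π]` -/

section Conductor

/-- The generator of `ℤ/2`. -/
def gen : Multiplicative (ZMod 2) := Multiplicative.ofAdd 1

theorem eq_one_or_eq_gen (γ : Multiplicative (ZMod 2)) : γ = 1 ∨ γ = gen := by
  revert γ; unfold gen; decide

theorem gen_ne_one : gen ≠ 1 := by unfold gen; decide

theorem gen_mul_gen : gen * gen = 1 := by unfold gen; decide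

theorem natCard_multiplicative_zmod_two : Nat.card (Multiplicative (ZMod 2)) = 2 := by simp

variable {O K : Type*} [CommRing O] [Field K] [Algebra O K]

/-- `O_M` has an `O`-basis `1, π` with `π ^ 2 = ϖ ^ i π + b` and with `ϖ ^ i + π` conjugate
to `π`. -/
def HasConductor (ϖ : O) (ρ : GalHom K (Multiplicative (ZMod 2))) (i : ℕ) : Prop :=
  ∃ B : Module.Basis (Fin 2) O (TorsorInt O ρ), B 0 = 1 ∧
    torsorAct ρ gen (B 1) = B 1 + algebraMap O _ (ϖ ^ i) ∧
    ∃ b : O, B 1 * B 1 = ϖ ^ i • B 1 + algebraMap O _ b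

theorem torsorAct_one (ρ : GalHom K (Multiplicative (ZMod 2))) (x : TorsorInt O ρ) :
    torsorAct ρ 1 x = x := by
  refine Subtype.ext (funext fun δ => ?_)
  change x.1 (δ * 1) = x.1 δ
  rw [mul_one]

theorem mem_tuning_involutionRep {ι : Type*} [Fintype ι] [DecidableEq ι] (M : Matrix ι ι O)
    (hM : M * M = 1) (ρ : GalHom K (Multiplicative (ZMod 2))) (x : ι → TorsorInt O ρ) :
    x ∈ tuning (involutionRep M hM) ρ ↔ ∀ i, ∑ j, M i j • x j = torsorAct ρ gen (x i) := by
  have hgen : ((involutionRep M hM gen : GL ι O) : Matrix ι ι O) = M := by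
    simp [involutionRep, gen_ne_one]
  constructor
  · intro h i
    have := h gen i
    rwa [hgen] at this
  · intro h γ i
    rcases eq_one_or_eq_gen γ with rfl | rfl
    · rw [map_one, torsorAct_one, Units.val_one, Finset.sum_eq_single i]
      · simp
      · intro j _ hj
        rw [Matrix.one_apply_ne hj.symm, zero_smul]
      · simp
    · rw [hgen]
      exact h i

/-- Upper unitriangular matrices of size two. -/
def upperUnip {A : Type*} [CommRing A] (a : A) : GL (Fin 2) A :=
  ⟨!![1, a; 0, 1], !![1, -a; 0, 1], by simp [Matrix.one_fin_two], by simp [Matrix.one_fin_two]⟩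

/-- Lower unitriangular matrices of size two. -/
def lowerUnip {A : Type*} [CommRing A] (a : A) : GL (Fin 2) A :=
  ⟨!![1, 0; a, 1], !![1, 0; -a, 1], by simp [Matrix.one_fin_two], by simp [Matrix.one_fin_two]⟩

theorem algebraMap_injective_of_basis {A : Type*} [CommRing A] [Algebra O A] [IsDomain O]
    (B : Module.Basis (Fin 2) O A) : Function.Injective (algebraMap O A) := by
  have hfree : Module.Free O A := Module.Free.of_basis B
  refine (injective_iff_map_eq_zero _).2 fun a ha => ?_
  have : a • B 0 = 0 := by rw [Algebra.smul_def, ha, zero_mul]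
  exact (smul_eq_zero.1 this).resolve_right (B.ne_zero 0)

/-- A tuned pair is an arbitrary `z` followed by its conjugate, so `(1, 1)` and `(π, π + ϖ ^ i)`
generate. Subtracting the first row from the second leaves an upper triangular matrix with diagonal
`1, ϖ ^ i`. -/
theorem isTuned_transposition [IsDomain O] {ϖ : O}
    {ρ : GalHom K (Multiplicative (ZMod 2))} {i : ℕ} (h : HasConductor ϖ ρ i)
    (h2 : (2 : O) = 0) : IsTuned ϖ (transposition O) ρ ![0, i] := by
  obtain ⟨B, hB0, hB1, -⟩ := h
  have h2A : ∀ a : TorsorInt O ρ, a + a = 0 := fun a => by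
    rw [← two_mul, ← map_ofNat (algebraMap O (TorsorInt O ρ)) 2, h2, map_zero, zero_mul]
  refine ⟨lowerUnip 1, upperUnip (B 1), fun x => ?_⟩
  have hΦ : ((lowerUnip 1 : GL (Fin 2) (TorsorInt O ρ)) : Matrix (Fin 2) (Fin 2) (TorsorInt O ρ)) *
      diagPow (TorsorInt O ρ) ϖ ![0, i] *
      ((upperUnip (B 1) : GL (Fin 2) (TorsorInt O ρ)) : Matrix (Fin 2) (Fin 2) (TorsorInt O ρ))
      = !![1, B 1; 1, B 1 + algebraMap O _ (ϖ ^ i)] := by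
    ext a b
    fin_cases a <;> fin_cases b <;>
      simp [lowerUnip, upperUnip, diagPow, Matrix.mul_apply, Fin.sum_univ_two,
        Matrix.vecMul_diagonal]
  change x ∈ tuning (involutionRep !![0, 1; 1, 0] _) ρ ↔ _
  rw [mem_tuning_involutionRep, hΦ]
  constructor
  · intro h
    have h1 : x 1 = torsorAct ρ gen (x 0) := by simpa using h 0
    refine ⟨fun j => B.repr (x 0) j, ?_⟩
    have h0 := B.sum_repr (x 0)
    rw [Fin.sum_univ_two, hB0] at h0
    have h3 : torsorAct ρ gen (x 0) = algebraMap O _ (B.repr (x 0) 0)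
        + (B 1 + algebraMap O _ (ϖ ^ i)) * algebraMap O _ (B.repr (x 0) 1) := by
      conv_lhs => rw [← h0]
      rw [map_add, map_smul, map_smul, map_one, hB1, Algebra.smul_def, Algebra.smul_def]
      ring
    funext a
    fin_cases a
    · rw [Algebra.smul_def, Algebra.smul_def] at h0
      simp [Matrix.mulVec, dotProduct, Fin.sum_univ_two]
      linear_combination h0
    · simp [Matrix.mulVec, dotProduct, Fin.sum_univ_two]
      rw [h1, h3]
      simp
  · rintro ⟨c, rfl⟩ a
    have e : ∀ c, torsorAct ρ gen (algebraMap O (TorsorInt O ρ) c) = algebraMap O _ c :=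
      fun c => (torsorAct ρ gen).commutes c
    -- In characteristic two conjugation also sends `π + ϖ ^ i` back to `π`, which gives the second
    -- tuning equation.
    have e' : B 1 + algebraMap O _ (ϖ ^ i) + algebraMap O _ (ϖ ^ i) = B 1 := by
      rw [add_assoc, h2A, add_zero]
    fin_cases a
    · simp [Matrix.mulVec, dotProduct, Fin.sum_univ_two, -map_pow, e, hB1]
    · simp [Matrix.mulVec, dotProduct, Fin.sum_univ_two, -map_pow, e, hB1, e']

/-- The second coordinate is invariant, hence a scalar `z`. If `y` is the `π`-coordinate of the
first entry, the other equation reads `ϖ ^ m z = y ϖ ^ i`. Its solutions are the multiples of `(y,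
z) = (ϖ ^ (m - i), ϖ ^ (i - m))`, where the subtractions are truncated and at least one of the two
powers is `1`. -/
theorem isTuned_involutionRep_upper [IsDomain O] {ϖ : O} (hϖ : ϖ ≠ 0)
    {ρ : GalHom K (Multiplicative (ZMod 2))} {i : ℕ} (h : HasConductor ϖ ρ i)
    (m : ℕ) (hM : !![1, ϖ ^ m; 0, 1] * !![1, ϖ ^ m; 0, 1] = 1) :
    IsTuned ϖ (involutionRep !![1, ϖ ^ m; 0, 1] hM) ρ ![0, i - m] := by
  obtain ⟨B, hB0, hB1, -⟩ := h
  have hinj := algebraMap_injective_of_basis B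
  have hfree : Module.Free O (TorsorInt O ρ) := Module.Free.of_basis B
  have hpow : ∀ n, algebraMap O (TorsorInt O ρ) (ϖ ^ n) ≠ 0 := fun n h =>
    pow_ne_zero n hϖ (hinj (h.trans (map_zero _).symm))
  have e : ∀ c, torsorAct ρ gen (algebraMap O (TorsorInt O ρ) c) = algebraMap O _ c :=
    fun c => (torsorAct ρ gen).commutes c
  refine ⟨1, upperUnip (algebraMap O _ (ϖ ^ (m - i)) * B 1), fun x => ?_⟩
  have hΦ : ((1 : GL (Fin 2) (TorsorInt O ρ)) : Matrix (Fin 2) (Fin 2) (TorsorInt O ρ)) *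
      diagPow (TorsorInt O ρ) ϖ ![0, i - m] *
      ((upperUnip (algebraMap O _ (ϖ ^ (m - i)) * B 1) : GL (Fin 2) (TorsorInt O ρ)) :
        Matrix (Fin 2) (Fin 2) (TorsorInt O ρ))
      = !![1, algebraMap O _ (ϖ ^ (m - i)) * B 1; 0, algebraMap O _ (ϖ ^ (i - m))] := by
    ext a b
    fin_cases a <;> fin_cases b <;>
      simp [upperUnip, diagPow, Matrix.mul_apply, Matrix.diagonal_apply]
  rw [mem_tuning_involutionRep, hΦ]
  have hcoord : ∀ y : TorsorInt O ρ, y = algebraMap O _ (B.repr y 0)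
      + algebraMap O _ (B.repr y 1) * B 1 := by
    intro y
    have h0 := B.sum_repr y
    rw [Fin.sum_univ_two, hB0, Algebra.smul_def, Algebra.smul_def, mul_one] at h0
    exact h0.symm
  have hact : ∀ y : TorsorInt O ρ, torsorAct ρ gen y
      = y + algebraMap O _ (B.repr y 1 * ϖ ^ i) := by
    intro y
    conv_lhs => rw [hcoord y]
    conv_rhs => enter [1]; rw [hcoord y]
    rw [map_add, map_mul, e, e, hB1, map_mul]
    ring
  constructor
  · intro h
    have h0 : x 0 + algebraMap O _ (ϖ ^ m) * x 1 = torsorAct ρ gen (x 0) := by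
      simpa [Fin.sum_univ_two, Algebra.smul_def] using h 0
    have h1 : x 1 = torsorAct ρ gen (x 1) := by simpa [Fin.sum_univ_two] using h 1
    have h1' : B.repr (x 1) 1 = 0 := by
      rw [hact, left_eq_add] at h1
      have := hinj (h1.trans (map_zero _).symm)
      exact (mul_eq_zero.1 this).resolve_right (pow_ne_zero _ hϖ)
    set z := B.repr (x 1) 0
    set y := B.repr (x 0) 1
    have hx1 : x 1 = algebraMap O _ z := by
      have := hcoord (x 1)
      rwa [h1', map_zero (algebraMap O _), zero_mul, add_zero] at this
    have h3 : ϖ ^ m * z = y * ϖ ^ i := by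
      rw [hact, add_right_inj, hx1, ← map_mul] at h0
      exact hinj h0
    obtain ⟨c, hy, hz⟩ : ∃ c, y = ϖ ^ (m - i) * c ∧ z = ϖ ^ (i - m) * c := by
      rcases le_total i m with him | him
      · refine ⟨z, ?_, by simp [Nat.sub_eq_zero_of_le him]⟩
        refine mul_right_cancel₀ (pow_ne_zero i hϖ) ?_
        rw [← h3, mul_right_comm, ← pow_add, Nat.sub_add_cancel him]
      · refine ⟨y, by simp [Nat.sub_eq_zero_of_le him], ?_⟩
        refine mul_left_cancel₀ (pow_ne_zero m hϖ) ?_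
        rw [h3, ← mul_assoc, ← pow_add, Nat.add_sub_cancel' him, mul_comm]
    refine ⟨![B.repr (x 0) 0, c], ?_⟩
    funext a
    fin_cases a
    · have h4 : x 0 = algebraMap O _ (B.repr (x 0) 0) + algebraMap O _ (ϖ ^ (m - i) * c) * B 1 := by
        rw [← hy]
        exact hcoord (x 0)
      simp [Matrix.mulVec, dotProduct, Fin.sum_univ_two, -map_pow]
      conv_rhs => rw [h4]
      rw [map_mul]
      ring
    · simp [Matrix.mulVec, dotProduct, Fin.sum_univ_two, -map_pow]
      rw [hx1, hz, map_mul]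
  · rintro ⟨c, rfl⟩ a
    have hpm : algebraMap O (TorsorInt O ρ) (ϖ ^ m) * algebraMap O _ (ϖ ^ (i - m))
        = algebraMap O _ (ϖ ^ (m - i)) * algebraMap O _ (ϖ ^ i) := by
      rw [← map_mul, ← map_mul, ← pow_add, ← pow_add]
      congr 2
      omega
    fin_cases a
    · simp [Matrix.mulVec, dotProduct, Fin.sum_univ_two, -map_pow, e, hB1, Algebra.smul_def]
      linear_combination hpm * algebraMap O (TorsorInt O ρ) (c 1)
    · simp [Matrix.mulVec, dotProduct, Fin.sum_univ_two, -map_pow, e]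

/-- In characteristic two the traces of `1`, `π`, `π ^ 2` are `0`, `y`, `y ^ 2`, so the trace matrix
has determinant `-y ^ 2 = y ^ 2`. -/
theorem discr_of_hasConductor {A : Type*} [CommRing A] [Algebra O A] (h2 : (2 : O) = 0)
    (B : Module.Basis (Fin 2) O A) (hB0 : B 0 = 1) (y b : O)
    (hB1 : B 1 * B 1 = y • B 1 + algebraMap O A b) : Algebra.discr O B = y ^ 2 := by
  have hcan : ∀ a : O, a + a = 0 := fun a => by rw [← two_mul, h2, zero_mul]
  have htr : ∀ x : A, Algebra.trace O A x = B.repr x 0 + B.repr (x * B 1) 1 := by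
    intro x
    rw [Algebra.trace_eq_matrix_trace B, Matrix.trace_fin_two, Algebra.leftMulMatrix_eq_repr_mul,
      Algebra.leftMulMatrix_eq_repr_mul, hB0, mul_one]
  have hB1' : B 1 * B 1 = y • B 1 + b • B 0 := by rw [hB1, hB0, Algebra.smul_def b, mul_one]
  have t1 : Algebra.trace O A 1 = 0 := by
    rw [htr, one_mul, ← hB0]
    simp [hcan]
  have tπ : Algebra.trace O A (B 1) = y := by
    rw [htr, hB1']
    simp
  have tππ : Algebra.trace O A (B 1 * B 1) = y ^ 2 := by
    rw [hB1', map_add, map_smul, map_smul, tπ, hB0, t1]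
    simp [sq]
  rw [Algebra.discr_def, Matrix.det_fin_two]
  simp only [Algebra.traceMatrix_apply, Algebra.traceForm_apply, hB0, one_mul, mul_one, t1, tπ, tππ]
  linear_combination -hcan (y * y)

/-- The discriminant of any family is that of the basis times the square of a determinant, so the
basis alone generates the ideal. -/
theorem HasConductor.discrIdeal_eq {ϖ : O} {ρ : GalHom K (Multiplicative (ZMod 2))} {i : ℕ}
    (h : HasConductor ϖ ρ i) (h2 : (2 : O) = 0) :
    discrIdeal O ρ = Ideal.span {ϖ} ^ (2 * i) := by
  obtain ⟨B, hB0, -, b, hb⟩ := h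
  have hd := discr_of_hasConductor h2 B hB0 _ b hb
  let e : Fin 2 ≃ Fin (Nat.card (Multiplicative (ZMod 2))) :=
    finCongr natCard_multiplicative_zmod_two.symm
  have hd' : Algebra.discr O (B.reindex e) = ϖ ^ (2 * i) := by
    rw [Module.Basis.coe_reindex, Algebra.discr_reindex, hd]
    ring
  rw [Ideal.span_singleton_pow, discrIdeal]
  refine le_antisymm (Ideal.span_le.2 ?_) (Ideal.span_le.2 ?_)
  · rintro _ ⟨b, rfl⟩
    have hb : b = Matrix.vecMul (B.reindex e)
        (((B.reindex e).toMatrix b).map (algebraMap O (TorsorInt O ρ))) := by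
      funext j
      conv_lhs => rw [← (B.reindex e).sum_toMatrix_smul_self b j]
      simp only [Matrix.vecMul, dotProduct, Matrix.map_apply, Algebra.smul_def, mul_comm]
    simp only [SetLike.mem_coe]
    rw [hb, Algebra.discr_of_matrix_vecMul, hd']
    exact Ideal.mul_mem_left _ _ (Ideal.mem_span_singleton_self _)
  · rintro _ rfl
    exact Ideal.subset_span ⟨B.reindex e, hd'⟩

end Conductor

/-! ### Artin–Schreier theory for homomorphisms to `ℤ/2` -/

section ArtinSchreier

variable {O K : Type*} [CommRing O] [Field K] [Algebra O K]

/-- The additive character `ℤ/2 → L` of a field of characteristic two. -/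
def chi (L : Type*) [Field L] (γ : Multiplicative (ZMod 2)) : L := if γ = 1 then 0 else 1

@[simp] theorem chi_one (L : Type*) [Field L] : chi L 1 = 0 := by simp [chi]

@[simp] theorem chi_gen (L : Type*) [Field L] : chi L gen = 1 := by simp [chi, gen_ne_one]

theorem chi_mul (L : Type*) [Field L] [CharP L 2] (γ δ : Multiplicative (ZMod 2)) :
    chi L (γ * δ) = chi L γ + chi L δ := by
  rcases eq_one_or_eq_gen γ with rfl | rfl <;> rcases eq_one_or_eq_gen δ with rfl | rfl <;>
    simp [gen_mul_gen, CharTwo.add_self_eq_zero]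

theorem chi_injective (L : Type*) [Field L] : Function.Injective (chi L) := by
  intro γ δ h
  rcases eq_one_or_eq_gen γ with rfl | rfl <;> rcases eq_one_or_eq_gen δ with rfl | rfl <;>
    simp_all

/-- `α` is an Artin–Schreier generator of the torsor of `ρ`, with equation `α ^ 2 + α = a`. -/
structure IsASGen (ρ : GalHom K (Multiplicative (ZMod 2))) (a : K) (α : SeparableClosure K) :
    Prop where
  eq : α * α + α = algebraMap K _ a
  act : ∀ g, g α = α + chi _ (ρ.1 g)

/-- The two roots of `X ^ 2 + X = a` differ by `1`, so `g ↦ g α - α` is a character with values in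
the prime field. -/
theorem exists_isASGen_of_elem [CharP K 2] (a : K) :
    ∃ (ρ : GalHom K (Multiplicative (ZMod 2))) (α : SeparableClosure K), IsASGen ρ a α := by
  have h2 : (2 : SeparableClosure K) = 0 := CharTwo.two_eq_zero
  -- The polynomial `X ^ 2 + X + a` is separable, its derivative being the constant `1`.
  obtain ⟨α, hα⟩ := IsSepClosed.exists_root_C_mul_X_pow_add_C_mul_X_add_C (n := 2)
    (1 : SeparableClosure K) 1 (algebraMap K _ a) (by exact_mod_cast h2) le_rfl one_ne_zero
  have hα' : α * α + α = algebraMap K _ a := by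
    linear_combination hα - algebraMap K _ a * h2
  have hg : ∀ g : Gal(SeparableClosure K/K), g α = α ∨ g α = α + 1 := by
    intro g
    have h1 : g α * g α + g α = algebraMap K _ a := by
      rw [← map_mul, ← map_add, hα', AlgEquiv.commutes]
    have h3 : (g α - α) * (g α - (α + 1)) = 0 := by
      linear_combination h1 - hα' + (α * α + α - g α - g α * α) * h2
    rcases mul_eq_zero.1 h3 with h | h
    · exact Or.inl (sub_eq_zero.1 h)
    · exact Or.inr (sub_eq_zero.1 h)
  classical
  let f : Gal(SeparableClosure K/K) → Multiplicative (ZMod 2) := fun g => if g α = α then 1 else gen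
  have hf : ∀ g, g α = α + chi _ (f g) := by
    intro g
    by_cases h : g α = α
    · simp [f, h]
    · simp only [f, if_neg h, chi_gen]
      exact (hg g).resolve_left h
  have hchi : ∀ (g : Gal(SeparableClosure K/K)) γ,
      g (chi (SeparableClosure K) γ) = chi _ γ := by
    intro g γ
    rcases eq_one_or_eq_gen γ with rfl | rfl <;> simp
  let F : Gal(SeparableClosure K/K) →* Multiplicative (ZMod 2) :=
    MonoidHom.mk' f fun g h => by
      apply chi_injective (SeparableClosure K)
      rw [chi_mul]
      apply add_left_cancel (a := α)
      rw [← hf, AlgEquiv.mul_apply, hf h, map_add, hf g, hchi, add_assoc]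
  refine ⟨⟨F, ?_⟩, α, hα', hf⟩
  let _ : TopologicalSpace (Multiplicative (ZMod 2)) := ⊥
  have : DiscreteTopology (Multiplicative (ZMod 2)) := ⟨rfl⟩
  -- `F` is trivial on the fixing subgroup of `K(α)`, which is open.
  refine continuous_of_continuousAt_one F ?_
  have hfin : FiniteDimensional K (IntermediateField.adjoin K {α}) :=
    IntermediateField.adjoin.finiteDimensional (Algebra.IsIntegral.isIntegral α)
  have hopen := IntermediateField.fixingSubgroup_isOpen (IntermediateField.adjoin K {α})
  refine ContinuousAt.congr (f := fun _ => 1) continuousAt_const ?_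
  filter_upwards [hopen.mem_nhds (one_mem _)] with g hg
  have : g α = α := (IntermediateField.mem_fixingSubgroup_iff _ _).1 hg α
    (IntermediateField.mem_adjoin_simple_self K α)
  change 1 = f g
  simp [f, this]

theorem chi_fixed (g : Gal(SeparableClosure K/K)) (γ : Multiplicative (ZMod 2)) :
    g (chi (SeparableClosure K) γ) = chi _ γ := by
  rcases eq_one_or_eq_gen γ with rfl | rfl <;> simp

/-- Additive Hilbert 90. For non-trivial `ρ` the kernel is closed, so the Galois correspondence
gives `β` fixed by the kernel but moved by some `g₀`. Then `β / (β + g₀ β)` has trace one, that is,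
its conjugate differs from it by `1`. -/
theorem exists_isASGen [CharP K 2] (ρ : GalHom K (Multiplicative (ZMod 2))) :
    ∃ (a : K) (α : SeparableClosure K), IsASGen ρ a α := by
  have h2 : (2 : SeparableClosure K) = 0 := CharTwo.two_eq_zero
  suffices h : ∃ α : SeparableClosure K, ∀ g, g α = α + chi _ (ρ.1 g) by
    obtain ⟨α, hα⟩ := h
    obtain ⟨a, ha⟩ := (InfiniteGalois.mem_range_algebraMap_iff_fixed (k := K) (α * α + α)).2 fun g => by
      rw [map_add, map_mul, hα]
      rcases eq_one_or_eq_gen (ρ.1 g) with h | h <;> rw [h]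
      · simp
      · rw [chi_gen]
        linear_combination (α + 1) * h2
    exact ⟨a, α, ha.symm, hα⟩
  by_cases htriv : ∀ g, ρ.1 g = 1
  · exact ⟨0, fun g => by simp [htriv g]⟩
  push Not at htriv
  obtain ⟨g₀, hg₀⟩ := htriv
  have hg₀' : ρ.1 g₀ = gen := (eq_one_or_eq_gen _).resolve_left hg₀
  have hopen : IsOpen (ρ.1.ker : Set Gal(SeparableClosure K/K)) :=
    ρ.2.isOpen_preimage {1} (@isOpen_discrete _ ⊥ ⟨rfl⟩ {1})
  let H : ClosedSubgroup Gal(SeparableClosure K/K) := ⟨ρ.1.ker, ρ.1.ker.isClosed_of_isOpen hopen⟩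
  have hH := InfiniteGalois.fixingSubgroup_fixedField H
  obtain ⟨β, hβ, hβ'⟩ : ∃ β ∈ IntermediateField.fixedField (H : Subgroup Gal(SeparableClosure K/K)), g₀ β ≠ β := by
    by_contra! hcon
    have : g₀ ∈ (IntermediateField.fixedField (H : Subgroup Gal(SeparableClosure K/K))).fixingSubgroup :=
      (IntermediateField.mem_fixingSubgroup_iff _ _).2 hcon
    rw [hH] at this
    exact hg₀ this
  have hfix : ∀ g, ρ.1 g = 1 → g β = β := fun g hg =>
    (IntermediateField.mem_fixedField_iff _ _).1 hβ g hg
  have hgβ : ∀ g, ρ.1 g = gen → g β = g₀ β := by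
    intro g hg
    have := hfix (g₀⁻¹ * g) (by rw [map_mul, map_inv, hg, hg₀', inv_mul_cancel])
    rw [AlgEquiv.mul_apply] at this
    conv_rhs => rw [← this]
    rw [← AlgEquiv.mul_apply, mul_inv_cancel, AlgEquiv.one_apply]
  have hgβ' : ∀ g, g (g₀ β) = if ρ.1 g = 1 then g₀ β else β := by
    intro g
    rw [← AlgEquiv.mul_apply]
    rcases eq_one_or_eq_gen (ρ.1 g) with h | h
    · rw [if_pos h, hgβ _ (by rw [map_mul, h, hg₀', one_mul])]
    · rw [if_neg (by rw [h]; exact gen_ne_one), hfix _ (by rw [map_mul, h, hg₀', gen_mul_gen])]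
  have hne : β + g₀ β ≠ 0 := fun h => hβ' (by linear_combination h - β * h2)
  refine ⟨β / (β + g₀ β), fun g => ?_⟩
  rw [map_div₀, map_add, hgβ']
  rcases eq_one_or_eq_gen (ρ.1 g) with h | h
  · rw [hfix g h, if_pos h, h, chi_one, add_zero]
  · rw [hgβ g h, if_neg (by rw [h]; exact gen_ne_one), h, chi_gen]
    rw [add_comm (g₀ β) β, div_add_one hne]
    congr 1
    linear_combination -β * h2

/-- Two roots of one equation differ by a Galois-fixed element of the prime field. With
`IsASGen.add` and `IsASGen.exists_add` this identifies homomorphisms with classes modulo the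
elements `x ^ 2 + x`. -/
theorem IsASGen.eq_of_same [CharP K 2] {ρ ρ' : GalHom K (Multiplicative (ZMod 2))} {a : K}
    {α α' : SeparableClosure K} (h : IsASGen ρ a α) (h' : IsASGen ρ' a α') : ρ = ρ' := by
  have h2 : (2 : SeparableClosure K) = 0 := CharTwo.two_eq_zero
  have h3 : (α' - α) * (α' - (α + 1)) = 0 := by
    linear_combination h'.eq - h.eq + (α * α + α - α' - α' * α) * h2
  have hα : ∃ γ, α' = α + chi _ γ := by
    rcases mul_eq_zero.1 h3 with h | h
    · exact ⟨1, by simpa using sub_eq_zero.1 h⟩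
    · exact ⟨gen, by simpa using sub_eq_zero.1 h⟩
  obtain ⟨γ, rfl⟩ := hα
  refine Subtype.ext (MonoidHom.ext fun g => chi_injective (SeparableClosure K) ?_)
  have := h'.act g
  rw [map_add, chi_fixed, h.act g] at this
  linear_combination this

theorem IsASGen.add [CharP K 2] {ρ : GalHom K (Multiplicative (ZMod 2))} {a : K}
    {α : SeparableClosure K} (h : IsASGen ρ a α) (x : K) :
    IsASGen ρ (a + (x * x + x)) (α + algebraMap K _ x) := by
  have h2 : (2 : SeparableClosure K) = 0 := CharTwo.two_eq_zero
  refine ⟨?_, fun g => ?_⟩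
  · simp only [map_add, map_mul]
    linear_combination h.eq + α * algebraMap K _ x * h2
  · rw [map_add, h.act, AlgEquiv.commutes]
    ring

theorem IsASGen.exists_add [CharP K 2] {ρ : GalHom K (Multiplicative (ZMod 2))} {a a' : K}
    {α α' : SeparableClosure K} (h : IsASGen ρ a α) (h' : IsASGen ρ a' α') :
    ∃ x : K, a + a' = x * x + x := by
  have h2 : (2 : SeparableClosure K) = 0 := CharTwo.two_eq_zero
  obtain ⟨x, hx⟩ := (InfiniteGalois.mem_range_algebraMap_iff_fixed (k := K) (α + α')).2 fun g => by
    rw [map_add, h.act, h'.act]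
    linear_combination chi _ (ρ.1 g) * h2
  refine ⟨x, (algebraMap K (SeparableClosure K)).injective ?_⟩
  simp only [map_add, map_mul, hx]
  linear_combination -h.eq - h'.eq - α * α' * h2

/-- A sufficient condition for the conductor in terms of an Artin–Schreier equation. -/
theorem IsASGen.hasConductor [CharP K 2] [IsDomain O] [IsFractionRing O K] [IsIntegrallyClosed O]
    {ϖ : O} (hϖ : ϖ ≠ 0) {ρ : GalHom K (Multiplicative (ZMod 2))} {a : K}
    {α : SeparableClosure K} (h : IsASGen ρ a α) (i : ℕ) {b : O}
    (hb : algebraMap O K (ϖ ^ (2 * i)) * a = algebraMap O K b)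
    (hint : ∀ (x : K) (y N : O), x * x + x * algebraMap O K y +
      a * (algebraMap O K y * algebraMap O K y) = algebraMap O K N →
        (∃ x' : O, algebraMap O K x' = x) ∧ ∃ c : O, y = ϖ ^ i * c) :
    HasConductor ϖ ρ i := by
  have h2 : (2 : SeparableClosure K) = 0 := CharTwo.two_eq_zero
  let L := SeparableClosure K
  let j : O →+* L := algebraMap O L
  have hj : ∀ c, j c = algebraMap K L (algebraMap O K c) := fun c =>
    IsScalarTower.algebraMap_apply O K L c
  have hjinj : Function.Injective j := by
    intro x y hxy
    rw [hj, hj] at hxy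
    exact IsFractionRing.injective O K ((algebraMap K L).injective hxy)
  -- the element `π`
  let p : Multiplicative (ZMod 2) → L := fun δ => j (ϖ ^ i) * (α + chi L δ)
  have hchi2 : ∀ δ, chi L δ * chi L δ = chi L δ := by
    intro δ
    rcases eq_one_or_eq_gen δ with rfl | rfl <;> simp
  have hpp : p * p = algebraMap O _ (ϖ ^ i) * p + algebraMap O _ b := by
    funext δ
    change j (ϖ ^ i) * (α + chi L δ) * (j (ϖ ^ i) * (α + chi L δ))
      = j (ϖ ^ i) * (j (ϖ ^ i) * (α + chi L δ)) + j b
    have hb' : j (ϖ ^ i) * j (ϖ ^ i) * algebraMap K L a = j b := by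
      rw [hj b, ← hb, map_mul, ← hj, ← map_mul j, ← pow_add, two_mul]
    linear_combination hb' + j (ϖ ^ i) * j (ϖ ^ i) * (h.eq + hchi2 δ) +
      j (ϖ ^ i) * j (ϖ ^ i) * (α * chi L δ - α) * h2
  have hpint : IsIntegral O p := by
    refine ⟨Polynomial.X ^ 2 - (Polynomial.C (ϖ ^ i) * Polynomial.X + Polynomial.C b), ?_, ?_⟩
    · refine Polynomial.monic_X_pow_sub (n := 2) ?_
      exact Polynomial.degree_linear_le.trans_lt (by norm_num)
    · simp only [Polynomial.eval₂_sub, Polynomial.eval₂_add, Polynomial.eval₂_mul,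
        Polynomial.eval₂_pow, Polynomial.eval₂_X, Polynomial.eval₂_C]
      rw [sq, hpp, sub_self]
  have hpmem : p ∈ torsorIntSubalgebra O ρ := by
    refine ⟨hpint, fun g γ => ?_⟩
    change j (ϖ ^ i) * (α + chi L (ρ.1 g * γ)) = g (j (ϖ ^ i) * (α + chi L γ))
    rw [map_mul, map_add, h.act, chi_fixed, chi_mul, hj, AlgEquiv.commutes, add_assoc]
  let π : TorsorInt O ρ := ⟨p, hpmem⟩
  let f : (Fin 2 → O) →ₗ[O] TorsorInt O ρ :=
    { toFun := fun c => algebraMap O _ (c 0) + c 1 • π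
      map_add' := fun c d => by simp only [Pi.add_apply, map_add, add_smul]; ring
      map_smul' := fun c d => by
        simp only [Pi.smul_apply, smul_eq_mul, map_mul, mul_smul, smul_add, RingHom.id_apply,
          Algebra.smul_def c (algebraMap O (TorsorInt O ρ) (d 0))] }
  have hfval : ∀ c δ, (f c).1 δ = j (c 0) + j (c 1) * p δ := by
    intro c δ
    change j (c 0) + c 1 • p δ = _
    rw [Algebra.smul_def]
  have hinj : Function.Injective f := by
    refine (injective_iff_map_eq_zero _).2 fun c hc => ?_
    have h0 : ∀ δ, j (c 0) + j (c 1) * p δ = 0 := fun δ => by rw [← hfval, hc]; rfl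
    have h1 := h0 1
    have hg := h0 gen
    simp only [p, chi_one, chi_gen] at h1 hg
    have h3 : j (c 1 * ϖ ^ i) = 0 := by
      rw [map_mul]
      linear_combination hg - h1
    have h4 : c 1 = 0 := (mul_eq_zero.1 (hjinj (h3.trans (map_zero j).symm))).resolve_right
      (pow_ne_zero _ hϖ)
    rw [h4, map_zero, zero_mul, add_zero] at h1
    have h5 : c 0 = 0 := hjinj (h1.trans (map_zero j).symm)
    funext l
    fin_cases l
    · exact h5
    · exact h4
  -- Every Galois element fixes or swaps the components `z 1` and `z gen`, so their sum `y` and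
  -- product `N` lie in `O`. Then `z 1 = x + y α` with `x` in `K`, and `N` is the norm form of
  -- `hint`, which makes `x` integral and `y` divisible by `ϖ ^ i`. Trivial and non-trivial `ρ` are
  -- treated alike.
  have hsurj : Function.Surjective f := by
    rintro ⟨z, hz⟩
    have hzint : ∀ δ, IsIntegral O (z δ) := fun δ => hz.1.map (Pi.evalAlgHom O (fun _ => L) δ)
    have hz1 : ∀ g, ρ.1 g = 1 → ∀ γ, g (z γ) = z γ := fun g hg γ => by
      rw [← hz.2 g γ, hg, one_mul]
    have hz2 : ∀ g, ρ.1 g = gen → g (z 1) = z gen ∧ g (z gen) = z 1 := fun g hg => by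
      rw [← hz.2 g 1, ← hz.2 g gen, hg, mul_one, gen_mul_gen]
      exact ⟨rfl, rfl⟩
    have hK : ∀ w : L, IsIntegral O w → (∀ g : Gal(L/K), g w = w) → ∃ c : O, j c = w := by
      intro w hw hfix
      obtain ⟨x, rfl⟩ := (InfiniteGalois.mem_range_algebraMap_iff_fixed (k := K) w).2 hfix
      have := (isIntegral_algebraMap_iff (algebraMap K L).injective).1 hw
      obtain ⟨c, rfl⟩ := IsIntegrallyClosed.isIntegral_iff.1 this
      exact ⟨c, hj c⟩
    obtain ⟨y, hy⟩ := hK (z gen + z 1) ((hzint _).add (hzint _)) fun g => by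
      rcases eq_one_or_eq_gen (ρ.1 g) with hg | hg
      · rw [map_add, hz1 g hg, hz1 g hg]
      · rw [map_add, (hz2 g hg).1, (hz2 g hg).2, add_comm]
    obtain ⟨N, hN⟩ := hK (z gen * z 1) ((hzint _).mul (hzint _)) fun g => by
      rcases eq_one_or_eq_gen (ρ.1 g) with hg | hg
      · rw [map_mul, hz1 g hg, hz1 g hg]
      · rw [map_mul, (hz2 g hg).1, (hz2 g hg).2, mul_comm]
    obtain ⟨x, hx⟩ := (InfiniteGalois.mem_range_algebraMap_iff_fixed (k := K) (z 1 + j y * α)).2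
      fun g => by
        rw [map_add, map_mul, h.act, hj, AlgEquiv.commutes, ← hj]
        rcases eq_one_or_eq_gen (ρ.1 g) with hg | hg
        · rw [hz1 g hg, hg, chi_one, add_zero]
        · rw [(hz2 g hg).1, hg, chi_gen]
          linear_combination z gen * h2 + hy
    have hzgen : z gen = j y + z 1 := by linear_combination -hy - z 1 * h2
    have hz1' : z 1 = algebraMap K L x + j y * α := by
      linear_combination -hx - j y * α * h2
    obtain ⟨⟨x', hx'⟩, c, hc⟩ := hint x y N (by
      apply (algebraMap K L).injective
      simp only [map_add, map_mul, ← hj]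
      rw [hN, hzgen, hz1', ← h.eq]
      linear_combination (-j y * algebraMap K L x * α) * h2)
    refine ⟨![x', c], Subtype.ext (funext fun δ => ?_)⟩
    rw [hfval]
    change j x' + j c * (j (ϖ ^ i) * (α + chi L δ)) = z δ
    have hjy : j y = j (ϖ ^ i) * j c := by rw [hc, map_mul]
    have hjx : j x' = algebraMap K L x := by rw [hj, hx']
    rcases eq_one_or_eq_gen δ with rfl | rfl
    · rw [chi_one, hz1', hjx, hjy]
      ring
    · rw [chi_gen, hzgen, hz1', hjx, hjy]
      ring
  let B : Module.Basis (Fin 2) O (TorsorInt O ρ) :=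
    (Pi.basisFun O (Fin 2)).map (LinearEquiv.ofBijective f ⟨hinj, hsurj⟩)
  have hB : ∀ l, B l = f (Pi.single l 1) := fun l => by
    simp only [B, Module.Basis.map_apply, Pi.basisFun_apply]
    rfl
  have hB0 : B 0 = 1 := by
    rw [hB]
    change algebraMap O _ ((Pi.single 0 1 : Fin 2 → O) 0) + (Pi.single 0 1 : Fin 2 → O) 1 • π = 1
    simp
  have hB1 : B 1 = π := by
    rw [hB]
    change algebraMap O _ ((Pi.single 1 1 : Fin 2 → O) 0) + (Pi.single 1 1 : Fin 2 → O) 1 • π = π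
    simp
  refine ⟨B, hB0, ?_, b, ?_⟩
  · rw [hB1]
    refine Subtype.ext (funext fun δ => ?_)
    change j (ϖ ^ i) * (α + chi L (δ * gen)) = j (ϖ ^ i) * (α + chi L δ) + j (ϖ ^ i)
    rw [chi_mul, chi_gen]
    ring
  · rw [hB1, Algebra.smul_def]
    exact Subtype.ext hpp

end ArtinSchreier

/-! ### Reduced Artin–Schreier representatives over `k((t))` -/

section Reduction

/-- Arithmetic of the norm form `x ^ 2 + x y + a y ^ 2` where `a` has a pole of odd order
`2 i - 1`, or `i = 0` and `a` is integral. -/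
theorem norm_form_integral {O K : Type*} [CommRing O] [Field K] [Algebra O K] [IsDomain O]
    [IsFractionRing O K] [IsIntegrallyClosed O] [IsDiscreteValuationRing O] {ϖ : O}
    (hϖ : Irreducible ϖ) {a : K} {b : O} {i : ℕ}
    (hb : algebraMap O K (ϖ ^ (2 * i)) * a = algebraMap O K b)
    (hi : i = 0 ∨ ∃ b', b = ϖ * b' ∧ ¬ ϖ ∣ b') (x : K) (y N : O)
    (h : x * x + x * algebraMap O K y + a * (algebraMap O K y * algebraMap O K y)
      = algebraMap O K N) :
    (∃ x' : O, algebraMap O K x' = x) ∧ ∃ c : O, y = ϖ ^ i * c := by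
  have hprime := hϖ.prime
  have hinj := IsFractionRing.injective O K
  have hint : ∀ (x : K) (r s : O), x * x + x * algebraMap O K r = algebraMap O K s →
      ∃ x' : O, algebraMap O K x' = x := by
    intro x r s h
    refine IsIntegrallyClosed.isIntegral_iff.1
      ⟨Polynomial.X ^ 2 - (Polynomial.C (-r) * Polynomial.X + Polynomial.C s), ?_, ?_⟩
    · exact Polynomial.monic_X_pow_sub (n := 2) (Polynomial.degree_linear_le.trans_lt (by norm_num))
    · simp only [Polynomial.eval₂_sub, Polynomial.eval₂_add, Polynomial.eval₂_mul,
        Polynomial.eval₂_pow, Polynomial.eval₂_X, Polynomial.eval₂_C]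
      rw [map_neg]
      linear_combination h
  have hdvd : ∃ c : O, y = ϖ ^ i * c := by
    change ϖ ^ i ∣ y
    rcases hi with rfl | ⟨b', hb', hndvd⟩
    · simp
    by_contra hny
    have hy0 : y ≠ 0 := fun h0 => hny (h0 ▸ dvd_zero _)
    obtain ⟨e, u, rfl⟩ := IsDiscreteValuationRing.eq_unit_mul_pow_irreducible hy0 hϖ
    have hei : e < i := by
      by_contra! hle
      exact hny (Dvd.dvd.mul_left (pow_dvd_pow _ hle) _)
    -- Suppose `y` has valuation `e < i` and multiply the equation by `ϖ ^ (2 (i - e))`. The term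
    -- with `a` becomes `b u ^ 2`, of valuation exactly one. Reduction modulo `ϖ` shows that `z = ϖ
    -- ^ (i - e) x` is divisible by `ϖ`, so every other term is divisible by `ϖ ^ 2`, a
    -- contradiction.
    obtain ⟨f, rfl⟩ : ∃ f, i = e + f + 1 := ⟨i - e - 1, by omega⟩
    have hmul : algebraMap O K (ϖ ^ (f + 1)) * algebraMap O K (ϖ ^ (f + 1)) *
        (a * (algebraMap O K (u * ϖ ^ e) * algebraMap O K (u * ϖ ^ e)))
        = algebraMap O K (b * (u * u)) := by
      rw [map_mul _ b, ← hb]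
      simp only [map_mul, map_pow]
      ring
    obtain ⟨z, hz⟩ := hint (algebraMap O K (ϖ ^ (f + 1)) * x) (ϖ ^ (f + 1) * (u * ϖ ^ e))
      (ϖ ^ (f + 1) * ϖ ^ (f + 1) * N - b * (u * u)) (by
        rw [map_sub, ← hmul, map_mul _ _ N, ← h]
        simp only [map_mul]
        ring)
    have hz2 : z * z + z * (ϖ ^ (f + 1) * (u * ϖ ^ e)) + b * (u * u)
        = ϖ ^ (f + 1) * ϖ ^ (f + 1) * N := by
      apply hinj
      simp only [map_add, map_mul, hz]
      simp only [map_mul] at h hmul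
      rw [← hmul, ← h]
      ring
    have hϖz : ϖ ∣ z := by
      have : ϖ ∣ z * z := by
        have e1 : z * z = ϖ * (ϖ ^ f * ϖ ^ (f + 1) * N - z * (ϖ ^ f * (u * ϖ ^ e))
            - b' * (u * u)) := by
          rw [hb'] at hz2
          linear_combination hz2
        exact ⟨_, e1⟩
      exact (hprime.dvd_or_dvd this).elim id id
    obtain ⟨w, rfl⟩ := hϖz
    have : ϖ * (b' * (u * u)) = ϖ * (ϖ * (ϖ ^ f * ϖ ^ f * N - w * w - w * (ϖ ^ f * (u * ϖ ^ e)))) := by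
      rw [hb'] at hz2
      linear_combination hz2
    have hd : ϖ ∣ b' * (u * u) := ⟨_, mul_left_cancel₀ hϖ.ne_zero this⟩
    rw [(u.isUnit.mul u.isUnit).dvd_mul_right] at hd
    exact hndvd hd
  refine ⟨?_, hdvd⟩
  obtain ⟨c, rfl⟩ := hdvd
  refine hint x (ϖ ^ i * c) (N - b * (c * c)) ?_
  rw [map_sub, ← h, map_mul _ b, ← hb]
  simp only [map_mul, map_pow]
  ring

variable {k K : Type*} [Field k] [Field K] [Algebra k⟦X⟧ K]

/-- The element `d + ∑_{l < i} p_l t^{-(2 l + 1)}` of `K = k((t))`. -/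
def redForm (K : Type*) [Field K] [Algebra k⟦X⟧ K] (d : k) (p : ℕ → k) (i : ℕ) : K :=
  algebraMap k⟦X⟧ K (PowerSeries.C d) + ∑ l ∈ Finset.range i,
    algebraMap k⟦X⟧ K (PowerSeries.C (p l)) * (algebraMap k⟦X⟧ K PowerSeries.X)⁻¹ ^ (2 * l + 1)

theorem redForm_zero (d : k) (p : ℕ → k) :
    redForm K d p 0 = algebraMap k⟦X⟧ K (PowerSeries.C d) := by simp [redForm]

theorem redForm_succ (d : k) (p : ℕ → k) (i : ℕ) : redForm K d p (i + 1) = redForm K d p i +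
    algebraMap k⟦X⟧ K (PowerSeries.C (p i)) *
      (algebraMap k⟦X⟧ K PowerSeries.X)⁻¹ ^ (2 * i + 1) := by
  simp only [redForm, Finset.sum_range_succ, add_assoc]

theorem redForm_congr (d : k) {p p' : ℕ → k} {i : ℕ} (h : ∀ l < i, p l = p' l) :
    redForm K d p i = redForm K d p' i := by
  unfold redForm
  congr 1
  exact Finset.sum_congr rfl fun l hl => by rw [h l (Finset.mem_range.1 hl)]

theorem redForm_add (d d' : k) (p p' : ℕ → k) (i : ℕ) :
    redForm K d p i + redForm K d' p' i = redForm K (d + d') (p + p') i := by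
  simp only [redForm, map_add, Pi.add_apply, add_mul, Finset.sum_add_distrib]
  ring

variable [IsFractionRing k⟦X⟧ K]

theorem algebraMap_X_ne_zero : algebraMap k⟦X⟧ K PowerSeries.X ≠ 0 := fun h =>
  PowerSeries.X_ne_zero (IsFractionRing.injective k⟦X⟧ K (h.trans (map_zero _).symm))

theorem redForm_integral (d : k) (p : ℕ → k) (i : ℕ) :
    ∃ b : k⟦X⟧, algebraMap k⟦X⟧ K (PowerSeries.X ^ (2 * i)) * redForm K d p i
      = algebraMap k⟦X⟧ K b := by
  induction i with
  | zero => exact ⟨PowerSeries.C d, by rw [redForm_zero]; simp⟩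
  | succ i ih =>
    obtain ⟨b, hb⟩ := ih
    refine ⟨PowerSeries.X ^ 2 * b + PowerSeries.X * PowerSeries.C (p i), ?_⟩
    have hX := algebraMap_X_ne_zero (k := k) (K := K)
    rw [redForm_succ, map_add, map_mul, ← hb]
    simp only [map_pow, map_mul]
    have e1 : (algebraMap k⟦X⟧ K PowerSeries.X) ^ (2 * (i + 1)) *
        (algebraMap k⟦X⟧ K PowerSeries.X)⁻¹ ^ (2 * i + 1) = algebraMap k⟦X⟧ K PowerSeries.X := by
      rw [inv_pow, show 2 * (i + 1) = 2 * i + 1 + 1 by ring, pow_succ _ (2 * i + 1)]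
      field_simp
    linear_combination e1 * algebraMap k⟦X⟧ K (PowerSeries.C (p i))

/-- The pole has odd order `2i + 1`, so multiplication by the even power `t ^ (2i + 2)` leaves
valuation exactly one. This is the hypothesis needed in `norm_form_integral`. -/
theorem redForm_succ_odd (d : k) (p : ℕ → k) (i : ℕ) (hp : p i ≠ 0) :
    ∃ b' : k⟦X⟧, algebraMap k⟦X⟧ K (PowerSeries.X ^ (2 * (i + 1))) * redForm K d p (i + 1)
      = algebraMap k⟦X⟧ K (PowerSeries.X * b') ∧ ¬ PowerSeries.X ∣ b' := by
  obtain ⟨b, hb⟩ := redForm_integral (K := K) d p i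
  refine ⟨PowerSeries.X * b + PowerSeries.C (p i), ?_, ?_⟩
  · have hX := algebraMap_X_ne_zero (k := k) (K := K)
    rw [redForm_succ, map_mul, map_add, map_mul, ← hb]
    simp only [map_pow]
    have e1 : (algebraMap k⟦X⟧ K PowerSeries.X) ^ (2 * (i + 1)) *
        (algebraMap k⟦X⟧ K PowerSeries.X)⁻¹ ^ (2 * i + 1) = algebraMap k⟦X⟧ K PowerSeries.X := by
      rw [inv_pow, show 2 * (i + 1) = 2 * i + 1 + 1 by ring, pow_succ _ (2 * i + 1)]
      field_simp
    linear_combination e1 * algebraMap k⟦X⟧ K (PowerSeries.C (p i))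
  · rw [PowerSeries.X_dvd_iff]
    simpa using hp

theorem redForm_norm_form (d : k) (p : ℕ → k) (i : ℕ) (hi : i = 0 ∨ p (i - 1) ≠ 0) :
    ∃ b : k⟦X⟧, algebraMap k⟦X⟧ K (PowerSeries.X ^ (2 * i)) * redForm K d p i
        = algebraMap k⟦X⟧ K b ∧
      (i = 0 ∨ ∃ b', b = PowerSeries.X * b' ∧ ¬ PowerSeries.X ∣ b') := by
  rcases i with - | i
  · obtain ⟨b, hb⟩ := redForm_integral (K := K) d p 0
    exact ⟨b, hb, Or.inl rfl⟩
  · obtain ⟨b', hb, hb'⟩ := redForm_succ_odd (K := K) d p i (by simpa using hi)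
    exact ⟨_, hb, Or.inr ⟨b', rfl, hb'⟩⟩

/-- Gives the uniqueness of reduced forms: an element `x ^ 2 + x` has no non-zero reduced pole part,
and its constant must itself have the form `z ^ 2 + z`. -/
theorem redForm_eq_wp (d : k) (p : ℕ → k) (i : ℕ) (x : K)
    (h : redForm K d p i = x * x + x) : (∃ z : k, d = z * z + z) ∧ ∀ l < i, p l = 0 := by
  induction i with
  | zero =>
    refine ⟨?_, by simp⟩
    obtain ⟨⟨x', rfl⟩, -⟩ := norm_form_integral (O := k⟦X⟧) PowerSeries.X_irreducible (a := (0 : K))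
      (b := 0) (i := 0) (by simp) (Or.inl rfl) x 1 (PowerSeries.C d) (by
        rw [redForm_zero] at h
        rw [h]
        simp)
    rw [redForm_zero, ← map_mul, ← map_add] at h
    have := IsFractionRing.injective k⟦X⟧ K h
    refine ⟨PowerSeries.constantCoeff x', ?_⟩
    have h2 := congrArg PowerSeries.constantCoeff this
    simpa using h2
  | succ i ih =>
    by_cases hp : p i = 0
    · rw [redForm_succ, hp, map_zero, map_zero, zero_mul, add_zero] at h
      obtain ⟨h1, h2⟩ := ih h
      exact ⟨h1, fun l hl => (Nat.lt_succ_iff_lt_or_eq.1 hl).elim (h2 l) fun e => e ▸ hp⟩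
    · exfalso
      obtain ⟨b', hb, hb'⟩ := redForm_succ_odd (K := K) d p i hp
      have hb2 : algebraMap k⟦X⟧ K (PowerSeries.X ^ (2 * (i + 1))) * (-redForm K d p (i + 1))
          = algebraMap k⟦X⟧ K (PowerSeries.X * (-b')) := by
        rw [mul_neg, hb, ← map_neg, mul_neg]
      -- The equation `h` is the norm form with `y = 1` and `N = 0`, which would make `1` divisible
      -- by `t ^ (i + 1)`.
      obtain ⟨-, c, hc⟩ := norm_form_integral (O := k⟦X⟧) PowerSeries.X_irreducible hb2
        (Or.inr ⟨_, rfl, by simpa using hb'⟩) x 1 0 (by rw [h]; simp)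
      have h0 := congrArg PowerSeries.constantCoeff hc
      simp at h0

/-- `t k[[t]]` is contained in the image of the Artin–Schreier operator. -/
theorem exists_wp_eq_X_mul (w : k⟦X⟧) : ∃ y : k⟦X⟧, PowerSeries.X * w = y * y + y := by
  have hH : HenselianRing k⟦X⟧ (Ideal.span {PowerSeries.X}) := inferInstance
  -- Hensel's lemma for `Y ^ 2 + Y - t w`, starting from the root `0` modulo `t`, where the
  -- derivative is `1`.
  obtain ⟨y, hy, -⟩ := hH.is_henselian (Polynomial.X ^ 2 - (Polynomial.C (-1) * Polynomial.X +
      Polynomial.C (PowerSeries.X * w)))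
    (Polynomial.monic_X_pow_sub (n := 2) (Polynomial.degree_linear_le.trans_lt (by norm_num))) 0
    (by
      simp only [Polynomial.eval_sub, Polynomial.eval_add, Polynomial.eval_mul,
        Polynomial.eval_pow, Polynomial.eval_X, Polynomial.eval_C]
      rw [Ideal.mem_span_singleton]
      exact ⟨-w, by ring⟩)
    (by simp)
  refine ⟨y, ?_⟩
  simp only [Polynomial.IsRoot.def, Polynomial.eval_sub, Polynomial.eval_add, Polynomial.eval_mul,
    Polynomial.eval_pow, Polynomial.eval_X, Polynomial.eval_C] at hy
  linear_combination -hy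

/-- In a finite field of characteristic two the Artin–Schreier operator has index two. -/
theorem exists_wp_complement (k : Type*) [Field k] [Finite k] [CharP k 2] :
    ∃ c : k, (∀ z, c ≠ z * z + z) ∧ ∀ d : k, ∃ z, d = z * z + z ∨ d = z * z + z + c := by
  have h2 : (2 : k) = 0 := CharTwo.two_eq_zero
  let f : k →+ k :=
    { toFun := fun z => z * z + z
      map_zero' := by simp
      map_add' := fun x y => by linear_combination x * y * h2 }
  have hker : (f.ker : Set k) = {0, 1} := by
    ext z
    change z * z + z = 0 ↔ z = 0 ∨ z = 1
    constructor
    · intro h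
      have : z * (z - 1) = 0 := by linear_combination h - z * h2
      exact (mul_eq_zero.1 this).imp id sub_eq_zero.1
    · rintro (rfl | rfl)
      · simp
      · linear_combination h2
  have hcard : Nat.card f.ker = 2 := by
    change Nat.card (f.ker : Set k) = 2
    rw [hker, Nat.card_coe_set_eq, Set.ncard_pair zero_ne_one]
  have hidx : f.range.index = 2 := by
    have h1 := f.range.card_mul_index
    have h3 := f.ker.card_mul_index
    rw [AddSubgroup.index_ker] at h3
    have h4 : 0 < Nat.card f.range := Nat.card_pos
    refine Nat.eq_of_mul_eq_mul_left h4 ?_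
    rw [h1, ← h3, hcard, mul_comm]
  obtain ⟨c, hc⟩ := AddSubgroup.index_eq_two_iff.1 hidx
  refine ⟨c, fun z hz => ?_, fun d => ?_⟩
  · have := hc 0
    rw [zero_add] at this
    exact this.elim (fun h => h.2 (zero_mem _)) fun h => h.2 ⟨z, hz.symm⟩
  · rcases hc d with ⟨⟨z, hz⟩, -⟩ | ⟨⟨z, hz⟩, -⟩
    · refine ⟨z, Or.inr ?_⟩
      have hz' : z * z + z = d + c := hz
      rw [hz']
      linear_combination -c * h2
    · exact ⟨z, Or.inl hz.symm⟩

/-- Even poles can be removed: `k` is perfect, and `s ^ 2 t^{-2j}` agrees with `s t^{-j}` modulo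
elements `x ^ 2 + x`. Odd poles are recorded in `p`. At pole order zero, `exists_wp_eq_X_mul`
removes everything but the constant, which is reduced to `0` or `c`. -/
theorem exists_redForm_of_integral [Finite k] [CharP k 2] {c : k}
    (hc : ∀ d : k, ∃ z, d = z * z + z ∨ d = z * z + z + c) (i : ℕ) :
    ∀ (a : K) (w : k⟦X⟧),
      algebraMap k⟦X⟧ K (PowerSeries.X ^ (2 * i)) * a = algebraMap k⟦X⟧ K w →
      ∃ (x : K) (ε : Bool) (p : ℕ → k), a = x * x + x + redForm K (if ε then c else 0) p i := by
  have h2 : (2 : k⟦X⟧) = 0 := by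
    rw [← map_ofNat (PowerSeries.C (R := k)) 2, CharTwo.two_eq_zero, map_zero]
  have h2K : (2 : K) = 0 := by
    rw [← map_ofNat (algebraMap k⟦X⟧ K) 2, h2, map_zero]
  have hX := algebraMap_X_ne_zero (k := k) (K := K)
  have hsplit : ∀ w : k⟦X⟧, ∃ w', w = PowerSeries.X * w' +
      PowerSeries.C (PowerSeries.constantCoeff w) := fun w =>
    ⟨_, PowerSeries.eq_X_mul_shift_add_const w⟩
  induction i with
  | zero =>
    intro a w hw
    simp only [mul_zero, pow_zero, map_one, one_mul] at hw
    subst hw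
    obtain ⟨w', hw'⟩ := hsplit w
    obtain ⟨y, hy⟩ := exists_wp_eq_X_mul w'
    obtain ⟨z, hz⟩ := hc (PowerSeries.constantCoeff w)
    obtain ⟨ε, hε⟩ : ∃ ε : Bool, PowerSeries.constantCoeff w = z * z + z + if ε then c else 0 := by
      rcases hz with hz | hz
      · exact ⟨false, by simpa using hz⟩
      · exact ⟨true, by simpa using hz⟩
    refine ⟨algebraMap k⟦X⟧ K (y + PowerSeries.C z), ε, 0, ?_⟩
    rw [redForm_zero, ← map_mul, ← map_add, ← map_add]
    congr 1
    rw [hw', hy, hε, map_add, map_add, map_mul]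
    linear_combination (-y * PowerSeries.C z) * h2
  | succ i ih =>
    intro a w hw
    obtain ⟨w', hw'⟩ := hsplit w
    obtain ⟨s, hs⟩ := FiniteField.isSquare_of_char_two (ringChar.eq k 2 ▸ rfl)
      (PowerSeries.constantCoeff w)
    set T := algebraMap k⟦X⟧ K PowerSeries.X with hT
    set σ := algebraMap k⟦X⟧ K (PowerSeries.C s) with hσ
    obtain ⟨v', hv'⟩ := hsplit (w' + PowerSeries.C s * PowerSeries.X ^ i)
    set v₀ := PowerSeries.constantCoeff (w' + PowerSeries.C s * PowerSeries.X ^ i)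
    have hw2 : T ^ (2 * (i + 1)) * a = T * algebraMap k⟦X⟧ K w' + σ * σ := by
      rw [hT, ← map_pow, hw, hw', hs]
      simp only [map_add, map_mul, hσ]
    have hv2 : algebraMap k⟦X⟧ K w' + σ * T ^ i
        = T * algebraMap k⟦X⟧ K v' + algebraMap k⟦X⟧ K (PowerSeries.C v₀) := by
      rw [hT, hσ, ← map_pow, ← map_mul, ← map_mul, ← map_add, ← map_add, ← hv']
    -- Adding `y ^ 2 + y` cancels the leading even term and leaves `t^{-(2i+1)} (w' + s t^i)`. Its
    -- leading coefficient `v₀` becomes the coefficient of index `i`, and the remainder `t^{-2i} v'`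
    -- falls under the induction hypothesis.
    set y := σ * T⁻¹ ^ (i + 1) with hy
    have hyT : T ^ (i + 1) * y = σ := by
      rw [hy, inv_pow]
      field_simp
    obtain ⟨x, ε, p, hx⟩ := ih (a + (y * y + y) -
        algebraMap k⟦X⟧ K (PowerSeries.C v₀) * T⁻¹ ^ (2 * i + 1)) v' (by
      rw [map_pow, ← hT]
      refine mul_left_cancel₀ (pow_ne_zero 2 hX) ?_
      have e1 : T ^ (2 * i + 1) * T⁻¹ ^ (2 * i + 1) = 1 := by
        rw [← mul_pow, mul_inv_cancel₀ hX, one_pow]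
      linear_combination hw2 + T * hv2 + (T ^ (i + 1) * y + σ + T ^ (i + 1)) * hyT -
        T * algebraMap k⟦X⟧ K (PowerSeries.C v₀) * e1 + σ * σ * h2K)
    refine ⟨x + y, ε, Function.update p i v₀, ?_⟩
    rw [redForm_succ, Function.update_self,
      redForm_congr (p' := p) _ fun l hl => Function.update_of_ne hl.ne _ _]
    linear_combination hx - (x * y + y * y + y) * h2K

theorem exists_redForm [Finite k] [CharP k 2] {c : k}
    (hc : ∀ d : k, ∃ z, d = z * z + z ∨ d = z * z + z + c) (a : K) :
    ∃ (x : K) (ε : Bool) (i : ℕ) (p : ℕ → k), (i = 0 ∨ p (i - 1) ≠ 0) ∧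
      a = x * x + x + redForm K (if ε then c else 0) p i := by
  obtain ⟨n, d, hd, rfl⟩ := IsFractionRing.div_surjective (A := k⟦X⟧) a
  have hd0 : d ≠ 0 := nonZeroDivisors.ne_zero hd
  obtain ⟨e, u, rfl⟩ := IsDiscreteValuationRing.eq_unit_mul_pow_irreducible hd0
    (PowerSeries.X_irreducible (R := k))
  obtain ⟨x, ε, p, hx⟩ := exists_redForm_of_integral (K := K) hc e
    (algebraMap k⟦X⟧ K n / algebraMap k⟦X⟧ K ((u : k⟦X⟧) * PowerSeries.X ^ e))
    (PowerSeries.X ^ e * ((↑u⁻¹ : k⟦X⟧) * n)) (by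
      have hu : algebraMap k⟦X⟧ K ((u : k⟦X⟧) * PowerSeries.X ^ e) ≠ 0 := fun h =>
        hd0 (IsFractionRing.injective k⟦X⟧ K (h.trans (map_zero (algebraMap k⟦X⟧ K)).symm))
      rw [← mul_div_assoc, div_eq_iff hu, ← map_mul, ← map_mul]
      congr 1
      have hu' : (↑u⁻¹ : k⟦X⟧) * u = 1 := u.inv_mul
      linear_combination (-(PowerSeries.X ^ e * PowerSeries.X ^ e * n)) * hu')
  -- The bound on the pole may be generous, so vanishing top coefficients are dropped.
  have htrim : ∀ i, ∃ i', (i' = 0 ∨ p (i' - 1) ≠ 0) ∧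
      redForm K (if ε then c else 0) p i = redForm K (if ε then c else 0) p i' := by
    intro i
    induction i with
    | zero => exact ⟨0, Or.inl rfl, rfl⟩
    | succ i ih =>
      by_cases hp : p i = 0
      · obtain ⟨i', h1, h2⟩ := ih
        exact ⟨i', h1, by rw [redForm_succ, hp, map_zero, map_zero, zero_mul, add_zero, h2]⟩
      · exact ⟨i + 1, Or.inr hp, rfl⟩
  obtain ⟨i', h1, h2⟩ := htrim e
  exact ⟨x, ε, i', p, h1, by rw [hx, h2]⟩

end Reduction

/-! ### Counting homomorphisms by discriminant -/

section Counting

theorem powerSeries_two_eq_zero {k : Type*} [Field k] [CharP k 2] : (2 : k⟦X⟧) = 0 := by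
  rw [← map_ofNat (PowerSeries.C (R := k)) 2, CharTwo.two_eq_zero, map_zero]

variable {k K : Type*} [Field k] [Field K] [Algebra k⟦X⟧ K]

theorem HasConductor.discrIdeal_eq_maximalIdeal_pow [CharP k 2] {ρ : GalHom K (Multiplicative (ZMod 2))} {i : ℕ}
    (h : HasConductor (PowerSeries.X : k⟦X⟧) ρ i) :
    discrIdeal k⟦X⟧ ρ = IsLocalRing.maximalIdeal k⟦X⟧ ^ (2 * i) := by
  rw [h.discrIdeal_eq powerSeries_two_eq_zero, PowerSeries.maximalIdeal_eq_span_X]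

theorem HasConductor.unique [CharP k 2] {ρ : GalHom K (Multiplicative (ZMod 2))} {i j : ℕ}
    (hi : HasConductor (PowerSeries.X : k⟦X⟧) ρ i) (hj : HasConductor (PowerSeries.X : k⟦X⟧) ρ j) :
    i = j := by
  have hinj : Function.Injective fun n : ℕ => IsLocalRing.maximalIdeal k⟦X⟧ ^ n :=
    (Ideal.pow_right_strictAnti _ (IsDiscreteValuationRing.not_a_field _)
      (IsLocalRing.maximalIdeal.isMaximal _).ne_top).injective
  have := hinj (hi.discrIdeal_eq_maximalIdeal_pow.symm.trans hj.discrIdeal_eq_maximalIdeal_pow)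
  omega

variable [IsFractionRing k⟦X⟧ K] [CharP K 2]

theorem IsASGen.hasConductor_redForm {ρ : GalHom K (Multiplicative (ZMod 2))} {d : k} {p : ℕ → k}
    {i : ℕ} {α : SeparableClosure K} (h : IsASGen ρ (redForm K d p i) α)
    (hi : i = 0 ∨ p (i - 1) ≠ 0) : HasConductor (PowerSeries.X : k⟦X⟧) ρ i := by
  obtain ⟨b, hb, hb'⟩ := redForm_norm_form (K := K) d p i hi
  exact h.hasConductor PowerSeries.X_ne_zero i hb
    fun x y N hN => norm_form_integral PowerSeries.X_irreducible hb hb' x y N hN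

variable [CharP k 2]

/-- The homomorphism attached to an Artin–Schreier equation. -/
def galOf (a : K) : GalHom K (Multiplicative (ZMod 2)) := (exists_isASGen_of_elem a).choose

theorem galOf_spec (a : K) : ∃ α, IsASGen (galOf a) a α := (exists_isASGen_of_elem a).choose_spec

/-- In characteristic two the difference of two reduced forms is their sum, again of reduced shape.
If the homomorphisms agree it equals some `x ^ 2 + x`, so `redForm_eq_wp` applies. The constants can
differ only by `c`, which is excluded. -/
theorem galOf_redForm_injective {c : k} (hc : ∀ z, c ≠ z * z + z) {ε ε' : Bool} {p p' : ℕ → k}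
    {i : ℕ} (h : galOf (redForm K (if ε then c else 0) p i)
      = galOf (redForm K (if ε' then c else 0) p' i)) : ε = ε' ∧ ∀ l < i, p l = p' l := by
  obtain ⟨α, hα⟩ := galOf_spec (redForm K (if ε then c else 0) p i)
  obtain ⟨α', hα'⟩ := galOf_spec (redForm K (if ε' then c else 0) p' i)
  rw [h] at hα
  obtain ⟨x, hx⟩ := hα.exists_add hα'
  rw [redForm_add] at hx
  obtain ⟨⟨z, hz⟩, hp⟩ := redForm_eq_wp _ _ _ _ hx
  refine ⟨?_, fun l hl => ?_⟩
  · cases ε <;> cases ε'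
    · rfl
    · exact (hc z (by simpa using hz)).elim
    · exact (hc z (by simpa using hz)).elim
    · rfl
  · exact CharTwo.add_eq_zero.1 (hp l hl)

variable [Finite k]

theorem exists_isASGen_redForm {c : k} (hc : ∀ d : k, ∃ z, d = z * z + z ∨ d = z * z + z + c)
    (ρ : GalHom K (Multiplicative (ZMod 2))) :
    ∃ (ε : Bool) (i : ℕ) (p : ℕ → k) (α : SeparableClosure K), (i = 0 ∨ p (i - 1) ≠ 0) ∧
      IsASGen ρ (redForm K (if ε then c else 0) p i) α := by
  have h2 : (2 : K) = 0 := CharTwo.two_eq_zero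
  obtain ⟨a, α, h⟩ := exists_isASGen ρ
  obtain ⟨x, ε, i, p, hi, ha⟩ := exists_redForm (K := K) hc a
  refine ⟨ε, i, p, α + algebraMap K _ x, hi, ?_⟩
  have := h.add x
  rwa [show a + (x * x + x) = redForm K (if ε then c else 0) p i by
    rw [ha]; linear_combination (x * x + x) * h2] at this

theorem exists_hasConductor (ρ : GalHom K (Multiplicative (ZMod 2))) :
    ∃ i, HasConductor (PowerSeries.X : k⟦X⟧) ρ i := by
  obtain ⟨c, -, hc⟩ := exists_wp_complement k
  obtain ⟨ε, i, p, α, hi, h⟩ := exists_isASGen_redForm hc ρ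
  exact ⟨i, h.hasConductor_redForm hi⟩

/-- Every `ρ` has some integer `j`, and the powers of the maximal ideal are distinct, so the
discriminant recovers `j`. -/
theorem hasConductor_iff (ρ : GalHom K (Multiplicative (ZMod 2))) (i : ℕ) :
    HasConductor (PowerSeries.X : k⟦X⟧) ρ i ↔
      discrIdeal k⟦X⟧ ρ = IsLocalRing.maximalIdeal k⟦X⟧ ^ (2 * i) := by
  refine ⟨fun h => h.discrIdeal_eq_maximalIdeal_pow, fun h => ?_⟩
  obtain ⟨j, hj⟩ := exists_hasConductor (k := k) ρ
  have hinj : Function.Injective fun n : ℕ => IsLocalRing.maximalIdeal k⟦X⟧ ^ n :=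
    (Ideal.pow_right_strictAnti _ (IsDiscreteValuationRing.not_a_field _)
      (IsLocalRing.maximalIdeal.isMaximal _).ne_top).injective
  have := hinj (hj.discrIdeal_eq_maximalIdeal_pow.symm.trans h)
  rwa [show i = j by omega]

theorem ncard_hasConductor_zero :
    {ρ : GalHom K (Multiplicative (ZMod 2)) | HasConductor (PowerSeries.X : k⟦X⟧) ρ 0}.ncard = 2 := by
  obtain ⟨c, hc', hc⟩ := exists_wp_complement k
  let F : Bool → GalHom K (Multiplicative (ZMod 2)) := fun ε =>
    galOf (redForm K (if ε then c else 0) (0 : ℕ → k) 0)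
  have hF : {ρ : GalHom K (Multiplicative (ZMod 2)) | HasConductor (PowerSeries.X : k⟦X⟧) ρ 0}
      = F '' Set.univ := by
    rw [Set.image_univ]
    ext ρ
    constructor
    · intro h
      obtain ⟨ε, i, p, α, hi, hα⟩ := exists_isASGen_redForm hc ρ
      have h0 := (hα.hasConductor_redForm hi)
      obtain rfl : i = 0 := HasConductor.unique h0 h
      obtain ⟨β, hβ⟩ := galOf_spec (redForm K (if ε then c else 0) (0 : ℕ → k) 0)
      refine ⟨ε, hβ.eq_of_same (by rwa [redForm_zero, ← redForm_zero _ p])⟩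
    · rintro ⟨ε, rfl⟩
      obtain ⟨β, hβ⟩ := galOf_spec (redForm K (if ε then c else 0) (0 : ℕ → k) 0)
      exact hβ.hasConductor_redForm (Or.inl rfl)
  rw [hF, Set.ncard_image_of_injective _ fun ε ε' h => (galOf_redForm_injective hc' h).1,
    Set.ncard_univ, Nat.card_eq_fintype_card, Fintype.card_bool]

/-- A reduced form has two choices of constant, `j` free coefficients and a non-zero top
coefficient. -/
theorem ncard_hasConductor_succ (j : ℕ) :
    {ρ : GalHom K (Multiplicative (ZMod 2)) |
      HasConductor (PowerSeries.X : k⟦X⟧) ρ (j + 1)}.ncard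
        = 2 * (Nat.card k - 1) * Nat.card k ^ j := by
  obtain ⟨c, hc', hc⟩ := exists_wp_complement k
  -- Only the indices up to `j` enter the reduced form; the values beyond are arbitrary.
  let P : (Fin j → k) × kˣ → ℕ → k := fun x l => if h : l < j then x.1 ⟨l, h⟩ else x.2
  have hPj : ∀ x, P x j = x.2 := fun x => dif_neg (lt_irrefl j)
  let F : Bool × ((Fin j → k) × kˣ) → GalHom K (Multiplicative (ZMod 2)) := fun x =>
    galOf (redForm K (if x.1 then c else 0) (P x.2) (j + 1))
  have hFinj : Function.Injective F := by
    rintro ⟨ε, x⟩ ⟨ε', x'⟩ h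
    obtain ⟨rfl, hp⟩ := galOf_redForm_injective hc' h
    refine Prod.ext rfl (Prod.ext (funext fun l => ?_) (Units.ext ?_))
    · have := hp l (l.2.trans (Nat.lt_succ_self j))
      simpa [P] using this
    · have := hp j (Nat.lt_succ_self j)
      rwa [hPj, hPj] at this
  have hF : {ρ : GalHom K (Multiplicative (ZMod 2)) |
      HasConductor (PowerSeries.X : k⟦X⟧) ρ (j + 1)} = F '' Set.univ := by
    rw [Set.image_univ]
    ext ρ
    constructor
    · intro h
      obtain ⟨ε, i, p, α, hi, hα⟩ := exists_isASGen_redForm hc ρ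
      have h0 := (hα.hasConductor_redForm hi)
      obtain rfl : i = j + 1 := HasConductor.unique h0 h
      have hpj : p j ≠ 0 := by simpa using hi
      let x : (Fin j → k) × kˣ := (fun l => p l, Units.mk0 _ hpj)
      obtain ⟨β, hβ⟩ := galOf_spec (redForm K (if ε then c else 0) (P x) (j + 1))
      refine ⟨(ε, x), hβ.eq_of_same (α' := α) ?_⟩
      rwa [redForm_congr (p' := p)]
      intro l hl
      by_cases hlj : l < j
      · simp [P, x, hlj]
      · obtain rfl : l = j := by omega
        simp [P, x]
    · rintro ⟨⟨ε, x⟩, rfl⟩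
      obtain ⟨β, hβ⟩ := galOf_spec (redForm K (if ε then c else 0) (P x) (j + 1))
      exact hβ.hasConductor_redForm (Or.inr (by
        rw [Nat.add_sub_cancel, hPj]
        exact x.2.ne_zero))
  have : Fintype k := Fintype.ofFinite k
  rw [hF, Set.ncard_image_of_injective _ hFinj, Set.ncard_univ, Nat.card_prod, Nat.card_prod,
    Nat.card_fun, Nat.card_units, Nat.card_eq_fintype_card, Fintype.card_bool,
    Nat.card_eq_fintype_card (α := Fin j), Fintype.card_fin]
  ring

/-- The total mass of a function of the conductor. -/
theorem mass_eq_tsum {q : ℕ} (hq : q = Nat.card k)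
    (c : GalHom K (Multiplicative (ZMod 2)) → ℝ) (F : ℕ → ℝ)
    (hcF : ∀ ρ i, HasConductor (PowerSeries.X : k⟦X⟧) ρ i → c ρ = F i) :
    mass k⟦X⟧ c = ENNReal.ofReal ((q : ℝ) ^ (-F 0)) +
      ∑' j : ℕ, ENNReal.ofReal (((q : ℝ) - 1) * (q : ℝ) ^ j * (q : ℝ) ^ (-F (j + 1))) := by
  have hres : Nat.card (IsLocalRing.ResidueField k⟦X⟧) = q := by
    rw [hq]
    exact Nat.card_congr PowerSeries.residueFieldOfPowerSeries.toEquiv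
  have hq1 : 1 < q := hq ▸ Finite.one_lt_card
  choose I hI using exists_hasConductor (k := k) (K := K)
  have hfib : ∀ i, I ⁻¹' {i} = {ρ | HasConductor (PowerSeries.X : k⟦X⟧) ρ i} := by
    intro i
    ext ρ
    constructor
    · rintro rfl
      exact hI ρ
    · intro h
      exact HasConductor.unique (hI ρ) h
  -- A non-zero `ncard` ensures that the fibre is finite, so that `ncard` is its true cardinality.
  have hsum : ∀ i, {ρ : GalHom K (Multiplicative (ZMod 2)) |
      HasConductor (PowerSeries.X : k⟦X⟧) ρ i}.ncard ≠ 0 →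
      ∑' ρ : (I ⁻¹' {i} : Set (GalHom K (Multiplicative (ZMod 2)))),
        ENNReal.ofReal ((q : ℝ) ^ (-c ρ)) = ({ρ : GalHom K (Multiplicative (ZMod 2)) |
      HasConductor (PowerSeries.X : k⟦X⟧) ρ i}.ncard : ℝ≥0∞) * ENNReal.ofReal ((q : ℝ) ^ (-F i)) := by
    intro i hi
    have hfin := Set.finite_of_ncard_ne_zero hi
    rw [hfib]
    have : ∀ ρ : {ρ : GalHom K (Multiplicative (ZMod 2)) |
        HasConductor (PowerSeries.X : k⟦X⟧) ρ i}, ENNReal.ofReal ((q : ℝ) ^ (-c ρ))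
        = ENNReal.ofReal ((q : ℝ) ^ (-F i)) := fun ρ => by rw [hcF ρ i ρ.2]
    rw [tsum_congr this, ENNReal.tsum_set_const, ← hfin.cast_ncard_eq]
    rfl
  -- The sum is grouped by conductor. The factor two in each count cancels `1 / ♯Γ`.
  rw [mass, hres, natCard_multiplicative_zmod_two, ← ENNReal.tsum_fiberwise _ I,
    tsum_eq_zero_add' ENNReal.summable, mul_add,
    ← ENNReal.tsum_mul_left (f := fun j => ∑' ρ : (I ⁻¹' {j + 1} : Set _), _), hsum 0 (by rw [ncard_hasConductor_zero]; norm_num), ncard_hasConductor_zero, ← mul_assoc]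
  congr 1
  · rw [Nat.cast_ofNat, ENNReal.inv_mul_cancel (by norm_num) (by norm_num), one_mul]
  · refine tsum_congr fun j => ?_
    have hpos : 0 < 2 * (q - 1) * q ^ j := by
      have : 0 < q - 1 := by omega
      positivity
    rw [hsum (j + 1) (by rw [ncard_hasConductor_succ, ← hq]; exact hpos.ne'),
      ncard_hasConductor_succ, ← hq, ← mul_assoc, mul_assoc 2, Nat.cast_mul, ← mul_assoc,
      Nat.cast_ofNat, ENNReal.inv_mul_cancel (by norm_num) (by norm_num), one_mul,
      ENNReal.ofReal_mul (by
        have : (1 : ℝ) ≤ q := by exact_mod_cast hq1.le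
        have := sub_nonneg.2 this
        positivity)]
    congr 1
    rw [← ENNReal.ofReal_natCast]
    congr 1
    push_cast [hq1.le]
    ring

end Counting

/-! ### The values of `v` and `w` -/

section Values

theorem card_pos_eq_sum {ι : Type*} [Fintype ι] (e : ι → ℕ) :
    Fintype.card {i // 0 < e i} = ∑ i, if 0 < e i then 1 else 0 := by
  rw [Fintype.card_subtype, Finset.card_filter]

variable {k K : Type*} [Field k] [Field K] [Algebra k⟦X⟧ K]

variable {ι : Type*} [Fintype ι] [DecidableEq ι]

theorem IsTuned.basis_and_length {ρ : GalHom K (Multiplicative (ZMod 2))} {i : ℕ}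
    (h : HasConductor (PowerSeries.X : k⟦X⟧) ρ i) {τ : Multiplicative (ZMod 2) →* GL ι k⟦X⟧}
    {e : ι → ℕ} (ht : IsTuned PowerSeries.X τ ρ e) :
    Nonempty (Module.Basis ι k⟦X⟧ (tuning τ ρ)) ∧ tuningLength τ ρ ≠ ⊤ := by
  obtain ⟨B, -⟩ := h
  refine ⟨⟨(ht.exists_basis PowerSeries.X_ne_zero B).choose⟩, ?_⟩
  rw [ht.tuningLength_eq PowerSeries.X_irreducible B]
  exact ENat.natCast_ne_top _

theorem IsTuned.vFun_eq_sum {ρ : GalHom K (Multiplicative (ZMod 2))} {i : ℕ}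
    (h : HasConductor (PowerSeries.X : k⟦X⟧) ρ i) {τ : Multiplicative (ZMod 2) →* GL ι k⟦X⟧}
    {e : ι → ℕ} (ht : IsTuned PowerSeries.X τ ρ e) : vFun τ ρ = ((∑ i, e i : ℕ) : ℝ) := by
  obtain ⟨B, -⟩ := h
  exact ht.vFun_eq PowerSeries.X_irreducible natCard_multiplicative_zmod_two B

theorem IsTuned.wFun_eq_sum {ρ : GalHom K (Multiplicative (ZMod 2))} {i : ℕ}
    (h : HasConductor (PowerSeries.X : k⟦X⟧) ρ i) {τ : Multiplicative (ZMod 2) →* GL ι k⟦X⟧}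
    {e : ι → ℕ} (ht : IsTuned PowerSeries.X τ ρ e) :
    wFun τ ρ = ((∑ i, if 0 < e i then 1 else 0 : ℕ) : ℝ) - ((∑ i, e i : ℕ) : ℝ) := by
  obtain ⟨B, -⟩ := h
  rw [ht.wFun_eq PowerSeries.X_irreducible natCard_multiplicative_zmod_two B, card_pos_eq_sum]

variable [CharP k 2]

theorem isTuned_sigmaRep {ρ : GalHom K (Multiplicative (ZMod 2))} {i : ℕ}
    (h : HasConductor (PowerSeries.X : k⟦X⟧) ρ i) (n : ℕ) :
    IsTuned PowerSeries.X (sigmaRep k⟦X⟧ n) ρ (fun p => ![0, i] p.1) :=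
  (isTuned_transposition h powerSeries_two_eq_zero).copies n

theorem isTuned_tauRep {ρ : GalHom K (Multiplicative (ZMod 2))} {i : ℕ}
    (h : HasConductor (PowerSeries.X : k⟦X⟧) ρ i) (m : ℕ) :
    IsTuned PowerSeries.X (tauRep k m) ρ ![0, i - m] :=
  isTuned_involutionRep_upper PowerSeries.X_ne_zero h m _

theorem isTuned_upsilonRep {ρ : GalHom K (Multiplicative (ZMod 2))} {i : ℕ}
    (h : HasConductor (PowerSeries.X : k⟦X⟧) ρ i) (m n : ℕ) :
    IsTuned PowerSeries.X (upsilonRep k m n) ρ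
      (Sum.elim ![0, i - m] fun p : Fin 2 × Fin n => ![0, i] p.1) :=
  (isTuned_tauRep h m).sum (isTuned_sigmaRep h n)

variable {ρ : GalHom K (Multiplicative (ZMod 2))} {i : ℕ}

theorem vFun_sigmaRep (h : HasConductor (PowerSeries.X : k⟦X⟧) ρ i) (n : ℕ) :
    vFun (sigmaRep k⟦X⟧ n) ρ = (n : ℝ) * i := by
  rw [(isTuned_sigmaRep h n).vFun_eq_sum h, Fintype.sum_prod_type]
  simp

theorem wFun_sigmaRep (h : HasConductor (PowerSeries.X : k⟦X⟧) ρ i) (n : ℕ) :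
    wFun (sigmaRep k⟦X⟧ n) ρ = if i = 0 then 0 else (n : ℝ) - n * i := by
  rw [(isTuned_sigmaRep h n).wFun_eq_sum h, Fintype.sum_prod_type, Fintype.sum_prod_type]
  rcases Nat.eq_zero_or_pos i with rfl | hi
  · simp
  · simp [hi, hi.ne']

theorem vFun_tauRep (h : HasConductor (PowerSeries.X : k⟦X⟧) ρ i) (m : ℕ) :
    vFun (tauRep k m) ρ = if i ≤ m then 0 else (i : ℝ) - m := by
  rw [(isTuned_tauRep h m).vFun_eq_sum h]
  split_ifs with him
  · simp [him]
  · simp [Nat.cast_sub (not_le.1 him).le]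

theorem wFun_tauRep (h : HasConductor (PowerSeries.X : k⟦X⟧) ρ i) (m : ℕ) :
    wFun (tauRep k m) ρ = if i ≤ m then 0 else 1 - (i : ℝ) + m := by
  rw [(isTuned_tauRep h m).wFun_eq_sum h]
  by_cases him : i ≤ m
  · rw [if_pos him]
    simp [him]
  · rw [if_neg him, Fin.sum_univ_two, Fin.sum_univ_two]
    simp [Nat.cast_sub (not_le.1 him).le, not_le.1 him]
    ring

theorem vFun_upsilonRep (h : HasConductor (PowerSeries.X : k⟦X⟧) ρ i) (m n : ℕ) :
    vFun (upsilonRep k m n) ρ = vFun (tauRep k m) ρ + vFun (sigmaRep k⟦X⟧ n) ρ := by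
  rw [(isTuned_upsilonRep h m n).vFun_eq_sum h, (isTuned_tauRep h m).vFun_eq_sum h,
    (isTuned_sigmaRep h n).vFun_eq_sum h, Fintype.sum_sum_type]
  push_cast
  rfl

/-- Both the sum of the exponents and the number of positive ones are additive under concatenation.
-/
theorem wFun_upsilonRep (h : HasConductor (PowerSeries.X : k⟦X⟧) ρ i) (m n : ℕ) :
    wFun (upsilonRep k m n) ρ = wFun (tauRep k m) ρ + wFun (sigmaRep k⟦X⟧ n) ρ := by
  rw [(isTuned_upsilonRep h m n).wFun_eq_sum h, (isTuned_tauRep h m).wFun_eq_sum h,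
    (isTuned_sigmaRep h n).wFun_eq_sum h]
  have h1 : ∀ (e₁ : Fin 2 → ℕ) (e₂ : Fin 2 × Fin n → ℕ),
      (∑ i, if 0 < Sum.elim e₁ e₂ i then 1 else 0 : ℕ)
        = (∑ i, if 0 < e₁ i then 1 else 0) + ∑ i, if 0 < e₂ i then 1 else 0 := fun _ _ =>
    Fintype.sum_sum_type _
  have h2 : ∀ (e₁ : Fin 2 → ℕ) (e₂ : Fin 2 × Fin n → ℕ),
      (∑ i, Sum.elim e₁ e₂ i : ℕ) = ∑ i, e₁ i + ∑ i, e₂ i := fun _ _ => Fintype.sum_sum_type _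
  rw [h1, h2, Nat.cast_add, Nat.cast_add]
  ring

end Values

/-! ### Masses as geometric series -/

section Series

theorem tsum_Ioi_eq (f : ℕ → ℝ≥0∞) (m : ℕ) :
    ∑' i : Set.Ioi m, f i = ∑' j : ℕ, f (j + m + 1) := by
  let e : ℕ ≃ Set.Ioi m :=
    { toFun := fun j => ⟨j + m + 1, Set.mem_Ioi.2 (by omega)⟩
      invFun := fun i => i.1 - m - 1
      left_inv := fun j => by simp only; omega
      right_inv := fun ⟨i, hi⟩ => Subtype.ext (by
        have : m < i := hi
        simp only
        omega) }
  exact (e.tsum_eq fun i : Set.Ioi m => f i).symm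

theorem tsum_Ioi_zero_eq (f : ℕ → ℝ≥0∞) (m : ℕ) :
    ∑' i : Set.Ioi 0, f i = ∑ i ∈ Finset.Icc 1 m, f i + ∑' i : Set.Ioi m, f i := by
  rw [tsum_Ioi_eq, tsum_Ioi_eq, ← ENNReal.summable.sum_add_tsum_nat_add' (k := m),
    Finset.range_eq_Ico, Finset.sum_Ico_add' (fun i => f i) 0 m 1]
  rfl

theorem tsum_geometric_ofReal {a r : ℝ} (ha : 0 ≤ a) (hr : 0 ≤ r) (hr1 : r < 1) :
    ∑' j : ℕ, ENNReal.ofReal (a * r ^ j) = ENNReal.ofReal (a / (1 - r)) := by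
  rw [← ENNReal.ofReal_tsum_of_nonneg (fun j => by positivity)
    ((summable_geometric_of_lt_one hr hr1).mul_left a), tsum_mul_left,
    tsum_geometric_of_lt_one hr hr1, div_eq_mul_inv]

variable {k K : Type*} [Field k] [Finite k] [CharP k 2] [Field K] [Algebra k⟦X⟧ K]
  [IsFractionRing k⟦X⟧ K] [CharP K 2]

/-- The total mass of an integral function `F` of the conductor. -/
theorem mass_eq_tsum_Ioi {q : ℕ} (hq : q = Nat.card k)
    (c : GalHom K (Multiplicative (ZMod 2)) → ℝ) (F : ℕ → ℤ) (hF0 : F 0 = 0)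
    (hcF : ∀ ρ i, HasConductor (PowerSeries.X : k⟦X⟧) ρ i → c ρ = F i) :
    mass k⟦X⟧ c = 1 + ∑' i : Set.Ioi 0, ENNReal.ofReal
      (((q : ℝ) - 1) * (q : ℝ) ^ ((i : ℤ) - 1) * (q : ℝ) ^ (-F i)) := by
  rw [mass_eq_tsum hq c (fun i => F i) hcF, hF0,
    tsum_Ioi_eq (fun i => ENNReal.ofReal
      (((q : ℝ) - 1) * (q : ℝ) ^ ((i : ℤ) - 1) * (q : ℝ) ^ (-F i)))]
  congr 1
  · simp
  · refine tsum_congr fun j => ?_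
    rw [← Int.cast_neg, Real.rpow_intCast, add_zero, Nat.cast_succ, add_sub_cancel_right,
      zpow_natCast]

variable {q : ℕ} (hq : q = Nat.card k)
include hq

theorem mass_vFun_sigmaRep (n : ℕ) : mass k⟦X⟧ (K := K) (vFun (sigmaRep k⟦X⟧ n))
    = 1 + ∑' i : Set.Ioi (0 : ℕ), ENNReal.ofReal
      (((q : ℝ) - 1) * (q : ℝ) ^ ((i : ℤ) - 1) * (q : ℝ) ^ (-((i : ℤ) * n))) :=
  mass_eq_tsum_Ioi hq _ (fun i => (i : ℤ) * n) (by simp) fun ρ i h => by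
    rw [vFun_sigmaRep h]
    push_cast
    ring

theorem mass_wFun_sigmaRep (n : ℕ) :
    mass k⟦X⟧ (K := K) (fun ρ => -wFun (sigmaRep k⟦X⟧ n) ρ)
    = 1 + ∑' i : Set.Ioi (0 : ℕ), ENNReal.ofReal
      (((q : ℝ) - 1) * (q : ℝ) ^ ((i : ℤ) - 1) * (q : ℝ) ^ (-((i : ℤ) * n) + n)) := by
  -- The value at `i = 0` is separate: all exponents vanish there, so the fibre has dimension `0`
  -- and not `n`.
  rw [mass_eq_tsum_Ioi hq _ (fun i => if i = 0 then 0 else (i : ℤ) * n - n) (by simp)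
    fun ρ i h => by
      rw [wFun_sigmaRep h]
      split_ifs
      · simp
      · push_cast
        ring]
  congr 1
  refine tsum_congr fun i => ?_
  rw [if_neg (Set.mem_Ioi.1 i.2).ne']
  congr 3
  ring

theorem mass_vFun_upsilonRep (m n : ℕ) : mass k⟦X⟧ (K := K) (vFun (upsilonRep k m n))
    = 1 + (∑ i ∈ Finset.Icc 1 m, ENNReal.ofReal
        (((q : ℝ) - 1) * (q : ℝ) ^ ((i : ℤ) - 1) * (q : ℝ) ^ (-((i : ℤ) * n))))
      + ∑' i : Set.Ioi m, ENNReal.ofReal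
        (((q : ℝ) - 1) * (q : ℝ) ^ ((i : ℤ) - 1) * (q : ℝ) ^ (-(i : ℤ) + m - (i : ℤ) * n)) := by
  rw [mass_eq_tsum_Ioi hq _ (fun i => if i ≤ m then (i : ℤ) * n else i - m + i * n) (by simp)
    fun ρ i h => by
      rw [vFun_upsilonRep h, vFun_tauRep h, vFun_sigmaRep h]
      split_ifs
      · push_cast
        ring
      · push_cast
        ring,
    tsum_Ioi_zero_eq (fun i => ENNReal.ofReal (((q : ℝ) - 1) * (q : ℝ) ^ ((i : ℤ) - 1) *
      (q : ℝ) ^ (-(if i ≤ m then (i : ℤ) * n else i - m + i * n)))) m, add_assoc]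
  congr 2
  · refine Finset.sum_congr rfl fun i hi => ?_
    rw [if_pos (Finset.mem_Icc.1 hi).2]
  · refine tsum_congr fun i => ?_
    rw [if_neg (not_le.2 (Set.mem_Ioi.1 i.2))]
    congr 3
    ring

theorem mass_wFun_upsilonRep (m n : ℕ) :
    mass k⟦X⟧ (K := K) (fun ρ => -wFun (upsilonRep k m n) ρ)
    = 1 + (∑ i ∈ Finset.Icc 1 m, ENNReal.ofReal
        (((q : ℝ) - 1) * (q : ℝ) ^ ((i : ℤ) - 1) * (q : ℝ) ^ (-((i : ℤ) * n) + n)))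
      + ∑' i : Set.Ioi m, ENNReal.ofReal
        (((q : ℝ) - 1) * (q : ℝ) ^ ((i : ℤ) - 1)
          * (q : ℝ) ^ (1 - (i : ℤ) + m - (i : ℤ) * n + n)) := by
  rw [mass_eq_tsum_Ioi hq _ (fun i => if i = 0 then 0 else
      if i ≤ m then (i : ℤ) * n - n else i - 1 - m + i * n - n) (by simp)
    fun ρ i h => by
      rw [wFun_upsilonRep h, wFun_tauRep h, wFun_sigmaRep h]
      rcases Nat.eq_zero_or_pos i with rfl | hi
      · simp
      · rw [if_neg hi.ne', if_neg hi.ne']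
        split_ifs
        · push_cast
          ring
        · push_cast
          ring,
    tsum_Ioi_zero_eq (fun i => ENNReal.ofReal (((q : ℝ) - 1) * (q : ℝ) ^ ((i : ℤ) - 1) *
      (q : ℝ) ^ (-(if i = 0 then 0 else
        if i ≤ m then (i : ℤ) * n - n else i - 1 - m + i * n - n)))) m, add_assoc]
  congr 2
  · refine Finset.sum_congr rfl fun i hi => ?_
    rw [if_neg (Nat.one_le_iff_ne_zero.1 (Finset.mem_Icc.1 hi).1),
      if_pos (Finset.mem_Icc.1 hi).2]
    congr 3
    ring
  · refine tsum_congr fun i => ?_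
    have hi : m < i := Set.mem_Ioi.1 i.2
    rw [if_neg (by omega), if_neg (not_le.2 hi)]
    congr 3
    ring

/-- The number of `ρ` grows like `q ^ i`, exactly as fast as the weight decays, so the terms are a
positive constant. The same happens in `mass_wFun_sigmaRep_one`. -/
theorem mass_vFun_sigmaRep_one : mass k⟦X⟧ (K := K) (vFun (sigmaRep k⟦X⟧ 1)) = ⊤ := by
  have hq1 : 1 < q := hq ▸ Finite.one_lt_card
  have hq0 : (q : ℝ) ≠ 0 := by positivity
  rw [mass_vFun_sigmaRep hq, tsum_Ioi_eq (fun i => ENNReal.ofReal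
    (((q : ℝ) - 1) * (q : ℝ) ^ ((i : ℤ) - 1) * (q : ℝ) ^ (-((i : ℤ) * (1 : ℕ))))) 0]
  have : ∀ j : ℕ, ENNReal.ofReal (((q : ℝ) - 1) * (q : ℝ) ^ (((j + 0 + 1 : ℕ) : ℤ) - 1)
      * (q : ℝ) ^ (-(((j + 0 + 1 : ℕ) : ℤ) * (1 : ℕ)))) = ENNReal.ofReal (((q : ℝ) - 1) * (q : ℝ)⁻¹) := by
    intro j
    rw [mul_assoc, ← zpow_add₀ hq0, ← zpow_neg_one]
    congr 3
    push_cast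
    ring
  rw [tsum_congr this, ENNReal.tsum_const_eq_top_of_ne_zero, add_top]
  rw [ne_eq, ENNReal.ofReal_eq_zero, not_le]
  have : (1 : ℝ) < q := by exact_mod_cast hq1
  have := sub_pos.2 this
  positivity

theorem mass_wFun_sigmaRep_one :
    mass k⟦X⟧ (K := K) (fun ρ => -wFun (sigmaRep k⟦X⟧ 1) ρ) = ⊤ := by
  have hq1 : 1 < q := hq ▸ Finite.one_lt_card
  have hq0 : (q : ℝ) ≠ 0 := by positivity
  rw [mass_wFun_sigmaRep hq, tsum_Ioi_eq (fun i => ENNReal.ofReal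
    (((q : ℝ) - 1) * (q : ℝ) ^ ((i : ℤ) - 1) * (q : ℝ) ^ (-((i : ℤ) * (1 : ℕ)) + (1 : ℕ)))) 0]
  have : ∀ j : ℕ, ENNReal.ofReal (((q : ℝ) - 1) * (q : ℝ) ^ (((j + 0 + 1 : ℕ) : ℤ) - 1)
      * (q : ℝ) ^ (-(((j + 0 + 1 : ℕ) : ℤ) * (1 : ℕ)) + (1 : ℕ))) = ENNReal.ofReal ((q : ℝ) - 1) := by
    intro j
    rw [mul_assoc, ← zpow_add₀ hq0]
    congr 1
    convert mul_one _
    rw [← zpow_zero (q : ℝ)]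
    congr 1
    push_cast
    ring
  rw [tsum_congr this, ENNReal.tsum_const_eq_top_of_ne_zero, add_top]
  rw [ne_eq, ENNReal.ofReal_eq_zero, not_le]
  have : (1 : ℝ) < q := by exact_mod_cast hq1
  exact sub_pos.2 this

omit hq

/-- Here `s` is the total exponent at `j = 0` and `Q ^ d` the common ratio. -/
theorem mass_term_eq {Q : ℝ} (hQ : 1 < Q) (a b s d : ℤ) (j : ℕ) (h : a + b = s + d * j) :
    (Q - 1) * Q ^ a * Q ^ b = (Q - 1) * Q ^ s * (Q ^ d) ^ j := by
  have hQ0 : Q ≠ 0 := (zero_lt_one.trans hQ).ne'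
  rw [mul_assoc, mul_assoc, ← zpow_add₀ hQ0, h, zpow_add₀ hQ0, zpow_mul, zpow_natCast]

/-- Summation of a geometric tail of a mass. -/
theorem tsum_Ioi_geometric {Q : ℝ} (hQ : 1 < Q) (m : ℕ) (E : ℤ → ℤ) (s d : ℤ) (hd : d < 0)
    (hE : ∀ j : ℕ, ((j + m + 1 : ℕ) : ℤ) - 1 + E (j + m + 1 : ℕ) = s + d * j) :
    ∑' i : Set.Ioi m, ENNReal.ofReal ((Q - 1) * Q ^ ((i : ℤ) - 1) * Q ^ (E i))
      = ENNReal.ofReal ((Q - 1) * (Q ^ s / (1 - Q ^ d))) := by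
  have hQ0 : 0 < Q := zero_lt_one.trans hQ
  rw [tsum_Ioi_eq (fun i => ENNReal.ofReal ((Q - 1) * Q ^ ((i : ℤ) - 1) * Q ^ (E i))),
    tsum_congr fun j => congrArg ENNReal.ofReal (mass_term_eq hQ _ _ s d j (hE j)),
    tsum_geometric_ofReal (mul_nonneg (sub_pos.2 hQ).le (by positivity)) (by positivity)
      (zpow_lt_one_of_neg₀ hQ hd), mul_div_assoc]

/-- Summation of a finite geometric part of a mass. -/
theorem sum_Icc_geometric {Q : ℝ} (hQ : 1 < Q) (m : ℕ) (E : ℤ → ℤ) (s d : ℤ)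
    (hE : ∀ j : ℕ, ((1 + j : ℕ) : ℤ) - 1 + E (1 + j : ℕ) = s + d * j) :
    ∑ i ∈ Finset.Icc 1 m, ENNReal.ofReal ((Q - 1) * Q ^ ((i : ℤ) - 1) * Q ^ (E i))
      = ENNReal.ofReal ((Q - 1) * Q ^ s * ∑ j ∈ Finset.range m, (Q ^ d) ^ j) := by
  have hQ0 : 0 < Q := zero_lt_one.trans hQ
  have h0 : 0 ≤ Q - 1 := (sub_pos.2 hQ).le
  rw [← ENNReal.ofReal_sum_of_nonneg fun i _ => by positivity]
  congr 1
  rw [Finset.mul_sum, ← Finset.Ico_add_one_right_eq_Icc, Finset.sum_Ico_eq_sum_range,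
    Nat.add_sub_cancel]
  exact Finset.sum_congr rfl fun j _ => mass_term_eq hQ _ _ s d j (hE j)

theorem geom_sum_zpow {Q : ℝ} (hQ : 1 < Q) (m : ℕ) {d : ℤ} (hd : d < 0) :
    ∑ j ∈ Finset.range m, (Q ^ d) ^ j = (1 - Q ^ (d * m)) / (1 - Q ^ d) := by
  have h1 : Q ^ d < 1 := zpow_lt_one_of_neg₀ hQ hd
  rw [geom_sum_eq h1.ne, zpow_mul, zpow_natCast, ← neg_sub, ← neg_sub 1 (Q ^ d), neg_div_neg_eq]

include hq

theorem mass_vFun_sigmaRep_closed {n : ℕ} (hn : 2 ≤ n) :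
    mass k⟦X⟧ (K := K) (vFun (sigmaRep k⟦X⟧ n))
    = ENNReal.ofReal (1 + ((q : ℝ) - 1) * (q : ℝ) ^ (-(n : ℤ))
            / (1 - (q : ℝ) ^ (1 - (n : ℤ)))) := by
  have hQ : (1 : ℝ) < q := by exact_mod_cast (hq ▸ Finite.one_lt_card : 1 < q)
  have hd : (1 - (n : ℤ)) < 0 := by omega
  have h1 := sub_pos.2 (zpow_lt_one_of_neg₀ hQ hd)
  have h0 := sub_pos.2 hQ
  rw [mass_vFun_sigmaRep hq, tsum_Ioi_geometric hQ 0 (fun i => -(i * n)) (-n) _ hd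
    (fun j => by push_cast; ring), ← ENNReal.ofReal_one, ← ENNReal.ofReal_add zero_le_one
    (by positivity), mul_div_assoc]

theorem mass_wFun_sigmaRep_closed {n : ℕ} (hn : 2 ≤ n) :
    mass k⟦X⟧ (K := K) (fun ρ => -wFun (sigmaRep k⟦X⟧ n) ρ)
    = ENNReal.ofReal (1 + ((q : ℝ) - 1) / (1 - (q : ℝ) ^ (1 - (n : ℤ)))) := by
  have hQ : (1 : ℝ) < q := by exact_mod_cast (hq ▸ Finite.one_lt_card : 1 < q)
  have hd : (1 - (n : ℤ)) < 0 := by omega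
  have h1 := sub_pos.2 (zpow_lt_one_of_neg₀ hQ hd)
  have h0 := sub_pos.2 hQ
  rw [mass_wFun_sigmaRep hq, tsum_Ioi_geometric hQ 0 (fun i => -(i * n) + n) 0 _ hd
    (fun j => by push_cast; ring), ← ENNReal.ofReal_one, ← ENNReal.ofReal_add zero_le_one
    (by positivity), zpow_zero, mul_one_div]

/-- The finite part has ratio `q ^ (1 - n)`, equal to `1` for `n = 1`, so its sum is left
unevaluated to cover all `n ≥ 1`. The tail has ratio `q ^ (-n)`, because `τ_m` contributes one more
factor `q⁻¹` per step. -/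
theorem mass_vFun_upsilonRep_geom (m : ℕ) {n : ℕ} (hn : 1 ≤ n) :
    mass k⟦X⟧ (K := K) (vFun (upsilonRep k m n))
    = ENNReal.ofReal (1 + ((q : ℝ) - 1) * (q : ℝ) ^ (-(n : ℤ)) *
          ∑ j ∈ Finset.range m, ((q : ℝ) ^ (1 - (n : ℤ))) ^ j
        + ((q : ℝ) - 1)
          * ((q : ℝ) ^ ((m : ℤ) - (m + 1) * n - 1) / (1 - (q : ℝ) ^ (-(n : ℤ))))) := by
  have hQ : (1 : ℝ) < q := by exact_mod_cast (hq ▸ Finite.one_lt_card : 1 < q)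
  have hd : (-(n : ℤ)) < 0 := by omega
  have h1 := sub_pos.2 (zpow_lt_one_of_neg₀ hQ hd)
  have h0 := sub_pos.2 hQ
  rw [mass_vFun_upsilonRep hq, tsum_Ioi_geometric hQ m (fun i => -i + m - i * n)
    ((m : ℤ) - (m + 1) * n - 1) _ hd (fun j => by push_cast; ring),
    sum_Icc_geometric hQ m (fun i => -(i * n)) (-n) (1 - n) (fun j => by push_cast; ring),
    ← ENNReal.ofReal_one, ← ENNReal.ofReal_add zero_le_one (by positivity),
    ← ENNReal.ofReal_add (by positivity) (by positivity)]

theorem mass_wFun_upsilonRep_geom (m : ℕ) {n : ℕ} (hn : 1 ≤ n) :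
    mass k⟦X⟧ (K := K) (fun ρ => -wFun (upsilonRep k m n) ρ)
    = ENNReal.ofReal (1 + ((q : ℝ) - 1) *
          ∑ j ∈ Finset.range m, ((q : ℝ) ^ (1 - (n : ℤ))) ^ j
        + ((q : ℝ) - 1) * ((q : ℝ) ^ ((m : ℤ) - m * n) / (1 - (q : ℝ) ^ (-(n : ℤ))))) := by
  have hQ : (1 : ℝ) < q := by exact_mod_cast (hq ▸ Finite.one_lt_card : 1 < q)
  have hd : (-(n : ℤ)) < 0 := by omega
  have h1 := sub_pos.2 (zpow_lt_one_of_neg₀ hQ hd)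
  have h0 := sub_pos.2 hQ
  rw [mass_wFun_upsilonRep hq, tsum_Ioi_geometric hQ m (fun i => 1 - i + m - i * n + n)
    ((m : ℤ) - m * n) _ hd (fun j => by push_cast; ring),
    sum_Icc_geometric hQ m (fun i => -(i * n) + n) 0 (1 - n) (fun j => by push_cast; ring),
    zpow_zero, mul_one,
    ← ENNReal.ofReal_one, ← ENNReal.ofReal_add zero_le_one (by positivity),
    ← ENNReal.ofReal_add (by positivity) (by positivity)]

theorem mass_vFun_upsilonRep_one (m : ℕ) : mass k⟦X⟧ (K := K) (vFun (upsilonRep k m 1))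
    = ENNReal.ofReal (1 + m * ((q : ℝ) - 1) / q + 1 / q) := by
  have hQ : (1 : ℝ) < q := by exact_mod_cast (hq ▸ Finite.one_lt_card : 1 < q)
  have hq0 : (q : ℝ) ≠ 0 := by positivity
  have hq1 : (q : ℝ) - 1 ≠ 0 := (sub_pos.2 hQ).ne'
  rw [mass_vFun_upsilonRep_geom hq m le_rfl]
  congr 1
  have e1 : (m : ℤ) - (m + 1) * (1 : ℕ) - 1 = -2 := by push_cast; ring
  rw [e1, Nat.cast_one, sub_self, zpow_zero, zpow_neg_one, zpow_neg, zpow_ofNat]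
  simp only [one_pow, Finset.sum_const, Finset.card_range, nsmul_eq_mul, mul_one]
  field_simp

theorem mass_wFun_upsilonRep_one (m : ℕ) :
    mass k⟦X⟧ (K := K) (fun ρ => -wFun (upsilonRep k m 1) ρ)
    = ENNReal.ofReal (1 + m * ((q : ℝ) - 1) + q) := by
  have hQ : (1 : ℝ) < q := by exact_mod_cast (hq ▸ Finite.one_lt_card : 1 < q)
  have hq0 : (q : ℝ) ≠ 0 := by positivity
  have hq1 : (q : ℝ) - 1 ≠ 0 := (sub_pos.2 hQ).ne'
  rw [mass_wFun_upsilonRep_geom hq m le_rfl]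
  congr 1
  have e1 : (m : ℤ) - m * (1 : ℕ) = 0 := by push_cast; ring
  rw [e1, Nat.cast_one, sub_self, zpow_zero, zpow_neg_one]
  simp only [one_pow, Finset.sum_const, Finset.card_range, nsmul_eq_mul, mul_one]
  field_simp

end Series

/-! ### Masses over the unramified extensions -/

section ScalarExtension

theorem charP_laurentSeries (k : Type*) [Field k] [CharP k 2] : CharP k⸨X⸩ 2 :=
  charP_of_injective_ringHom (f := (HahnSeries.C : k →+* k⸨X⸩)) HahnSeries.C_injective 2

variable {k : Type*} [Field k] [Finite k] [CharP k 2]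

instance (r : ℕ+) : CharP (resExt k r) 2 :=
  charP_of_injective_algebraMap (algebraMap k (resExt k r)).injective 2

/-- The matrix entries are `0` and `1`, so they survive extension of scalars. Hence the formulas
over `k` apply to `k_r` with `q ^ r` in place of `q`; for `τ_m` the further entry `t ^ m` is
preserved as well. -/
theorem baseChange_sigmaRep (n : ℕ) (r : ℕ+) :
    baseChange (sigmaRep k⟦X⟧ n) r = sigmaRep (resExt k r)⟦X⟧ n := by
  refine MonoidHom.ext fun γ => Units.ext (Matrix.ext fun a b => ?_)
  change PowerSeries.map _ (Matrix.blockDiagonal (fun _ : Fin n =>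
      if γ = 1 then (1 : Matrix (Fin 2) (Fin 2) k⟦X⟧) else !![0, 1; 1, 0]) a b)
    = Matrix.blockDiagonal (fun _ : Fin n =>
      if γ = 1 then (1 : Matrix (Fin 2) (Fin 2) (resExt k r)⟦X⟧) else !![0, 1; 1, 0]) a b
  obtain ⟨a, i⟩ := a
  obtain ⟨b, j⟩ := b
  rw [Matrix.blockDiagonal_apply, Matrix.blockDiagonal_apply]
  split_ifs
  · rw [Matrix.one_apply, Matrix.one_apply]
    split_ifs <;> simp
  · fin_cases a <;> fin_cases b <;> simp
  · simp

theorem baseChange_tauRep (m : ℕ) (r : ℕ+) :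
    baseChange (tauRep k m) r = tauRep (resExt k r) m := by
  refine MonoidHom.ext fun γ => Units.ext (Matrix.ext fun a b => ?_)
  change PowerSeries.map _
      ((if γ = 1 then (1 : Matrix (Fin 2) (Fin 2) k⟦X⟧) else !![1, PowerSeries.X ^ m; 0, 1]) a b)
    = (if γ = 1 then (1 : Matrix (Fin 2) (Fin 2) (resExt k r)⟦X⟧) else
      !![1, PowerSeries.X ^ m; 0, 1]) a b
  split_ifs
  · rw [Matrix.one_apply, Matrix.one_apply]
    split_ifs <;> simp
  · fin_cases a <;> fin_cases b <;> simp

theorem baseChange_upsilonRep (m n : ℕ) (r : ℕ+) :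
    baseChange (upsilonRep k m n) r = upsilonRep (resExt k r) m n := by
  refine MonoidHom.ext fun γ => Units.ext (Matrix.ext fun a b => ?_)
  have hσ := congrArg (fun τ => (τ γ).val)
    (baseChange_sigmaRep (k := k) n r)
  have hτ := congrArg (fun τ => (τ γ).val)
    (baseChange_tauRep (k := k) m r)
  rcases a with a | a <;> rcases b with b | b
  · exact congrFun (congrFun hτ a) b
  · exact map_zero (PowerSeries.map (algebraMap k (resExt k r)))
  · exact map_zero (PowerSeries.map (algebraMap k (resExt k r)))
  · exact congrFun (congrFun hσ a) b

variable {q : ℕ} (hq : q = Nat.card k)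
include hq

theorem natCard_resExt (r : ℕ+) : q ^ (r : ℕ) = Nat.card (resExt k r) := by
  rw [hq]
  exact (FiniteField.natCard_extension k 2 r).symm

theorem massV_sigmaRep {n : ℕ} (hn : 2 ≤ n) (r : ℕ+) : massV (sigmaRep k⟦X⟧ n) r
    = ENNReal.ofReal (1 + ((q : ℝ) ^ (r : ℕ) - 1) * ((q : ℝ) ^ (r : ℕ)) ^ (-(n : ℤ))
            / (1 - ((q : ℝ) ^ (r : ℕ)) ^ (1 - (n : ℤ)))) := by
  have := charP_laurentSeries (resExt k r)
  unfold massV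
  rw [baseChange_sigmaRep, mass_vFun_sigmaRep_closed (natCard_resExt hq r) hn, Nat.cast_pow]

theorem massW_sigmaRep {n : ℕ} (hn : 2 ≤ n) (r : ℕ+) : massW (sigmaRep k⟦X⟧ n) r
    = ENNReal.ofReal (1 + ((q : ℝ) ^ (r : ℕ) - 1)
            / (1 - ((q : ℝ) ^ (r : ℕ)) ^ (1 - (n : ℤ)))) := by
  have := charP_laurentSeries (resExt k r)
  unfold massW
  rw [baseChange_sigmaRep, mass_wFun_sigmaRep_closed (natCard_resExt hq r) hn, Nat.cast_pow]

/-- With `Q = q ^ r` the sum `1 + (Q - 1) / Q + 1 / Q` collapses to a constant. -/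
theorem massV_upsilonRep_one (r : ℕ+) : massV (upsilonRep k 1 1) r = ENNReal.ofReal 2 := by
  have := charP_laurentSeries (resExt k r)
  have hQ : (((q ^ (r : ℕ) : ℕ) : ℝ)) ≠ 0 := by
    rw [natCard_resExt hq r]
    exact_mod_cast Finite.card_pos.ne'
  unfold massV
  rw [baseChange_upsilonRep, mass_vFun_upsilonRep_one (natCard_resExt hq r)]
  congr 1
  field_simp
  ring

theorem massW_upsilonRep_one (r : ℕ+) :
    massW (upsilonRep k 1 1) r = ENNReal.ofReal (2 * (q : ℝ) ^ (r : ℕ)) := by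
  have := charP_laurentSeries (resExt k r)
  unfold massW
  rw [baseChange_upsilonRep, mass_wFun_upsilonRep_one (natCard_resExt hq r)]
  congr 1
  push_cast
  ring

end ScalarExtension

/-! ### Strong duality for `σ_n` and failure of weak duality for `υ_{1,1}` -/

section Duality

theorem zpow_rpow_eq (q : ℕ) (c : ℤ) (r : ℕ+) :
    (q : ℝ) ^ (((c : ℚ) : ℝ) * (r : ℝ)) = ((q : ℝ) ^ (r : ℕ)) ^ c := by
  rw [← zpow_natCast, ← zpow_mul, ← Real.rpow_intCast]
  push_cast
  rw [mul_comm]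

/-- The expression `r ↦ (n q^{a r} - n q^{b r}) / (q^{cr} - 1)`. -/
def binomialExpr {q : ℕ} (hq : q ≠ 0) (n a b c : ℤ) (hc : c ≠ 0) : AdmExpr where
  c := c
  c_ne := Int.cast_ne_zero.2 hc
  l := 2
  n := ![n, -n]
  α := ![(q : ℂ) ^ a, (q : ℂ) ^ b]
  α_ne := by
    have : (q : ℂ) ≠ 0 := Nat.cast_ne_zero.2 hq
    simp [Fin.forall_fin_two, zpow_ne_zero, this]

theorem binomialExpr_eval {q : ℕ} (hq : q ≠ 0) (n a b c : ℤ) (hc : c ≠ 0) (r : ℕ+) :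
    (binomialExpr hq n a b c hc).eval q r
      = ((n * (((q : ℝ) ^ (r : ℕ)) ^ a - ((q : ℝ) ^ (r : ℕ)) ^ b)
        / (((q : ℝ) ^ (r : ℕ)) ^ c - 1) : ℝ) : ℂ) := by
  have h := zpow_rpow_eq q c r
  change (∑ i : Fin 2, ((![n, -n] i : ℤ) : ℂ) * ![(q : ℂ) ^ a, (q : ℂ) ^ b] i ^ (r : ℕ))
    / (((q : ℝ) ^ (((c : ℚ) : ℝ) * (r : ℝ)) : ℝ) - 1) = _
  rw [Fin.sum_univ_two, h]
  have e : ∀ x : ℤ, ((q : ℂ) ^ x) ^ (r : ℕ) = ((q : ℂ) ^ (r : ℕ)) ^ x := fun x => by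
    rw [← zpow_natCast, ← zpow_natCast, ← zpow_mul, ← zpow_mul, mul_comm]
  simp only [Matrix.cons_val_zero, Matrix.cons_val_one, e]
  push_cast
  ring

theorem binomialExpr_evalDual {q : ℕ} (hq : q ≠ 0) (n a b c : ℤ) (hc : c ≠ 0) (r : ℕ+) :
    (binomialExpr hq n a b c hc).evalDual q r
      = ((n * (((q : ℝ) ^ (r : ℕ)) ^ (-a) - ((q : ℝ) ^ (r : ℕ)) ^ (-b))
        / (((q : ℝ) ^ (r : ℕ)) ^ (-c) - 1) : ℝ) : ℂ) := by
  have h := zpow_rpow_eq q (-c) r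
  rw [Int.cast_neg, Rat.cast_neg] at h
  change (∑ i : Fin 2, ((![n, -n] i : ℤ) : ℂ) * ![(q : ℂ) ^ a, (q : ℂ) ^ b] i ^ (-(r : ℤ)))
    / (((q : ℝ) ^ (-((c : ℚ) : ℝ) * (r : ℝ)) : ℝ) - 1) = _
  rw [Fin.sum_univ_two, h]
  have e : ∀ x : ℤ, ((q : ℂ) ^ x) ^ (-(r : ℤ)) = ((q : ℂ) ^ (r : ℕ)) ^ (-x) := fun x => by
    rw [← zpow_natCast, ← zpow_mul, ← zpow_mul]
    congr 1
    ring
  simp only [Matrix.cons_val_zero, Matrix.cons_val_one, e]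
  push_cast
  ring

/-- Rewrites the mass in the shape of `binomialExpr`, from which the dual can be read off;
`sigma_closed_w` does the same for the other mass. -/
theorem sigma_closed_v {Q : ℝ} (hQ : 1 < Q) {n : ℕ} (hn : 2 ≤ n) :
    1 + (Q - 1) * Q ^ (-(n : ℤ)) / (1 - Q ^ (1 - (n : ℤ)))
      = (Q ^ (-(n : ℤ)) - Q ^ (0 : ℤ)) / (Q ^ (1 - (n : ℤ)) - 1) := by
  have h1 : 1 - Q ^ (1 - (n : ℤ)) ≠ 0 :=
    (sub_pos.2 (zpow_lt_one_of_neg₀ hQ (by omega))).ne'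
  have h2 : Q ^ (1 - (n : ℤ)) = Q * Q ^ (-(n : ℤ)) := by
    rw [sub_eq_add_neg, zpow_one_add₀ (by positivity)]
  rw [← neg_sub 1 (Q ^ (1 - (n : ℤ))), div_neg, ← neg_div, eq_div_iff h1, add_mul,
    div_mul_cancel₀ _ h1, h2, zpow_zero]
  ring

theorem sigma_closed_w {Q : ℝ} (hQ : 1 < Q) {n : ℕ} (hn : 2 ≤ n) :
    1 + (Q - 1) / (1 - Q ^ (1 - (n : ℤ)))
      = (Q ^ (1 - (n : ℤ)) - Q ^ (1 : ℤ)) / (Q ^ (1 - (n : ℤ)) - 1) := by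
  have h1 : 1 - Q ^ (1 - (n : ℤ)) ≠ 0 :=
    (sub_pos.2 (zpow_lt_one_of_neg₀ hQ (by omega))).ne'
  rw [← neg_sub 1 (Q ^ (1 - (n : ℤ))), div_neg, ← neg_div, eq_div_iff h1, add_mul,
    div_mul_cancel₀ _ h1, zpow_one]
  ring

/-- Multiplying numerator and denominator by a power of `Q` and changing both signs. -/
theorem binomial_div_eq {Q : ℝ} (hQ : 1 < Q) (a b c a' b' : ℤ) (hc : c ≠ 0)
    (ha : a' = b + c) (hb : b' = a + c) :
    (Q ^ a' - Q ^ b') / (Q ^ c - 1) = (Q ^ a - Q ^ b) / (Q ^ (-c) - 1) := by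
  have hQ0 : Q ≠ 0 := by positivity
  have h : ∀ d : ℤ, d ≠ 0 → Q ^ d - 1 ≠ 0 := fun d hd h0 => hd <| by
    rw [← zpow_zero Q] at h0
    exact zpow_right_injective₀ (by positivity) hQ.ne' (sub_eq_zero.1 h0)
  rw [div_eq_div_iff (h c hc) (h _ (neg_ne_zero.2 hc)), ha, hb, zpow_add₀ hQ0, zpow_add₀ hQ0,
    zpow_neg]
  field_simp
  ring

variable {k : Type*} [Field k] [Finite k] [CharP k 2] {q : ℕ} (hq : q = Nat.card k)
include hq

/-- With `Q = q ^ r` the masses are `(Q^{-n} - 1) / (Q^{1-n} - 1)` and `(Q^{1-n} - Q) / (Q^{1-n} -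
1)`, and `Q ↦ Q⁻¹` exchanges them. Both duals being known, the weak duality holds term by term. -/
theorem sigmaRep_duality {n : ℕ} (hn : 2 ≤ n) :
    (∀ r, massV (sigmaRep k⟦X⟧ n) r ≠ ⊤) ∧
      (∀ r, massW (sigmaRep k⟦X⟧ n) r ≠ ⊤) ∧
      IsAdmissible q (toComplexFun (massV (sigmaRep k⟦X⟧ n))) ∧
      IsAdmissible q (toComplexFun (massW (sigmaRep k⟦X⟧ n))) ∧
      StrongDuality q (toComplexFun (massV (sigmaRep k⟦X⟧ n)))
        (toComplexFun (massW (sigmaRep k⟦X⟧ n))) ∧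
      WeakDuality q (2 * n) (toComplexFun (massV (sigmaRep k⟦X⟧ n)))
        (toComplexFun (massW (sigmaRep k⟦X⟧ n))) := by
  have hq1 : 1 < q := hq ▸ Finite.one_lt_card
  have hq0 : q ≠ 0 := by omega
  have hc : (1 - (n : ℤ)) ≠ 0 := by omega
  have hQ : ∀ r : ℕ+, 1 < (q : ℝ) ^ (r : ℕ) := fun r =>
    one_lt_pow₀ (by exact_mod_cast hq1) r.ne_zero
  have hV : ∀ r, toComplexFun (massV (sigmaRep k⟦X⟧ n)) r
      = (binomialExpr hq0 1 (-n) 0 _ hc).eval q r := fun r => by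
    have h0 := sub_pos.2 (hQ r)
    have h1 := sub_pos.2 (zpow_lt_one_of_neg₀ (hQ r) (show 1 - (n : ℤ) < 0 by omega))
    rw [binomialExpr_eval, Int.cast_one, one_mul, ← sigma_closed_v (hQ r) hn, toComplexFun,
      massV_sigmaRep hq hn, ENNReal.toReal_ofReal (by positivity)]
  have hW : ∀ r, toComplexFun (massW (sigmaRep k⟦X⟧ n)) r
      = (binomialExpr hq0 1 (1 - n) 1 _ hc).eval q r := fun r => by
    have h0 := sub_pos.2 (hQ r)
    have h1 := sub_pos.2 (zpow_lt_one_of_neg₀ (hQ r) (show 1 - (n : ℤ) < 0 by omega))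
    rw [binomialExpr_eval, Int.cast_one, one_mul, ← sigma_closed_w (hQ r) hn, toComplexFun,
      massW_sigmaRep hq hn, ENNReal.toReal_ofReal (by positivity)]
  have hDW : ∀ r, dual q (toComplexFun (massW (sigmaRep k⟦X⟧ n))) r
      = toComplexFun (massV (sigmaRep k⟦X⟧ n)) r := fun r => by
    rw [dual_eq q hq1 _ _ hW, hV, binomialExpr_evalDual, binomialExpr_eval, Int.cast_one, one_mul,
      one_mul]
    exact congrArg _ (binomial_div_eq (hQ r) _ _ _ _ _ hc (by ring) (by ring)).symm
  have hDV : ∀ r, dual q (toComplexFun (massV (sigmaRep k⟦X⟧ n))) r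
      = toComplexFun (massW (sigmaRep k⟦X⟧ n)) r := fun r => by
    rw [dual_eq q hq1 _ _ hV, hW, binomialExpr_evalDual, binomialExpr_eval, Int.cast_one, one_mul,
      one_mul]
    exact congrArg _ (binomial_div_eq (hQ r) _ _ _ _ _ hc (by ring) (by ring)).symm
  refine ⟨fun r => ?_, fun r => ?_, ⟨_, hV⟩, ⟨_, hW⟩, hDW, fun r => ?_⟩
  · rw [massV_sigmaRep hq hn]
    exact ENNReal.ofReal_ne_top
  · rw [massW_sigmaRep hq hn]
    exact ENNReal.ofReal_ne_top
  · rw [hDW, hDV]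

theorem upsilonRep_one_one_duality :
    (∀ r, massV (upsilonRep k 1 1) r ≠ ⊤) ∧
      (∀ r, massW (upsilonRep k 1 1) r ≠ ⊤) ∧
      IsAdmissible q (toComplexFun (massV (upsilonRep k 1 1))) ∧
      IsAdmissible q (toComplexFun (massW (upsilonRep k 1 1))) ∧
      ¬ WeakDuality q 4 (toComplexFun (massV (upsilonRep k 1 1)))
        (toComplexFun (massW (upsilonRep k 1 1))) := by
  have hq1 : 1 < q := hq ▸ Finite.one_lt_card
  have hq0 : q ≠ 0 := by omega
  have hQ : ∀ r : ℕ+, 1 < (q : ℝ) ^ (r : ℕ) := fun r =>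
    one_lt_pow₀ (by exact_mod_cast hq1) r.ne_zero
  have hV' : ∀ r, toComplexFun (massV (upsilonRep k 1 1)) r = 2 := fun r => by
    rw [toComplexFun, massV_upsilonRep_one hq, ENNReal.toReal_ofReal zero_le_two]
    rfl
  have hW' : ∀ r, toComplexFun (massW (upsilonRep k 1 1)) r
      = ((2 * (q : ℝ) ^ (r : ℕ) : ℝ) : ℂ) := fun r => by
    rw [toComplexFun, massW_upsilonRep_one hq, ENNReal.toReal_ofReal (by positivity)]
  -- An admissible expression needs `c ≠ 0`, so `2` is written as `2 (Q - 1) / (Q - 1)`, and below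
  -- `2 Q` as `2 (Q ^ 2 - Q) / (Q - 1)`.
  have hV : ∀ r, toComplexFun (massV (upsilonRep k 1 1)) r
      = (binomialExpr hq0 2 1 0 1 one_ne_zero).eval q r := fun r => by
    have h0 := (sub_pos.2 (hQ r)).ne'
    rw [hV', binomialExpr_eval, zpow_one, zpow_zero, mul_div_assoc, div_self h0]
    norm_num
  have hW : ∀ r, toComplexFun (massW (upsilonRep k 1 1)) r
      = (binomialExpr hq0 2 2 1 1 one_ne_zero).eval q r := fun r => by
    have h0 := (sub_pos.2 (hQ r)).ne'
    rw [hW', binomialExpr_eval, zpow_one, zpow_ofNat, sq, ← mul_sub_one, mul_div_assoc,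
      mul_div_assoc, div_self h0, mul_one]
    norm_num
  refine ⟨fun r => ?_, fun r => ?_, ⟨_, hV⟩, ⟨_, hW⟩, fun h => ?_⟩
  · rw [massV_upsilonRep_one hq]
    exact ENNReal.ofReal_ne_top
  · rw [massW_upsilonRep_one hq]
    exact ENNReal.ofReal_ne_top
  -- At `r = 1` the two sides are `2 q ^ 4 - 2 q` and `2 q ^ 3 - 2`, which differ by `2 (q - 1) (q ^
  -- 3 - 1) > 0`.
  · have h1 := h 1
    have hR : (1 : ℝ) < q := by exact_mod_cast hq1
    have hR0 : (q : ℝ) ≠ 0 := by positivity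
    have hinv : (q : ℝ)⁻¹ - 1 ≠ 0 := (sub_neg.2 (inv_lt_one_of_one_lt₀ hR)).ne
    have dV : dual q (toComplexFun (massV (upsilonRep k 1 1))) 1 = ((2 : ℝ) : ℂ) := by
      rw [dual_eq q hq1 _ _ hV, binomialExpr_evalDual]
      simp only [PNat.one_coe, pow_one, zpow_neg_one, neg_zero, zpow_zero]
      rw [mul_div_assoc, div_self hinv]
      norm_num
    have dW : dual q (toComplexFun (massW (upsilonRep k 1 1))) 1 = ((2 * (q : ℝ)⁻¹ : ℝ) : ℂ) := by
      rw [dual_eq q hq1 _ _ hW, binomialExpr_evalDual]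
      simp only [PNat.one_coe, pow_one, zpow_neg, zpow_ofNat]
      rw [sq, mul_inv, ← mul_sub_one, mul_div_assoc, mul_div_assoc, div_self hinv, mul_one]
      norm_num
    rw [hV', hW', dV, dW, PNat.one_coe, one_mul, pow_one] at h1
    have h2 : 2 * (q : ℝ) ^ 4 - 2 * q = 2 * (q : ℝ)⁻¹ * q ^ 4 - 2 := by exact_mod_cast h1
    have h3 : (q : ℝ)⁻¹ * q ^ 4 = q ^ 3 := by field_simp
    have h4 : 0 < ((q : ℝ) - 1) * (q ^ 3 - 1) :=
      mul_pos (sub_pos.2 hR) (sub_pos.2 (one_lt_pow₀ hR three_ne_zero))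
    rw [mul_assoc 2, h3] at h2
    linarith

end Duality

end TotalMass

end

/-! ### The theorem, with conductors translated into discriminants -/

open TotalMass in
theorem mainTheorem6 (k : Type*) [Field k] [Finite k] [CharP k 2] (q : ℕ) (hq : q = Nat.card k) :
    -- the quadratic extensions of `K = k((t))`, by discriminant
    (∀ ρ : GalHom k⸨X⸩ (Multiplicative (ZMod 2)), ∃ i : ℕ,
      discrIdeal k⟦X⟧ ρ = IsLocalRing.maximalIdeal k⟦X⟧ ^ (2 * i)) ∧
    {ρ : GalHom k⸨X⸩ (Multiplicative (ZMod 2)) | discrIdeal k⟦X⟧ ρ = ⊤}.ncard = 2 ∧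
    (∀ i : ℕ, 1 ≤ i → {ρ : GalHom k⸨X⸩ (Multiplicative (ZMod 2)) |
      discrIdeal k⟦X⟧ ρ = IsLocalRing.maximalIdeal k⟦X⟧ ^ (2 * i)}.ncard
        = 2 * (q - 1) * q ^ (i - 1)) ∧
    -- the tuning submodules are free of the right rank and the lengths are finite
    (∀ ρ : GalHom k⸨X⸩ (Multiplicative (ZMod 2)),
      (∀ n : ℕ, 1 ≤ n →
        Nonempty (Module.Basis (Fin 2 × Fin n) k⟦X⟧ (tuning (sigmaRep k⟦X⟧ n) ρ)) ∧
          tuningLength (sigmaRep k⟦X⟧ n) ρ ≠ ⊤) ∧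
      (∀ m : ℕ, Nonempty (Module.Basis (Fin 2) k⟦X⟧ (tuning (tauRep k m) ρ)) ∧
          tuningLength (tauRep k m) ρ ≠ ⊤) ∧
      (∀ m n : ℕ, 1 ≤ n →
        Nonempty (Module.Basis (Fin 2 ⊕ Fin 2 × Fin n) k⟦X⟧ (tuning (upsilonRep k m n) ρ)) ∧
          tuningLength (upsilonRep k m n) ρ ≠ ⊤)) ∧
    -- the values of `v` and `w` on an extension of discriminant `m_K ^ (2 i)`
    (∀ (ρ : GalHom k⸨X⸩ (Multiplicative (ZMod 2))) (i : ℕ),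
      discrIdeal k⟦X⟧ ρ = IsLocalRing.maximalIdeal k⟦X⟧ ^ (2 * i) →
      (∀ n : ℕ, 1 ≤ n →
        vFun (sigmaRep k⟦X⟧ n) ρ = (n : ℝ) * i ∧
        wFun (sigmaRep k⟦X⟧ n) ρ = if i = 0 then 0 else (n : ℝ) - n * i) ∧
      (∀ m : ℕ,
        (vFun (tauRep k m) ρ = if i ≤ m then 0 else (i : ℝ) - m) ∧
        (wFun (tauRep k m) ρ = if i ≤ m then 0 else 1 - (i : ℝ) + m)) ∧
      (∀ m n : ℕ, 1 ≤ n →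
        vFun (upsilonRep k m n) ρ = vFun (tauRep k m) ρ + vFun (sigmaRep k⟦X⟧ n) ρ ∧
        wFun (upsilonRep k m n) ρ = wFun (tauRep k m) ρ + wFun (sigmaRep k⟦X⟧ n) ρ)) ∧
    -- total masses for `σ_n`
    (∀ n : ℕ, 1 ≤ n →
      mass k⟦X⟧ (K := k⸨X⸩) (vFun (sigmaRep k⟦X⟧ n))
        = 1 + ∑' i : Set.Ioi (0 : ℕ), ENNReal.ofReal
            (((q : ℝ) - 1) * (q : ℝ) ^ ((i : ℤ) - 1) * (q : ℝ) ^ (-((i : ℤ) * n))) ∧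
      mass k⟦X⟧ (K := k⸨X⸩) (fun ρ => -wFun (sigmaRep k⟦X⟧ n) ρ)
        = 1 + ∑' i : Set.Ioi (0 : ℕ), ENNReal.ofReal
            (((q : ℝ) - 1) * (q : ℝ) ^ ((i : ℤ) - 1) * (q : ℝ) ^ (-((i : ℤ) * n) + n))) ∧
    mass k⟦X⟧ (K := k⸨X⸩) (vFun (sigmaRep k⟦X⟧ 1)) = ⊤ ∧
    mass k⟦X⟧ (K := k⸨X⸩) (fun ρ => -wFun (sigmaRep k⟦X⟧ 1) ρ) = ⊤ ∧
    (∀ n : ℕ, 2 ≤ n →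
      mass k⟦X⟧ (K := k⸨X⸩) (vFun (sigmaRep k⟦X⟧ n))
        = ENNReal.ofReal (1 + ((q : ℝ) - 1) * (q : ℝ) ^ (-(n : ℤ))
            / (1 - (q : ℝ) ^ (1 - (n : ℤ)))) ∧
      mass k⟦X⟧ (K := k⸨X⸩) (fun ρ => -wFun (sigmaRep k⟦X⟧ n) ρ)
        = ENNReal.ofReal (1 + ((q : ℝ) - 1) / (1 - (q : ℝ) ^ (1 - (n : ℤ))))) ∧
    -- the strong duality, and hence the weak one, for `σ_n`
    (∀ n : ℕ, 2 ≤ n →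
      (∀ r, massV (sigmaRep k⟦X⟧ n) r ≠ ⊤) ∧
      (∀ r, massW (sigmaRep k⟦X⟧ n) r ≠ ⊤) ∧
      IsAdmissible q (toComplexFun (massV (sigmaRep k⟦X⟧ n))) ∧
      IsAdmissible q (toComplexFun (massW (sigmaRep k⟦X⟧ n))) ∧
      StrongDuality q (toComplexFun (massV (sigmaRep k⟦X⟧ n)))
        (toComplexFun (massW (sigmaRep k⟦X⟧ n))) ∧
      WeakDuality q (2 * n) (toComplexFun (massV (sigmaRep k⟦X⟧ n)))
        (toComplexFun (massW (sigmaRep k⟦X⟧ n)))) ∧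
    -- total masses for `υ_{m,n}`
    (∀ m n : ℕ, 1 ≤ n →
      mass k⟦X⟧ (K := k⸨X⸩) (vFun (upsilonRep k m n))
        = 1 + (∑ i ∈ Finset.Icc 1 m, ENNReal.ofReal
            (((q : ℝ) - 1) * (q : ℝ) ^ ((i : ℤ) - 1) * (q : ℝ) ^ (-((i : ℤ) * n))))
          + ∑' i : Set.Ioi m, ENNReal.ofReal
            (((q : ℝ) - 1) * (q : ℝ) ^ ((i : ℤ) - 1) * (q : ℝ) ^ (-(i : ℤ) + m - (i : ℤ) * n)) ∧
      mass k⟦X⟧ (K := k⸨X⸩) (fun ρ => -wFun (upsilonRep k m n) ρ)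
        = 1 + (∑ i ∈ Finset.Icc 1 m, ENNReal.ofReal
            (((q : ℝ) - 1) * (q : ℝ) ^ ((i : ℤ) - 1) * (q : ℝ) ^ (-((i : ℤ) * n) + n)))
          + ∑' i : Set.Ioi m, ENNReal.ofReal
            (((q : ℝ) - 1) * (q : ℝ) ^ ((i : ℤ) - 1)
              * (q : ℝ) ^ (1 - (i : ℤ) + m - (i : ℤ) * n + n))) ∧
    (∀ m n : ℕ, 2 ≤ n →
      mass k⟦X⟧ (K := k⸨X⸩) (vFun (upsilonRep k m n))
        = ENNReal.ofReal (1
          + ((q : ℝ) - 1) * (q : ℝ) ^ (-(n : ℤ))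
            * ((1 - (q : ℝ) ^ ((1 - (n : ℤ)) * m)) / (1 - (q : ℝ) ^ (1 - (n : ℤ))))
          + ((q : ℝ) - 1)
            * ((q : ℝ) ^ ((m : ℤ) - (m + 1) * n - 1) / (1 - (q : ℝ) ^ (-(n : ℤ))))) ∧
      mass k⟦X⟧ (K := k⸨X⸩) (fun ρ => -wFun (upsilonRep k m n) ρ)
        = ENNReal.ofReal (1
          + ((q : ℝ) - 1)
            * ((1 - (q : ℝ) ^ ((1 - (n : ℤ)) * m)) / (1 - (q : ℝ) ^ (1 - (n : ℤ))))
          + ((q : ℝ) - 1) * ((q : ℝ) ^ ((m : ℤ) - m * n) / (1 - (q : ℝ) ^ (-(n : ℤ)))))) ∧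
    (∀ m : ℕ,
      mass k⟦X⟧ (K := k⸨X⸩) (vFun (upsilonRep k m 1))
        = ENNReal.ofReal (1 + m * ((q : ℝ) - 1) / q + 1 / q) ∧
      mass k⟦X⟧ (K := k⸨X⸩) (fun ρ => -wFun (upsilonRep k m 1) ρ)
        = ENNReal.ofReal (1 + m * ((q : ℝ) - 1) + q)) ∧
    -- the weak duality fails for `(m, n) = (1, 1)`
    ((∀ r, massV (upsilonRep k 1 1) r ≠ ⊤) ∧
      (∀ r, massW (upsilonRep k 1 1) r ≠ ⊤) ∧
      IsAdmissible q (toComplexFun (massV (upsilonRep k 1 1))) ∧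
      IsAdmissible q (toComplexFun (massW (upsilonRep k 1 1))) ∧
      ¬ WeakDuality q 4 (toComplexFun (massV (upsilonRep k 1 1)))
        (toComplexFun (massW (upsilonRep k 1 1)))) := by
  have := charP_laurentSeries k
  refine ⟨fun ρ => ?_, ?_, fun i hi => ?_, fun ρ => ?_, fun ρ i h => ?_,
    fun n _ => ⟨mass_vFun_sigmaRep hq n, mass_wFun_sigmaRep hq n⟩,
    mass_vFun_sigmaRep_one hq, mass_wFun_sigmaRep_one hq,
    fun n hn => ⟨mass_vFun_sigmaRep_closed hq hn, mass_wFun_sigmaRep_closed hq hn⟩,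
    fun n hn => sigmaRep_duality hq hn,
    fun m n _ => ⟨mass_vFun_upsilonRep hq m n, mass_wFun_upsilonRep hq m n⟩,
    fun m n hn => ?_,
    fun m => ⟨mass_vFun_upsilonRep_one hq m, mass_wFun_upsilonRep_one hq m⟩,
    upsilonRep_one_one_duality hq⟩
  · obtain ⟨i, hi⟩ := exists_hasConductor (k := k) ρ
    exact ⟨i, (hasConductor_iff ρ i).1 hi⟩
  · refine Eq.trans (congrArg Set.ncard (Set.ext fun ρ => ?_))
      (ncard_hasConductor_zero (k := k) (K := k⸨X⸩))
    rw [Set.mem_ofPred_eq, Set.mem_ofPred_eq, hasConductor_iff, mul_zero, pow_zero,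
      Ideal.one_eq_top]
  · obtain ⟨j, rfl⟩ := Nat.exists_eq_add_of_le' hi
    rw [Nat.add_sub_cancel, hq, ← ncard_hasConductor_succ (k := k) (K := k⸨X⸩) j]
    congr 1
    ext ρ
    rw [Set.mem_ofPred_eq, Set.mem_ofPred_eq, hasConductor_iff]
  · obtain ⟨i, hi⟩ := exists_hasConductor (k := k) ρ
    exact ⟨fun n _ => (isTuned_sigmaRep hi n).basis_and_length hi,
      fun m => (isTuned_tauRep hi m).basis_and_length hi,
      fun m n _ => (isTuned_upsilonRep hi m n).basis_and_length hi⟩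
  · have hi := (hasConductor_iff ρ i).2 h
    exact ⟨fun n _ => ⟨vFun_sigmaRep hi n, wFun_sigmaRep hi n⟩,
      fun m => ⟨vFun_tauRep hi m, wFun_tauRep hi m⟩,
      fun m n _ => ⟨vFun_upsilonRep hi m n, wFun_upsilonRep hi m n⟩⟩
  · have hQ : (1 : ℝ) < q := by exact_mod_cast (hq ▸ Finite.one_lt_card : 1 < q)
    rw [mass_vFun_upsilonRep_geom hq m (by omega), mass_wFun_upsilonRep_geom hq m (by omega),
      geom_sum_zpow hQ m (by omega)]
    exact ⟨rfl, rfl⟩
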